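/- Let $\mathbb{K}$ be a field of characteristic zero, let $r,s\in\mathbb{N}$, and let $\mathcal{S}$ be a signature (a set of generators with arities) of profile $0^{r+1}s0\dots$, that is, $\mathcal{S}$ has exactly $s$ generators, all of arity $r+1$. **Definitions.** Let $\mathfrak{T}\mathcal{S}$ be the free nonsymmetric operad on $\mathcal{S}$: its elements are the planar rooted trees whose internal nodes with $n$ children are decorated by generators of arity $n$, the arity is the number of leaves, the composition $\mathfrak{t}[\mathfrak{s}_1,\dots,\mathfrak{s}_n]$ grafts $\mathfrak{s}_i$ onto the $i$-th leaf, the unit is the tree reduced to a leaf, and the degree is the number of internal nodes. Let $\mathsf{MAs}_{\mathcal{S}}$ be the quotient of $\mathfrak{T}\mathcal{S}$ by the smallest operad congruence $\equiv$ such that $\mathsf{g}\circ_i\mathsf{g}'\equiv\mathsf{g}'\circ_{i'}\mathsf{g}$ for all generators $\mathsf{g},\mathsf{g}'$ and all positions $i,i'$; the degree passes to the quotient. For an operad $\mathcal{O}$ with unit $\mathbf 1$, $\mathbf{N}\mathcal{O}$ is the $\mathbb{K}$-vector space with basis $(\mathsf{E}_w)$, $w$ running over the words on $\mathcal{O}\setminus\{\mathbf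 1\}$, with the product $\mathsf{E}_w\mathsf{E}_{w'}=\mathsf{E}_{ww'}$, the counit $\varepsilon(\mathsf{E}_w)=1$ if $w$ is empty and $0$ otherwise, and the coproduct $\Delta$ which is the algebra morphism such that, for $x\in\mathcal{O}\setminus\{\mathbf 1\}$, $$\Delta\mathsf{E}_x=\sum_{x=y[w_1,\dots,w_{n}]}\mathsf{E}_{\mathrm{rd}(y)}\otimes\mathsf{E}_{\mathrm{rd}(w_1\cdots w_{n})},$$ where the sum is over the factorizations of $x$ ($n$ being the arity of $y$) and $\mathrm{rd}$ deletes the letters $\mathbf 1$. By definition $\mathbf{FdB}_{r,s}=\mathbf{N}\,\mathsf{MAs}_{\mathcal{S}}$. It is embedded in $\mathbf{N}\,\mathfrak{T}\mathcal{S}$ by sending $\mathsf{E}_w$ to the sum of the $\mathsf{E}_{\mathfrak{f}}$ over all words $\mathfrak{f}$ of trees whose letters represent the letters of $w$. An $\mathcal{S}$-forest-like alphabet is a set $A$ with unary relations $\mathrm{R}$ (root) and $\mathrm{D}_{\mathsf{g}}$ ($\mathsf{g}\in\mathcal{S}$) and binary relations $\to_j$ ($j\ge1$). The disjoint sum $A+A'$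 is the disjoint union with the unions of the unary relations, and with $a_1\to_j a_2$ if this holds in $A$ or in $A'$, or if $a_1\in A$, $a_2\in A'$ and $a_2$ is a root letter of $A'$. Let $\mathbb{K}\langle A\rangle$ be the algebra of noncommutative polynomials on $A$ of finite degree with possibly infinite support. Let $\mathsf{r}_A:\mathbf{N}\,\mathfrak{T}\mathcal{S}\to\mathbb{K}\langle A\rangle$ be the linear map sending $\mathsf{E}_{\mathfrak{f}}$ to the sum of all words $w$ on $A$ whose length is the number of internal nodes of $\mathfrak{f}$ and such that, the nodes being numbered in preorder, $w_i\in\mathrm{R}$ if node $i$ is a root, $w_i\in\mathrm{D}_{\mathsf{g}}$ if node $i$ is decorated by $\mathsf{g}$, and $w_i\to_j w_{i'}$ if node $i'$ is the $j$-th child of node $i$. Restrict $\mathsf{r}_A$ to $\mathbf{N}\,\mathsf{MAs}_{\mathcal{S}}$ through the embedding. Let $\theta_{A,A'}$ be the linear map, compatible with infinite sums, that sends a word $w$ on $A\sqcup A'$ to $w_{|A}\otimes w_{|A'}$. Finally let $\mathbb{A}_{\mathcal{S},\mathbb{N}}=\{\mathbf{a}_{\mathsf{g},i}:\mathsf{g}\in\mathcal{S},\,i\in\mathbb{N}\}$,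 where every letter is a root, $\mathrm{D}_{\mathsf{g}}=\{\mathbf{a}_{\mathsf{g},i}:i\in\mathbb{N}\}$, and $\mathbf{a}_{\mathsf{g},i}\to_j\mathbf{a}_{\mathsf{g}',i'}$ if and only if $i<i'$. **Theorem.** 1. The operad $\mathsf{MAs}_{\mathcal{S}}$ is finitely factorizable and graded by the degree, each class of $\equiv$ is finite, and $\mathbf{FdB}_{r,s}=\mathbf{N}\,\mathsf{MAs}_{\mathcal{S}}$ is a Hopf algebra. 2. Put $\mathbb{A}=\mathbb{A}_{\mathcal{S},\mathbb{N}}$. The image $\mathsf{r}_{\mathbb{A}}(\mathbf{N}\,\mathsf{MAs}_{\mathcal{S}})$ is a subalgebra of $\mathbb{K}\langle\mathbb{A}\rangle$; it is a Hopf algebra for the coproduct sending $\mathsf{r}_{\mathbb{A}}(x)$ to $\theta_{\mathbb{A},\mathbb{A}}(\mathsf{r}_{\mathbb{A}+\mathbb{A}}(x))$, and $\mathsf{r}_{\mathbb{A}}$ is an isomorphism of Hopf algebras from $\mathbf{FdB}_{r,s}$ onto it. 3. The class of $\mathcal{S}$-forest-like alphabets, the disjoint sum, the maps $\mathsf{r}_A$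 and the alphabet $\mathbb{A}_{\mathcal{S},\mathbb{N}}$ form a polynomial realization of $\mathbf{FdB}_{r,s}$: the disjoint sum is associative (up to the canonical bijection), every $\mathsf{r}_A$ sends elements of degree $n$ to homogeneous polynomials of degree $n$, one has $\theta_{A,A'}(\mathsf{r}_{A+A'}(x))=(\mathsf{r}_A\otimes\mathsf{r}_{A'})(\Delta x)$ for all $A$, $A'$ and $x$, and $\mathsf{r}_{\mathbb{A}_{\mathcal{S},\mathbb{N}}}$ is injective. -/

import Mathlib

universe u u' v w w'
open scoped TensorProduct

/-- A nonsymmetric operad in sets: a set of operations `carrier` with an arity map, a unit and the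
full composition maps `y[z₁, …, z_n]`, `n = ar y`. -/
structure NSOperad where
  carrier : Type u
  ar : carrier → ℕ
  one : carrier
  comp : (y : carrier) → (Fin (ar y) → carrier) → carrier
  ar_one : ar one = 1
  ar_comp : ∀ y z, ar (comp y z) = ∑ i, ar (z i)
  one_comp : ∀ x, comp one (fun _ => x) = x
  comp_one : ∀ y, comp y (fun _ => one) = y
  assoc : ∀ (y : carrier) (z : Fin (ar y) → carrier) (w : Fin (ar (comp y z)) → carrier),
    comp (comp y z) w =
      comp y fun i => comp (z i) fun j =>
        w (Fin.cast (ar_comp y z).symm (finSigmaFinEquiv ⟨i, j⟩))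

namespace NSOperad

/-- The partial composition `x ∘ᵢ y = x[1, …, 1, y, 1, …, 1]`, with `y` in position `i`. -/
def pcomp (O : NSOperad.{u}) (x : O.carrier) (i : Fin (O.ar x)) (y : O.carrier) : O.carrier :=
  O.comp x fun k => if k = i then y else O.one

theorem comp_congr (O : NSOperad.{u}) {y y' : O.carrier} (h : y = y')
    (z : Fin (O.ar y) → O.carrier) (z' : Fin (O.ar y') → O.carrier)
    (hz : ∀ (i : Fin (O.ar y)) (i' : Fin (O.ar y')), (i : ℕ) = i' → z i = z' i') :
    O.comp y z = O.comp y' z' := by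
  subst h
  congr 1
  funext i
  exact hz i i rfl

/-- An operad congruence: an equivalence relation which is compatible with the arities and with the
composition maps. -/
structure Congruence (O : NSOperad.{u}) where
  rel : O.carrier → O.carrier → Prop
  iseqv : Equivalence rel
  ar_eq : ∀ {x y}, rel x y → O.ar x = O.ar y
  comp_rel : ∀ {y y'} (z : Fin (O.ar y) → O.carrier) (z' : Fin (O.ar y') → O.carrier), rel y y' →
    (∀ (i : Fin (O.ar y)) (i' : Fin (O.ar y')), (i : ℕ) = i' → rel (z i) (z' i')) →
    rel (O.comp y z) (O.comp y' z')

/-- The smallest relation containing `R` and satisfying the axioms of an operad congruence. -/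
inductive CongrGen (O : NSOperad.{u}) (R : O.carrier → O.carrier → Prop) :
    O.carrier → O.carrier → Prop
  | of {x y : O.carrier} : R x y → CongrGen O R x y
  | refl (x : O.carrier) : CongrGen O R x x
  | symm {x y : O.carrier} : CongrGen O R x y → CongrGen O R y x
  | trans {x y z : O.carrier} : CongrGen O R x y → CongrGen O R y z → CongrGen O R x z
  | comp {y y' : O.carrier} (z : Fin (O.ar y) → O.carrier) (z' : Fin (O.ar y') → O.carrier) :
      CongrGen O R y y' →
      (∀ (i : Fin (O.ar y)) (i' : Fin (O.ar y')), (i : ℕ) = i' → CongrGen O R (z i) (z' i')) →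
      CongrGen O R (O.comp y z) (O.comp y' z')

theorem sum_fin_eq {m n : ℕ} (h : m = n) (f : Fin m → ℕ) (g : Fin n → ℕ)
    (hfg : ∀ (i : Fin m) (i' : Fin n), (i : ℕ) = i' → f i = g i') : ∑ i, f i = ∑ i, g i := by
  subst h
  exact Finset.sum_congr rfl fun i _ => hfg i i rfl

/-- The operad congruence generated by an arity-preserving relation. -/
def congrGen (O : NSOperad.{u}) (R : O.carrier → O.carrier → Prop)
    (hR : ∀ x y, R x y → O.ar x = O.ar y) : O.Congruence where
  rel := CongrGen O R
  iseqv := ⟨.refl, .symm, .trans⟩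
  ar_eq := by
    intro x y h
    induction h with
    | of h => exact hR _ _ h
    | refl => rfl
    | symm _ ih => exact ih.symm
    | trans _ _ ih1 ih2 => exact ih1.trans ih2
    | comp z z' _ _ ih1 ih2 =>
      rw [O.ar_comp, O.ar_comp]
      exact sum_fin_eq ih1 _ _ ih2
  comp_rel := fun z z' h hz => .comp z z' h hz

namespace Congruence

variable {O : NSOperad.{u}} (C : O.Congruence)

/-- The equivalence relation underlying an operad congruence. -/
def toSetoid : Setoid O.carrier := ⟨C.rel, C.iseqv⟩

/-- The set of equivalence classes of an operad congruence. -/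
def Quo : Type u := Quotient C.toSetoid

/-- The equivalence class of an operation. -/
def cls (x : O.carrier) : C.Quo := Quotient.mk C.toSetoid x

/-- A representative of an equivalence class. -/
noncomputable def out (q : C.Quo) : O.carrier := Quotient.out q

theorem cls_out (q : C.Quo) : C.cls (C.out q) = q := Quotient.out_eq q

theorem cls_eq {x y : O.carrier} : C.cls x = C.cls y ↔ C.rel x y :=
  ⟨fun h => Quotient.exact (s := C.toSetoid) h, fun h => Quotient.sound (s := C.toSetoid) h⟩

theorem out_cls (x : O.carrier) : C.rel (C.out (C.cls x)) x := C.cls_eq.1 (C.cls_out _)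

/-- The arity of an equivalence class. -/
def quoAr : C.Quo → ℕ := Quotient.lift O.ar fun _ _ h => C.ar_eq h

theorem ar_out (q : C.Quo) : O.ar (C.out q) = C.quoAr q :=
  congrArg C.quoAr (C.cls_out q)

/-- The composition of equivalence classes, computed on representatives. -/
noncomputable def quoComp (q : C.Quo) (w : Fin (C.quoAr q) → C.Quo) : C.Quo :=
  C.cls (O.comp (C.out q) fun i => C.out (w (Fin.cast (C.ar_out q) i)))

/-- The composition of equivalence classes does not depend on the representatives. -/
theorem quoComp_cls (y : O.carrier) (z : Fin (O.ar y) → O.carrier)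
    (w : Fin (C.quoAr (C.cls y)) → C.Quo)
    (h : ∀ (i : Fin (C.quoAr (C.cls y))) (i' : Fin (O.ar y)), (i : ℕ) = i' → w i = C.cls (z i')) :
    C.quoComp (C.cls y) w = C.cls (O.comp y z) := by
  refine C.cls_eq.2 (C.comp_rel _ _ (C.out_cls y) fun i i' hi => ?_)
  rw [h _ i' (by simpa using hi)]
  exact C.out_cls _

theorem exists_rep (q : C.Quo) : ∃ x, q = C.cls x := ⟨_, (C.cls_out q).symm⟩

theorem quoAr_comp (q : C.Quo) (w : Fin (C.quoAr q) → C.Quo) :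
    C.quoAr (C.quoComp q w) = ∑ i, C.quoAr (w i) := by
  refine (O.ar_comp _ _).trans (sum_fin_eq (C.ar_out q) _ _ fun i i' h => ?_)
  rw [C.ar_out]
  congr 2
  exact Fin.ext h

/-- The quotient of an operad by an operad congruence. -/
noncomputable def quotient : NSOperad.{u} where
  carrier := C.Quo
  ar := C.quoAr
  one := C.cls O.one
  comp := C.quoComp
  ar_one := O.ar_one
  ar_comp := C.quoAr_comp
  one_comp := by
    intro q
    obtain ⟨x, rfl⟩ := C.exists_rep q
    rw [C.quoComp_cls O.one (fun _ => x) _ fun _ _ _ => rfl, O.one_comp]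
  comp_one := by
    intro q
    obtain ⟨x, rfl⟩ := C.exists_rep q
    rw [C.quoComp_cls x (fun _ => O.one) _ fun _ _ _ => rfl, O.comp_one]
  assoc := by
    intro q w v
    obtain ⟨y, rfl⟩ := C.exists_rep q
    have hw : w = fun i => C.cls (C.out (w i)) := funext fun i => (C.cls_out _).symm
    obtain ⟨z, hz⟩ : ∃ z : Fin (O.ar y) → O.carrier, (fun i => C.out (w i)) = z := ⟨_, rfl⟩
    have hw' : w = fun i => C.cls (z i) := by subst hz; exact hw
    clear hw hz
    subst hw'
    have e : C.quoComp (C.cls y) (fun i => C.cls (z i)) = C.cls (O.comp y z) :=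
      C.quoComp_cls y z _ fun i i' h => by rw [Fin.ext h]
    have har : O.ar (O.comp y z) = C.quoAr (C.quoComp (C.cls y) (fun i => C.cls (z i))) :=
      (congrArg C.quoAr e).symm
    have key : ∀ (q' : C.Quo) (hq : q' = C.cls (O.comp y z)) (v : Fin (C.quoAr q') → C.Quo),
        C.quoComp q' v = C.cls (O.comp (O.comp y z) fun i =>
          C.out (v (Fin.cast (congrArg C.quoAr hq).symm i))) := by
      intro q' hq v
      subst hq
      refine C.quoComp_cls _ _ _ fun i i' h => ?_
      rw [C.cls_out]
      congr 1
      exact Fin.ext h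
    refine (key _ e v).trans ((congrArg C.cls (O.assoc y z _)).trans ?_)
    symm
    refine C.quoComp_cls y _ _ fun i i' h => ?_
    obtain rfl : i = i' := Fin.ext h
    refine C.quoComp_cls (z i) _ _ fun j j' h => ?_
    obtain rfl : j = j' := Fin.ext h
    rw [C.cls_out]
    rfl

end Congruence

end NSOperad

/-! ## Terms -/

/-- Terms on a signature `S`, where `S n` is the set of generators of arity `n`: planar rooted trees
whose internal nodes with `n` children are decorated by elements of `S n`. -/
inductive STerm (S : ℕ → Type u) : Type u
  | leaf : STerm S
  | node {n : ℕ} (g : S n) (ts : Fin n → STerm S) : STerm S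

namespace STerm

variable {S : ℕ → Type u}

/-- The arity of a term: its number of leaves. -/
def ar : STerm S → ℕ
  | leaf => 1
  | node _ ts => ∑ i, ar (ts i)

/-- The degree of a term: its number of internal nodes. -/
def deg : STerm S → ℕ
  | leaf => 0
  | node _ ts => 1 + ∑ i, deg (ts i)

/-- Grafting `s i` onto the `i`-th leaf of `t`. -/
def graft : (t : STerm S) → (Fin t.ar → STerm S) → STerm S
  | leaf, s => s ⟨0, Nat.one_pos⟩
  | node g ts, s => node g fun i => graft (ts i) fun j => s (finSigmaFinEquiv ⟨i, j⟩)

/-- The term with a single internal node, decorated by `g`. -/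
def corolla {n : ℕ} (g : S n) : STerm S := node g fun _ => leaf

theorem sum_finSigma {m : ℕ} {n : Fin m → ℕ} (f : Fin (∑ i, n i) → ℕ) :
    ∑ p, f p = ∑ i, ∑ j, f (finSigmaFinEquiv ⟨i, j⟩) := by
  rw [← finSigmaFinEquiv.sum_comp, Fintype.sum_sigma]

theorem ar_graft (t : STerm S) (s : Fin t.ar → STerm S) : (graft t s).ar = ∑ i, (s i).ar := by
  induction t with
  | leaf => exact (Fin.sum_univ_one fun i : Fin 1 => (s i).ar).symm
  | node g ts ih =>
    refine (Finset.sum_congr rfl fun i _ => ih i _).trans ?_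
    exact (sum_finSigma (n := fun i => (ts i).ar) fun p => (s p).ar).symm

theorem deg_graft (t : STerm S) (s : Fin t.ar → STerm S) :
    (graft t s).deg = t.deg + ∑ i, (s i).deg := by
  induction t with
  | leaf =>
    refine Eq.trans ?_ (zero_add _).symm
    exact (Fin.sum_univ_one fun i : Fin 1 => (s i).deg).symm
  | node g ts ih =>
    refine (congrArg (1 + ·) (Finset.sum_congr rfl fun i _ => ih i _)).trans ?_
    rw [Finset.sum_add_distrib, ← add_assoc]
    refine congrArg (1 + ∑ i, (ts i).deg + ·) ?_
    exact (sum_finSigma (n := fun i => (ts i).ar) fun p => (s p).deg).symm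

theorem graft_leaf (t : STerm S) : graft t (fun _ => leaf) = t := by
  induction t with
  | leaf => rfl
  | node g ts ih =>
    change node g (fun i => graft (ts i) fun _ => leaf) = _
    simp_rw [ih]

theorem sum_fin_castLE {N : ℕ} (b : Fin N → ℕ) (p : ℕ) (hp : p ≤ N) :
    ∑ i : Fin p, b (Fin.castLE hp i) = ∑ i ∈ Finset.range p, if h : i < N then b ⟨i, h⟩ else 0 := by
  rw [Finset.sum_range]
  refine Finset.sum_congr rfl fun i _ => ?_
  rw [dif_pos (lt_of_lt_of_le i.2 hp)]
  rfl

/-- Comparison of the two ways of numbering the elements of an iterated sum. -/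
theorem finSigma_assoc {m : ℕ} {n : Fin m → ℕ} (a : Fin (∑ i, n i) → ℕ) (i : Fin m) (k : Fin (n i))
    (l : Fin (a (finSigmaFinEquiv ⟨i, k⟩))) (N : Fin m → ℕ)
    (hN : ∀ i, N i = ∑ k, a (finSigmaFinEquiv ⟨i, k⟩)) (l' : Fin (N i))
    (hl : (l' : ℕ) = finSigmaFinEquiv (n := fun k => a (finSigmaFinEquiv ⟨i, k⟩)) ⟨k, l⟩) :
    (finSigmaFinEquiv (n := N) ⟨i, l'⟩ : ℕ) =
      finSigmaFinEquiv (n := a) ⟨finSigmaFinEquiv ⟨i, k⟩, l⟩ := by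
  obtain rfl : N = _ := funext hN
  obtain rfl := Fin.ext hl
  set b : ℕ → ℕ := fun p => if h : p < ∑ i, n i then a ⟨p, h⟩ else 0 with hb
  have hoff : ∀ (i : Fin m), ∀ c, c ≤ n i →
      ∑ p ∈ Finset.range (∑ i' : Fin i, n (Fin.castLE i.2.le i') + c), b p =
      ∑ p ∈ Finset.range (∑ i' : Fin i, n (Fin.castLE i.2.le i')), b p +
        ∑ k ∈ Finset.range c, if h : k < n i then a (finSigmaFinEquiv ⟨i, ⟨k, h⟩⟩) else 0 := by
    intro i c hc
    rw [Finset.sum_range_add]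
    congr 1
    refine Finset.sum_congr rfl fun k hk => ?_
    have hk' : k < n i := lt_of_lt_of_le (Finset.mem_range.1 hk) hc
    rw [dif_pos hk']
    have hv := finSigmaFinEquiv_apply (n := n) ⟨i, ⟨k, hk'⟩⟩
    have hlt : ∑ i' : Fin i, n (Fin.castLE i.2.le i') + k < ∑ i, n i := by
      rw [← hv]; exact (finSigmaFinEquiv _).2
    simp only [hb]
    rw [dif_pos hlt]
    congr 1
    exact Fin.ext hv.symm
  have hfull : ∀ (c : ℕ) (hc : c ≤ m),
      ∑ p ∈ Finset.range (∑ i' : Fin c, n (Fin.castLE hc i')), b p =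
      ∑ i' : Fin c, ∑ k, a (finSigmaFinEquiv ⟨Fin.castLE hc i', k⟩) := by
    intro c
    induction c with
    | zero => intro _; simp
    | succ c ih =>
      intro hc
      rw [Fin.sum_univ_castSucc, Fin.sum_univ_castSucc]
      have h1 := hoff ⟨c, hc⟩ (n ⟨c, hc⟩) le_rfl
      refine h1.trans ?_
      congr 1
      · exact ih (Nat.le_of_succ_le hc)
      · rw [Finset.sum_range]
        refine Finset.sum_congr rfl fun k _ => ?_
        rw [dif_pos k.2]
        rfl
  rw [finSigmaFinEquiv_apply, finSigmaFinEquiv_apply, finSigmaFinEquiv_apply]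
  dsimp only
  rw [← add_assoc]
  congr 1
  rw [sum_fin_castLE a, sum_fin_castLE (fun k => a (finSigmaFinEquiv ⟨i, k⟩))]
  rw [finSigmaFinEquiv_apply]
  refine Eq.trans ?_ (hoff i k k.2.le).symm
  rw [hfull i i.2.le]

theorem graft_assoc (t : STerm S) (z : Fin t.ar → STerm S) (w : Fin (graft t z).ar → STerm S) :
    graft (graft t z) w = graft t fun i => graft (z i) fun j =>
      w (Fin.cast (ar_graft t z).symm (finSigmaFinEquiv ⟨i, j⟩)) := by
  induction t with
  | leaf =>
    change graft (z ⟨0, _⟩) w = graft (z ⟨0, _⟩) _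
    congr 1
    funext j
    congr 1
    refine Fin.ext ?_
    rw [Fin.val_cast]
    exact (finSigmaFinEquiv_one (n := fun i : Fin 1 => (z i).ar) ⟨0, j⟩).symm
  | node g ts ih =>
    change node g (fun i => graft (graft (ts i) _) _) = node g _
    congr 1
    funext i
    rw [ih]
    congr 1
    funext k
    congr 1
    funext l
    congr 1
    refine Fin.ext ?_
    exact finSigma_assoc (n := fun i => (ts i).ar) (fun p => (z p).ar) i k l _
      (fun i => ar_graft (ts i) _) _ rfl

end STerm

/-! ## Free operads and multi-multiassociative operads -/

/-- The free operad on the signature `S`. -/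
def freeOperad (S : ℕ → Type u) : NSOperad.{u} where
  carrier := STerm S
  ar := STerm.ar
  one := STerm.leaf
  comp := STerm.graft
  ar_one := rfl
  ar_comp := STerm.ar_graft
  one_comp := fun _ => rfl
  comp_one := STerm.graft_leaf
  assoc := STerm.graft_assoc

/-- `S` has profile `0^{r+1} s 0 0 …`: there are exactly `s` generators of arity `r + 1`, and no
generator of any other arity. -/
def HasProfile (S : ℕ → Type u) (r s : ℕ) : Prop :=
  ∀ n, Finite (S n) ∧ Nat.card (S n) = if n = r + 1 then s else 0

/-- The pairs `(g ∘ᵢ g', g' ∘ᵢ' g)` with `g`, `g'` generators. -/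
def masRel (S : ℕ → Type u) (x y : (freeOperad S).carrier) : Prop :=
  ∃ (n n' : ℕ) (g : S n) (g' : S n')
    (i : Fin ((freeOperad S).ar (STerm.corolla g))) (i' : Fin ((freeOperad S).ar (STerm.corolla g'))),
    x = (freeOperad S).pcomp (STerm.corolla g) i (STerm.corolla g') ∧
    y = (freeOperad S).pcomp (STerm.corolla g') i' (STerm.corolla g)

theorem NSOperad.ar_pcomp (O : NSOperad.{u}) (x : O.carrier) (i : Fin (O.ar x)) (y : O.carrier) :
    O.ar (O.pcomp x i y) + 1 = O.ar x + O.ar y := by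
  rw [NSOperad.pcomp, O.ar_comp, ← Finset.add_sum_erase _ _ (Finset.mem_univ i), if_pos rfl,
    Finset.sum_congr rfl (g := fun _ => 1)]
  · have := i.2
    simp
    omega
  · intro k hk
    rw [if_neg (Finset.ne_of_mem_erase hk), O.ar_one]

theorem masRel_ar (S : ℕ → Type u) (x y : (freeOperad S).carrier) (h : masRel S x y) :
    (freeOperad S).ar x = (freeOperad S).ar y := by
  obtain ⟨n, n', g, g', i, i', rfl, rfl⟩ := h
  have h1 := (freeOperad S).ar_pcomp (STerm.corolla g) i (STerm.corolla g')
  have h2 := (freeOperad S).ar_pcomp (STerm.corolla g') i' (STerm.corolla g)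
  omega

/-- The operad congruence generated by `g ∘ᵢ g' ≡ g' ∘ᵢ' g` for all generators `g`, `g'`. -/
def masCongr (S : ℕ → Type u) : (freeOperad S).Congruence :=
  (freeOperad S).congrGen (masRel S) (masRel_ar S)

/-- The multi-multiassociative operad on the signature `S`. -/
noncomputable def MAs (S : ℕ → Type u) : NSOperad.{u} := (masCongr S).quotient

theorem deg_pcomp_corolla {S : ℕ → Type u} {n n' : ℕ} (g : S n) (g' : S n')
    (i : Fin ((freeOperad S).ar (STerm.corolla g))) :
    STerm.deg ((freeOperad S).pcomp (STerm.corolla g) i (STerm.corolla g')) = 2 := by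
  have hc : ∀ {m : ℕ} (h : S m), (STerm.corolla h).deg = 1 := fun h =>
    (congrArg (1 + ·) (Finset.sum_eq_zero fun _ _ => rfl)).trans rfl
  have hs : ∀ {N : ℕ} (j : Fin N),
      ∑ k, STerm.deg (if k = j then STerm.corolla g' else STerm.leaf) = 1 := by
    intro N j
    rw [← Finset.add_sum_erase _ _ (Finset.mem_univ j), if_pos rfl, hc, Finset.sum_eq_zero fun k hk =>
      (congrArg STerm.deg (if_neg (Finset.ne_of_mem_erase hk))).trans rfl, add_zero]
  exact (STerm.deg_graft _ _).trans (congrArg₂ (· + ·) (hc g) (hs i))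

theorem masCongr_deg_aux {S : ℕ → Type u} {x y : (freeOperad S).carrier}
    (h : NSOperad.CongrGen (freeOperad S) (masRel S) x y) : STerm.deg x = STerm.deg y := by
  induction h with
  | of h =>
    obtain ⟨n, n', g, g', i, i', rfl, rfl⟩ := h
    exact (deg_pcomp_corolla g g' i).trans (deg_pcomp_corolla g' g i').symm
  | refl => rfl
  | symm _ ih => exact ih.symm
  | trans _ _ ih1 ih2 => exact ih1.trans ih2
  | comp z z' h _ ih1 ih2 =>
    refine (STerm.deg_graft _ _).trans (Eq.trans ?_ (STerm.deg_graft _ _).symm)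
    exact congrArg₂ (· + ·) ih1
      (NSOperad.sum_fin_eq ((masCongr S).ar_eq h) _ _ ih2)

theorem masCongr_deg {S : ℕ → Type u} {x y : STerm S} (h : (masCongr S).rel x y) :
    x.deg = y.deg := masCongr_deg_aux h

/-- The degree of an element of `MAs S`: the number of internal nodes of any representative. -/
def MAs.deg (S : ℕ → Type u) : (MAs S).carrier → ℕ :=
  Quotient.lift (s := (masCongr S).toSetoid) STerm.deg fun _ _ h => masCongr_deg h

/-- All equivalence classes of the congruence are finite. -/
def NSOperad.Congruence.FiniteType {O : NSOperad.{u}} (C : O.Congruence) : Prop :=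
  ∀ x, {y | C.rel x y}.Finite

/-! ## Natural Hopf algebras -/

namespace NSOperad

variable (K : Type v) [Field K] (O : NSOperad.{u})

/-- The factorizations `x = y[w₁, …, w_n]` of `x`. -/
def Factorization (x : O.carrier) : Type u :=
  {p : (y : O.carrier) × (Fin (O.ar y) → O.carrier) // O.comp p.1 p.2 = x}

/-- Every element has finitely many factorizations. -/
def FinitelyFactorizable : Prop := ∀ x, Finite (O.Factorization x)

/-- `dg` is a grading of the operad `O`. -/
def IsGrading (dg : O.carrier → ℕ) : Prop :=
  (∀ x, dg x = 0 ↔ x = O.one) ∧ ∀ y z, dg (O.comp y z) = dg y + ∑ i, dg (z i)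

/-- The elements of `O` that are not the unit. -/
abbrev NonUnit : Type u := {x : O.carrier // x ≠ O.one}

/-- Reduced words on `O`. -/
abbrev RedWord : Type u := FreeMonoid O.NonUnit

/-- The space with basis `E_w`, where `w` runs over the reduced words on `O`, with the product
`E_w · E_w' = E_{ww'}`. -/
abbrev Natural : Type (max u v) := MonoidAlgebra K O.RedWord

/-- The basis element `E_w`. -/
noncomputable def E {O : NSOperad.{u}} (w : O.RedWord) : O.Natural K := MonoidAlgebra.single w 1

open Classical in
/-- The reduced word obtained by deleting all the units in a word on `O`. -/
noncomputable def rd {O : NSOperad.{u}} (w : List O.carrier) : O.RedWord :=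
  FreeMonoid.ofList (w.filterMap fun x => if h : x ≠ O.one then some ⟨x, h⟩ else none)

/-- `∑ E_{rd y} ⊗ E_{rd w}` over the factorizations `x = y[w]` of `x`. -/
noncomputable def comulGen (x : O.carrier) : O.Natural K ⊗[K] O.Natural K :=
  ∑ᶠ p : O.Factorization x, E K (rd [p.1.1]) ⊗ₜ[K] E K (rd (List.ofFn p.1.2))

/-- The coproduct of the natural Hopf algebra. -/
noncomputable def comul : O.Natural K →ₐ[K] O.Natural K ⊗[K] O.Natural K :=
  MonoidAlgebra.lift K (O.Natural K ⊗[K] O.Natural K) O.RedWord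
    (FreeMonoid.lift fun x => O.comulGen K x.1)

/-- The counit of the natural Hopf algebra: `E_w` is sent to `1` if `w` is empty and to `0`
otherwise. -/
noncomputable def counit : O.Natural K →ₐ[K] K :=
  MonoidAlgebra.lift K K O.RedWord (FreeMonoid.lift fun _ => 0)

/-- The homogeneous component of degree `n` for the additive extension of `dg` to words. -/
noncomputable def homogeneous (dg : O.carrier → ℕ) (n : ℕ) : Submodule K (O.Natural K) :=
  Submodule.span K {x | ∃ w : O.RedWord, (w.toList.map fun y => dg y.1).sum = n ∧ x = E K w}

/-- The linear map `E_w ↦ ∑ E_f` from the natural Hopf algebra of a quotient `O/≡` to that of `O`,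
where `f` runs over the reduced words on `O` whose letters represent the letters of `w`. -/
noncomputable def quotEmbed {O : NSOperad.{u}} (C : O.Congruence) :
    C.quotient.Natural K →ₗ[K] O.Natural K :=
  (MonoidAlgebra.basis C.quotient.RedWord K).constr K fun w =>
    ∑ᶠ f ∈ {f : O.RedWord | f.toList.map (fun y => C.cls y.1) = w.toList.map Subtype.val}, E K f

end NSOperad

/-! ## Hopf algebras -/

section Hopf

variable {K : Type v} [Field K] {H : Type w} [Ring H] [Algebra K H] {H' : Type w'} [Ring H']
  [Algebra K H']

/-- The algebra `H` with the coproduct `Δ` and the counit `ε` is a Hopf algebra. -/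
structure IsHopfAlgebra (Δ : H →ₐ[K] H ⊗[K] H) (ε : H →ₐ[K] K) : Prop where
  coassoc : (Algebra.TensorProduct.assoc K K K H H H).toAlgHom.comp
      ((Algebra.TensorProduct.map Δ (.id K H)).comp Δ)
      = (Algebra.TensorProduct.map (.id K H) Δ).comp Δ
  rTensor_counit : (Algebra.TensorProduct.map ε (.id K H)).comp Δ
      = (Algebra.TensorProduct.lid K H).symm
  lTensor_counit : (Algebra.TensorProduct.map (.id K H) ε).comp Δ
      = (Algebra.TensorProduct.rid K K H).symm
  exists_antipode : ∃ α : H →ₗ[K] H,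
    LinearMap.mul' K H ∘ₗ α.rTensor H ∘ₗ Δ.toLinearMap = Algebra.linearMap K H ∘ₗ ε.toLinearMap ∧
    LinearMap.mul' K H ∘ₗ α.lTensor H ∘ₗ Δ.toLinearMap = Algebra.linearMap K H ∘ₗ ε.toLinearMap

/-- The bundled Hopf algebra given by `IsHopfAlgebra`. -/
@[reducible] noncomputable def IsHopfAlgebra.toHopfAlgebra {Δ : H →ₐ[K] H ⊗[K] H} {ε : H →ₐ[K] K}
    (h : IsHopfAlgebra Δ ε) : HopfAlgebra K H where
  toBialgebra := Bialgebra.ofAlgHom Δ ε h.coassoc h.rTensor_counit h.lTensor_counit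
  antipode := h.exists_antipode.choose
  mul_antipode_rTensor_comul := h.exists_antipode.choose_spec.1
  mul_antipode_lTensor_comul := h.exists_antipode.choose_spec.2

/-- The algebra isomorphism `φ` is compatible with the coproducts and with the counits. -/
structure IsHopfIso (Δ : H →ₐ[K] H ⊗[K] H) (ε : H →ₐ[K] K) (Δ' : H' →ₐ[K] H' ⊗[K] H')
    (ε' : H' →ₐ[K] K) (φ : H ≃ₐ[K] H') : Prop where
  map_comul : ∀ x, Δ' (φ x) = Algebra.TensorProduct.map φ.toAlgHom φ.toAlgHom (Δ x)
  map_counit : ∀ x, ε' (φ x) = ε x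

end Hopf

/-! ## Noncommutative polynomials with possibly infinite support -/

/-- Noncommutative series with variables in `A`: families of coefficients indexed by words. -/
def NCSeries (K : Type v) (A : Type u) : Type (max u v) := List A → K

namespace NCSeries

variable {K : Type v} [Field K] {A : Type u}

noncomputable instance : AddCommGroup (NCSeries K A) := inferInstanceAs (AddCommGroup (List A → K))

noncomputable instance : Module K (NCSeries K A) := inferInstanceAs (Module K (List A → K))

/-- The coefficient of a word in a series. -/
def coeff {K : Type v} {A : Type u} (f : NCSeries K A) (w : List A) : K := f w

@[ext] theorem ext {K : Type v} {A : Type u} {f g : NCSeries K A} (h : ∀ w, f.coeff w = g.coeff w) : f = g := funext h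

/-- The Cauchy product, extending the concatenation of words. -/
noncomputable instance : Mul (NCSeries K A) :=
  ⟨fun f g w => ∑ i ∈ Finset.range (w.length + 1), f (w.take i) * g (w.drop i)⟩

open Classical in
noncomputable instance : One (NCSeries K A) := ⟨fun w => if w = [] then 1 else 0⟩

theorem coeff_mul (f g : NCSeries K A) (w : List A) : (f * g).coeff w =
    ∑ i ∈ Finset.range (w.length + 1), f.coeff (w.take i) * g.coeff (w.drop i) := rfl

open Classical in
theorem coeff_one (w : List A) : (1 : NCSeries K A).coeff w = if w = [] then 1 else 0 := rfl

@[simp] theorem coeff_add (f g : NCSeries K A) (w : List A) :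
    (f + g).coeff w = f.coeff w + g.coeff w := rfl

@[simp] theorem coeff_zero (w : List A) : (0 : NCSeries K A).coeff w = 0 := rfl

@[simp] theorem coeff_smul (c : K) (f : NCSeries K A) (w : List A) :
    (c • f).coeff w = c * f.coeff w := rfl

theorem mul_assoc' (f g h : NCSeries K A) : f * g * h = f * (g * h) := by
  ext w
  simp only [coeff_mul, Finset.sum_mul, Finset.mul_sum]
  rw [Finset.sum_sigma', Finset.sum_sigma']
  refine Finset.sum_nbij' (fun p => ⟨p.2, p.1 - p.2⟩) (fun p => ⟨p.1 + p.2, p.1⟩) ?_ ?_ ?_ ?_ ?_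
  · rintro ⟨i, j⟩ h
    simp only [Finset.mem_sigma, Finset.mem_range, List.length_take, List.length_drop] at h ⊢
    omega
  · rintro ⟨i, j⟩ h
    simp only [Finset.mem_sigma, Finset.mem_range, List.length_take, List.length_drop] at h ⊢
    omega
  · rintro ⟨i, j⟩ h
    simp only [Finset.mem_sigma, Finset.mem_range, List.length_take] at h
    have : j + (i - j) = i := by omega
    simp [this]
  · rintro ⟨i, j⟩ h
    simp
  · rintro ⟨i, j⟩ h
    simp only [Finset.mem_sigma, Finset.mem_range, List.length_take] at h
    have h1 : j + (i - j) = i := by omega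
    have h2 : min j i = j := by omega
    rw [List.take_take, List.drop_take, List.drop_drop, h1, h2, mul_assoc]

theorem one_mul' (f : NCSeries K A) : 1 * f = f := by
  ext w
  rw [coeff_mul, Finset.sum_eq_single 0]
  · simp [coeff_one]
  · intro i hi h0
    rw [coeff_one, if_neg, zero_mul]
    intro h
    rw [List.take_eq_nil_iff] at h
    rcases h with h | h
    · exact h0 h
    · subst h
      simp at hi
      exact h0 hi
  · simp

theorem mul_one' (f : NCSeries K A) : f * 1 = f := by
  ext w
  rw [coeff_mul, Finset.sum_eq_single w.length]
  · simp [coeff_one]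
  · intro i hi h0
    rw [coeff_one, if_neg, mul_zero]
    intro h
    rw [List.drop_eq_nil_iff] at h
    rw [Finset.mem_range] at hi
    omega
  · simp

noncomputable instance : Ring (NCSeries K A) :=
  { (inferInstance : AddCommGroup (NCSeries K A)) with
    mul := (· * ·)
    one := 1
    mul_assoc := mul_assoc'
    one_mul := one_mul'
    mul_one := mul_one'
    zero_mul := fun f => by ext w; simp [coeff_mul]
    mul_zero := fun f => by ext w; simp [coeff_mul]
    left_distrib := fun f g h => by
      ext w; simp [coeff_mul, mul_add, Finset.sum_add_distrib]
    right_distrib := fun f g h => by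
      ext w; simp [coeff_mul, add_mul, Finset.sum_add_distrib] }

noncomputable instance : Algebra K (NCSeries K A) :=
  Algebra.ofModule
    (fun c f g => by ext w; simp [coeff_mul, Finset.mul_sum, mul_assoc])
    (fun c f g => by ext w; simp [coeff_mul, Finset.mul_sum, mul_left_comm])

end NCSeries

/-- The algebra `K⟨A⟩` of `A`-polynomials: the series of finite degree. -/
noncomputable def NCPoly (K : Type v) [Field K] (A : Type u) : Subalgebra K (NCSeries K A) where
  carrier := {f | ∃ d : ℕ, ∀ w : List A, d < w.length → f.coeff w = 0}
  mul_mem' := by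
    rintro f g ⟨d, hd⟩ ⟨e, he⟩
    refine ⟨d + e, fun w hw => ?_⟩
    rw [NCSeries.coeff_mul]
    refine Finset.sum_eq_zero fun i hi => ?_
    rw [Finset.mem_range] at hi
    by_cases h : d < i
    · rw [hd _ (by rw [List.length_take]; omega), zero_mul]
    · rw [he _ (by rw [List.length_drop]; omega), mul_zero]
  add_mem' := by
    rintro f g ⟨d, hd⟩ ⟨e, he⟩
    refine ⟨d + e, fun w hw => ?_⟩
    rw [NCSeries.coeff_add, hd w (by omega), he w (by omega), add_zero]
  algebraMap_mem' := by
    intro c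
    refine ⟨0, fun w hw => ?_⟩
    have hw' : w ≠ [] := by rintro rfl; simp at hw
    rw [Algebra.algebraMap_eq_smul_one, NCSeries.coeff_smul, NCSeries.coeff_one, if_neg hw',
      mul_zero]

namespace NCPoly

variable {K : Type v} [Field K] {A : Type u} {B : Type u'}

/-- A polynomial is homogeneous of degree `n` if it is supported on words of length `n`. -/
def IsHomogeneous (n : ℕ) (f : NCPoly K A) : Prop :=
  ∀ w : List A, w.length ≠ n → f.1.coeff w = 0

/-- The linear map sending a word `w` on `A ⊔ B` to `w_{|A} ⊗ w_{|B}`, extended to polynomials with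
infinite support. Its values are given by their coefficients on the pairs of words. -/
noncomputable def theta (f : NCPoly K (A ⊕ B)) (u : List A) (v : List B) : K :=
  ∑ᶠ w ∈ {w : List (A ⊕ B) | w.filterMap Sum.getLeft? = u ∧ w.filterMap Sum.getRight? = v},
    f.1.coeff w

/-- The coefficients of an element of `K⟨A⟩ ⊗ K⟨B⟩` on the pairs of words. -/
noncomputable def tensorCoeff :
    NCPoly K A ⊗[K] NCPoly K B →ₗ[K] (List A → List B → K) :=
  TensorProduct.lift (LinearMap.mk₂ K (fun f g u v => f.1.coeff u * g.1.coeff v)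
    (fun f f' g => by ext u v; simp [add_mul])
    (fun c f g => by ext u v; simp [mul_assoc])
    (fun f g g' => by ext u v; simp [mul_add])
    (fun c f g => by ext u v; simp [mul_left_comm]))

/-- An element of `K⟨A⟩ ⊗ K⟨B⟩` is determined by its coefficients. -/
theorem tensorCoeff_injective : Function.Injective (tensorCoeff (K := K) (A := A) (B := B)) := by
  classical
  rw [injective_iff_map_eq_zero]
  intro x hx
  let b := Module.Basis.ofVectorSpace K (NCPoly K B)
  obtain ⟨m, rfl⟩ := (TensorProduct.equivFinsuppOfBasisRight (M := NCPoly K A) b).symm.surjective x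
  suffices m = 0 by rw [this, map_zero]
  rw [TensorProduct.equivFinsuppOfBasisRight_symm_apply] at hx
  ext k u
  let c : List B → NCPoly K B →ₗ[K] K := fun v =>
    { toFun := fun f => f.1.coeff v, map_add' := fun _ _ => rfl, map_smul' := fun _ _ => rfl }
  have h : ∑ k ∈ m.support, (m k).1.coeff u • b k = 0 := by
    refine Subtype.ext (NCSeries.ext fun v => ?_)
    refine Eq.trans ?_ (congrFun (congrFun hx u) v)
    rw [Finsupp.sum, map_sum, Finset.sum_apply, Finset.sum_apply]
    refine (map_sum (c v) _ _).trans (Finset.sum_congr rfl fun k _ => ?_)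
    rw [map_smul]
    rfl
  by_cases hk : k ∈ m.support
  · exact linearIndependent_iff'.1 b.linearIndependent _ _ h k hk
  · rw [Finsupp.notMem_support_iff.1 hk]
    rfl

/-- Only finitely many words restrict to given words on `A` and on `B`. -/
theorem finite_theta (u : List A) (v : List B) :
    {w : List (A ⊕ B) | w.filterMap Sum.getLeft? = u ∧
      w.filterMap Sum.getRight? = v}.Finite := by
  induction u generalizing v with
  | nil =>
    induction v with
    | nil =>
      refine (Set.finite_singleton []).subset ?_
      rintro (_ | ⟨a | b, w⟩) ⟨h1, h2⟩ <;> simp at h1 h2 ⊢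
    | cons b v ihv =>
      refine (ihv.image (Sum.inr b :: ·)).subset ?_
      rintro (_ | ⟨a' | b', w⟩) ⟨h1, h2⟩ <;> simp_all
  | cons a u ihu =>
    induction v with
    | nil =>
      refine ((ihu []).image (Sum.inl a :: ·)).subset ?_
      rintro (_ | ⟨a' | b', w⟩) ⟨h1, h2⟩ <;> simp_all
    | cons b v ihv =>
      refine (((ihu (b :: v)).image (Sum.inl a :: ·)).union (ihv.image (Sum.inr b :: ·))).subset ?_
      rintro (_ | ⟨a' | b', w⟩) ⟨h1, h2⟩ <;> simp [List.filterMap_cons] at h1 h2 ⊢ <;> simp_all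

end NCPoly

/-! ## Forest-like alphabets and realizations -/

/-- An `S`-forest-like alphabet: a set with a unary root relation, a unary decoration relation for
each generator, and a binary `j`-edge relation for each `j ≥ 1`. -/
structure ForestAlphabet (S : ℕ → Type u) where
  carrier : Type u
  root : carrier → Prop
  deco : {n : ℕ} → S n → carrier → Prop
  edge : ℕ+ → carrier → carrier → Prop

namespace ForestAlphabet

variable {S : ℕ → Type u}

/-- The edge relations of the disjoint sum of two alphabets. -/
def sumEdge (A B : ForestAlphabet S) (j : ℕ+) : A.carrier ⊕ B.carrier → A.carrier ⊕ B.carrier → Prop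
  | .inl a, .inl a' => A.edge j a a'
  | .inr b, .inr b' => B.edge j b b'
  | .inl _, .inr b => B.root b
  | .inr _, .inl _ => False

/-- The disjoint sum of two alphabets. -/
def sum (A B : ForestAlphabet S) : ForestAlphabet S where
  carrier := A.carrier ⊕ B.carrier
  root := Sum.elim A.root B.root
  deco := fun g => Sum.elim (A.deco g) (B.deco g)
  edge := sumEdge A B

/-- The bijection `e` between two alphabets preserves and reflects all the relations. -/
structure IsIso (A B : ForestAlphabet S) (e : A.carrier ≃ B.carrier) : Prop where
  root_iff : ∀ a, B.root (e a) ↔ A.root a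
  deco_iff : ∀ {n : ℕ} (g : S n) (a : A.carrier), B.deco g (e a) ↔ A.deco g a
  edge_iff : ∀ (j : ℕ+) (a a' : A.carrier), B.edge j (e a) (e a') ↔ A.edge j a a'

/-- The alphabet of the letters `a_{g,i}`, with `g` a generator and `i` a natural number: all letters
are roots, `a_{g,i}` is decorated by `g` only, and there is a `j`-edge from `a_{g,i}` to `a_{g',i'}`
if and only if `i < i'`. -/
def lengthAlphabet (S : ℕ → Type u) : ForestAlphabet S where
  carrier := (Σ n, S n) × ℕ
  root := fun _ => True
  deco := fun {n} g a => a.1 = ⟨n, g⟩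
  edge := fun _ a a' => a.2 < a'.2

end ForestAlphabet

namespace STerm

variable {S : ℕ → Type u}

/-- The decorations of the internal nodes of a term, in preorder. -/
def nodes : STerm S → List (Σ n, S n)
  | leaf => []
  | node g ts => ⟨_, g⟩ :: (List.ofFn fun i => nodes (ts i)).flatten

/-- The position of the first internal node of the `i`-th child of `node g ts`, if there is one. -/
def offset {n : ℕ} (ts : Fin n → STerm S) (i : Fin n) : ℕ :=
  1 + ∑ k ∈ Finset.Iio i, (ts k).deg

/-- `t.Edge j a b` means that the internal node in position `b` of `t` is the `j`-th child of the
internal node in position `a`, positions being numbered from `0` in preorder. -/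
def Edge : STerm S → ℕ+ → ℕ → ℕ → Prop
  | leaf, _, _, _ => False
  | node _ ts, j, a, b => ∃ i,
      (ts i ≠ leaf ∧ (j : ℕ) = i + 1 ∧ a = 0 ∧ b = offset ts i) ∨
      (∃ a' b', Edge (ts i) j a' b' ∧ a = offset ts i + a' ∧ b = offset ts i + b')

end STerm

/-- Forests: words of terms. -/
abbrev SForest (S : ℕ → Type u) : Type u := List (STerm S)

namespace SForest

variable {S : ℕ → Type u}

/-- The degree of a forest: its number of internal nodes. -/
def deg (f : SForest S) : ℕ := (f.map STerm.deg).sum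

/-- The decorations of the internal nodes of a forest, in preorder. -/
def nodes (f : SForest S) : List (Σ n, S n) := f.flatMap STerm.nodes

/-- The internal node in position `a` of the forest is a root. -/
def IsRoot : SForest S → ℕ → Prop
  | [], _ => False
  | t :: f, a => (t ≠ STerm.leaf ∧ a = 0) ∨ ∃ a', IsRoot f a' ∧ a = t.deg + a'

/-- The internal node in position `b` of the forest is the `j`-th child of the internal node in
position `a`. -/
def Edge : SForest S → ℕ+ → ℕ → ℕ → Prop
  | [], _, _, _ => False
  | t :: f, j, a, b =>
      t.Edge j a b ∨ ∃ a' b', Edge f j a' b' ∧ a = t.deg + a' ∧ b = t.deg + b'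

/-- The word `w` is `f`-compatible. -/
structure Compatible (A : ForestAlphabet S) (w : List A.carrier) (f : SForest S) : Prop where
  length_eq : w.length = f.deg
  root : ∀ (i : ℕ) (a : A.carrier), f.IsRoot i → w[i]? = some a → A.root a
  deco : ∀ (i : ℕ) (a : A.carrier) (g : Σ n, S n), f.nodes[i]? = some g → w[i]? = some a →
    A.deco g.2 a
  edge : ∀ (i i' : ℕ) (j : ℕ+) (a a' : A.carrier), f.Edge j i i' → w[i]? = some a →
    w[i']? = some a' → A.edge j a a'

end SForest

/-- The forest underlying a reduced word on the free operad. -/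
def redForest {S : ℕ → Type u} (f : (freeOperad S).RedWord) : SForest S :=
  f.toList.map Subtype.val

open Classical in
/-- The sum of all the words on `A` that are `f`-compatible. -/
noncomputable def forestPoly (K : Type v) [Field K] {S : ℕ → Type u} (A : ForestAlphabet S)
    (f : SForest S) : NCPoly K A.carrier :=
  ⟨fun w => if SForest.Compatible A w f then 1 else 0, SForest.deg f, fun _ hw =>
    if_neg fun h => hw.ne' h.length_eq⟩

/-- The `A`-realization map on the natural Hopf algebra of the free operad. -/
noncomputable def realization (K : Type v) [Field K] {S : ℕ → Type u} (A : ForestAlphabet S) :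
    (freeOperad S).Natural K →ₗ[K] NCPoly K A.carrier :=
  (MonoidAlgebra.basis (freeOperad S).RedWord K).constr K fun f => forestPoly K A (redForest f)

/-- The `A`-realization map on the natural Hopf algebra of `MAs S`, the latter being embedded into
the natural Hopf algebra of the free operad. -/
noncomputable def masRealization (K : Type v) [Field K] {S : ℕ → Type u} (A : ForestAlphabet S) :
    (MAs S).Natural K →ₗ[K] NCPoly K A.carrier :=
  realization K A ∘ₗ NSOperad.quotEmbed K (masCongr S)

/-- The class of `S`-forest-like alphabets, the disjoint sum, the maps `r A` and the alphabet `𝔸`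
form a polynomial realization of the Hopf algebra `H`, with coproduct `Δ` and homogeneous components
`gr n`. -/
structure IsPolynomialRealization {K : Type v} [Field K] {S : ℕ → Type u} {H : Type w} [Ring H]
    [Algebra K H] (Δ : H →ₐ[K] H ⊗[K] H) (gr : ℕ → Submodule K H)
    (r : (A : ForestAlphabet S) → H →ₗ[K] NCPoly K A.carrier) (𝔸 : ForestAlphabet S) : Prop where
  sum_assoc : ∀ A B C : ForestAlphabet S,
    ForestAlphabet.IsIso ((A.sum B).sum C) (A.sum (B.sum C)) (Equiv.sumAssoc _ _ _)
  graded : ∀ (A : ForestAlphabet S) (n : ℕ), ∀ x ∈ gr n, NCPoly.IsHomogeneous n (r A x)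
  doubling : ∀ (A B : ForestAlphabet S) (x : H),
    NCPoly.theta (A := A.carrier) (B := B.carrier) (r (A.sum B) x) =
      NCPoly.tensorCoeff (TensorProduct.map (r A) (r B) (Δ x))
  injective : Function.Injective (r 𝔸)

/-! Hopf structure. The generating relations preserve the number of internal nodes, so the degree
descends to `MAs S`. There are finitely many generators, hence finitely many trees of bounded
degree: classes are finite and every element has finitely many factorizations. Both iterated
coproducts of a letter x are sums over the triples (p, q, w) with (p[q])[w] = x, by associativity of
the composition (`leftEquivRight`). The only factorization with a trivial left factor is x = 1[x],
and the only one with trivial right factors is x = x[1, …, 1], which gives the counit axioms. Only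
the empty word has degree 0, so the bialgebra is connected and the antipode is a geometric series
for convolution (`exists_antipode_of_graded_basis`).

Doubling (`theta_sumTree`). In A + B an edge may go from A to B but never back. In a word compatible
with a tree t, the nodes carrying letters of A therefore form an upper part y of t, and the other
nodes form the forest w grafted on the leaves of y, whose roots carry root letters of B. This is a
factorization t = y[w], with y a leaf if the root letter is in B. Summing over a class is harmless:
choosing a representative of x and factorizing it amounts to factorizing x and choosing
representatives of the factors (`MAs.repFactorization`). Both sides of the identity are
multiplicative, so the case of a letter suffices.

Injectivity. All generators have the same arity, and the relations let a generator grafted on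
another one move from one input to the next; every tree is thus equivalent to the left comb with the
same decorations in preorder (`MAs.rel_comb`), so the preorder word of decorations determines the
class. On the other side, `testWord f` has indices increasing along each tree of f and dropping from
one tree to the next. The root of a tree has the smallest index in any compatible word, so no tree
of a forest compatible with `testWord f` can straddle two trees of f: such a forest has at least as
many trees as f, and with equally many it has the same decorations tree by tree
(`SForest.nodes_eq_of_compatible_testWord`). For a nonzero x, take a word w of maximal length in its
support and a forest f representing it: in the image of x, the coefficient of `testWord f` is the
coefficient of w times a positive integer, nonzero in characteristic zero.

The Hopf structure on the image is then carried over by the realization, and doubling identifies its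
coproduct. -/

/-! ### Ordered products and concatenation of blocks -/

/-- Distributivity for ordered products of finite sums. -/
theorem List.prod_ofFn_sum {R : Type*} [Semiring R] : ∀ {n : ℕ} (κ : Fin n → Type*)
    [∀ i, Fintype (κ i)] (f : ∀ i, κ i → R),
    (List.ofFn fun i => ∑ k, f i k).prod = ∑ p : ∀ i, κ i, (List.ofFn fun i => f i (p i)).prod
  | 0, κ, _, f => by simp
  | n + 1, κ, _, f => by
    rw [List.ofFn_succ, List.prod_cons, List.prod_ofFn_sum (fun i => κ i.succ), Finset.sum_mul_sum,
      ← Fintype.sum_prod_type', ← (Fin.consEquiv κ).sum_comp]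
    refine Finset.sum_congr rfl fun p _ => ?_
    rw [List.ofFn_succ, List.prod_cons]
    simp [Fin.consEquiv]

theorem finSigmaFinEquiv_succ_val {m : ℕ} {n : Fin (m + 1) → ℕ} (i : Fin m) (j : Fin (n i.succ)) :
    (finSigmaFinEquiv ⟨i.succ, j⟩ : ℕ) =
      n 0 + finSigmaFinEquiv (n := fun i => n i.succ) ⟨i, j⟩ := by
  rw [finSigmaFinEquiv_apply, finSigmaFinEquiv_apply]
  dsimp only
  rw [← add_assoc]
  congr 1
  exact Fin.sum_univ_succ (n := i) (fun i' => n (Fin.castLE i.succ.2.le i'))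

/-- The leaves of a composite are numbered block by block. This turns the right factors of (p[q])[w]
into the concatenation of the right factors of the q_i, the form in which they occur in a product of
coproducts. -/
theorem List.ofFn_finSigma {α : Type*} : ∀ {n : ℕ} (m : Fin n → ℕ) {N : ℕ} (h : ∑ i, m i = N)
    (w : Fin N → α), List.ofFn w =
      (List.ofFn fun i => List.ofFn fun j => w (Fin.cast h (finSigmaFinEquiv ⟨i, j⟩))).flatten
  | 0, m, N, h, w => by
    obtain rfl : 0 = N := by simpa using h
    simp
  | n + 1, m, N, h, w => by
    obtain rfl : m 0 + ∑ i : Fin n, m i.succ = N := by rw [← h, Fin.sum_univ_succ]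
    rw [List.ofFn_add, List.ofFn_succ, List.flatten_cons]
    congr 1
    · congr 1
      funext j
      congr 1
      ext
      simp
    · rw [List.ofFn_finSigma (fun i => m i.succ) rfl]
      congr 2
      funext i
      congr 1
      funext j
      congr 1
      ext
      simp only [Fin.val_natAdd, Fin.val_cast]
      exact (finSigmaFinEquiv_succ_val i j).symm

/-! ### Reduced words and the basis `E` -/

namespace NSOperad

section Words

variable (K : Type v) [Field K] {O : NSOperad.{u}}

theorem rd_append (l l' : List O.carrier) : rd (l ++ l') = rd l * rd l' := by
  unfold rd
  rw [List.filterMap_append]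
  rfl

theorem rd_one : rd [O.one] = 1 := by
  unfold rd
  rw [List.filterMap_cons_none (by simp)]
  rfl

theorem rd_nonUnit (x : O.NonUnit) : rd [x.1] = FreeMonoid.of x := by
  unfold rd
  rw [List.filterMap_cons_some (b := x) (by simp [x.2])]
  rfl

theorem E_one : E K (1 : O.RedWord) = 1 := rfl

theorem E_mul (w w' : O.RedWord) : E K (w * w') = E K w * E K w' := by
  simp [E, MonoidAlgebra.single_mul_single]

theorem E_rd_cons (x : O.carrier) (l : List O.carrier) :
    E K (rd (x :: l)) = E K (rd [x]) * E K (rd l) := by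
  rw [← E_mul, ← rd_append]; rfl

/-- The letters of `l` may be units, which contribute a factor 1. Lists of factors of a
factorization can thus be treated without separating the units. -/
theorem E_rd_eq_prod (l : List O.carrier) :
    E K (rd l) = (l.map fun x => E K (rd [x])).prod := by
  induction l with
  | nil => rfl
  | cons x l ih => rw [E_rd_cons, List.map_cons, List.prod_cons, ih]

theorem E_rd_flatten (l : List (List O.carrier)) :
    E K (rd l.flatten) = (l.map fun x => E K (rd x)).prod := by
  induction l with
  | nil => rfl
  | cons x l ih =>
    rw [List.flatten_cons, rd_append, E_mul, List.map_cons, List.prod_cons, ih]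

theorem rd_toList (w : O.RedWord) : rd (w.toList.map Subtype.val) = w := by
  induction w using FreeMonoid.inductionOn' with
  | one => rfl
  | of_mul x w ih =>
    rw [FreeMonoid.toList_mul, FreeMonoid.toList_of, List.singleton_append, List.map_cons,
      ← List.singleton_append, rd_append, ih, rd_nonUnit]

theorem natural_linearMap_ext {M : Type*} [AddCommMonoid M] [Module K M] {f g : O.Natural K →ₗ[K] M}
    (h : ∀ w : O.RedWord, f (E K w) = g (E K w)) : f = g :=
  (MonoidAlgebra.basis O.RedWord K).ext fun w => by
    rw [MonoidAlgebra.basis_apply]; exact h w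

/-- The natural algebra is free on the non-units. -/
theorem natural_algHom_ext {A : Type*} [Semiring A] [Algebra K A] {f g : O.Natural K →ₐ[K] A}
    (h : ∀ x : O.NonUnit, f (E K (rd [x.1])) = g (E K (rd [x.1]))) : f = g := by
  refine AlgHom.toLinearMap_injective (natural_linearMap_ext K fun w => ?_)
  change f (E K w) = g (E K w)
  rw [← rd_toList w, E_rd_eq_prod, map_list_prod, map_list_prod]
  simp only [List.map_map]
  congr 1
  exact List.map_congr_left fun x _ => h x

end Words

/-! ### Coassociativity and counit of the natural bialgebra -/

section Hopf

variable {K : Type v} [Field K] {O : NSOperad.{u}} {dg : O.carrier → ℕ}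

/-- The index set of the iterated coproduct, in its two forms. -/
def arityCurry (p : O.carrier) (q : Fin (O.ar p) → O.carrier) :
    (Fin (O.ar (O.comp p q)) → O.carrier) ≃ (∀ i, Fin (O.ar (q i)) → O.carrier) where
  toFun w i j := w (Fin.cast (O.ar_comp p q).symm (finSigmaFinEquiv ⟨i, j⟩))
  invFun v k := v (finSigmaFinEquiv.symm (Fin.cast (O.ar_comp p q) k)).1
    (finSigmaFinEquiv.symm (Fin.cast (O.ar_comp p q) k)).2
  left_inv w := by
    funext k
    dsimp only
    rw [Sigma.eta, Equiv.apply_symm_apply]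
    simp
  right_inv v := by
    funext i j
    dsimp only
    rw [Fin.cast_cast, Fin.cast_eq_self, Equiv.symm_apply_apply]

/-- The factorizations `x = (p[q])[w]`. -/
def LeftFactorization (x : O.carrier) : Type u :=
  {t : Σ (p : O.carrier) (q : Fin (O.ar p) → O.carrier), (Fin (O.ar (O.comp p q)) → O.carrier) //
    O.comp (O.comp t.1 t.2.1) t.2.2 = x}

/-- The factorizations `x = p[q_1[w_1], …]`. -/
def RightFactorization (x : O.carrier) : Type u :=
  {t : Σ (p : O.carrier) (q : Fin (O.ar p) → O.carrier), (∀ i, Fin (O.ar (q i)) → O.carrier) //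
    O.comp t.1 (fun i => O.comp (t.2.1 i) (t.2.2 i)) = x}

/-- Associativity of the composition as a bijection between iterated factorizations. -/
def leftEquivRight (x : O.carrier) : LeftFactorization x ≃ RightFactorization x :=
  Equiv.subtypeEquiv
    (Equiv.sigmaCongrRight fun p => Equiv.sigmaCongrRight fun q => arityCurry p q) fun t => by
      rw [O.assoc]; rfl

/-- Factorizing the left factor of a factorization. -/
def leftEquiv (x : O.carrier) :
    LeftFactorization x ≃ Σ p : O.Factorization x, O.Factorization p.1.1 where
  toFun t := ⟨⟨⟨O.comp t.1.1 t.1.2.1, t.1.2.2⟩, t.2⟩, ⟨⟨t.1.1, t.1.2.1⟩, rfl⟩⟩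
  invFun s := ⟨⟨s.2.1.1, s.2.1.2, fun i => s.1.1.2 (Fin.cast (congrArg O.ar s.2.2) i)⟩, by
    obtain ⟨⟨⟨y, w⟩, h⟩, ⟨⟨p, q⟩, h'⟩⟩ := s
    dsimp only at h' w
    subst h'
    exact h⟩
  left_inv _ := rfl
  right_inv s := by
    obtain ⟨⟨⟨y, w⟩, h⟩, ⟨⟨p, q⟩, h'⟩⟩ := s
    dsimp only at h' w
    subst h'
    rfl

/-- Factorizing the right factors of a factorization. -/
def rightEquiv (x : O.carrier) :
    RightFactorization x ≃ Σ p : O.Factorization x, ∀ i, O.Factorization (p.1.2 i) where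
  toFun t := ⟨⟨⟨t.1.1, fun i => O.comp (t.1.2.1 i) (t.1.2.2 i)⟩, t.2⟩,
    fun i => ⟨⟨t.1.2.1 i, t.1.2.2 i⟩, rfl⟩⟩
  invFun s := ⟨⟨s.1.1.1, fun i => (s.2 i).1.1, fun i => (s.2 i).1.2⟩, by
    obtain ⟨⟨⟨p, z⟩, h⟩, k⟩ := s
    dsimp only at k ⊢
    rw [← h]
    exact congrArg (O.comp p) (funext fun i => (k i).2)⟩
  left_inv _ := rfl
  right_inv s := by
    obtain ⟨⟨⟨p, z⟩, h⟩, k⟩ := s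
    obtain ⟨q, w, hk, rfl⟩ : ∃ (q : Fin (O.ar p) → O.carrier) (w : ∀ i, Fin (O.ar (q i)) → O.carrier)
      (hk : ∀ i, O.comp (q i) (w i) = z i), k = fun i => ⟨⟨q i, w i⟩, hk i⟩ := ⟨_, _, _, rfl⟩
    obtain rfl : (fun i => O.comp (q i) (w i)) = z := funext hk
    rfl

theorem comulGen_eq_sum (x : O.carrier) [Fintype (O.Factorization x)] :
    O.comulGen K x =
      ∑ p : O.Factorization x, E K (rd [p.1.1]) ⊗ₜ[K] E K (rd (List.ofFn p.1.2)) :=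
  finsum_eq_sum_of_fintype _

theorem comul_E_nonUnit (x : O.NonUnit) : O.comul K (E K (rd [x.1])) = O.comulGen K x.1 := by
  rw [rd_nonUnit, E, comul, MonoidAlgebra.lift_single, one_smul, FreeMonoid.lift_eval_of]

theorem counit_E_nonUnit (x : O.NonUnit) : O.counit K (E K (rd [x.1])) = 0 := by
  rw [rd_nonUnit, E, counit, MonoidAlgebra.lift_single, one_smul, FreeMonoid.lift_eval_of]

theorem eq_of_factorization_one (p : O.carrier) (z : Fin (O.ar p) → O.carrier) (x : O.carrier)
    (hp : p = O.one) (h : O.comp p z = x) (i : Fin (O.ar p)) : z i = x := by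
  subst hp
  have hs : Subsingleton (Fin (O.ar O.one)) := by rw [O.ar_one]; infer_instance
  rw [← h, show z = fun _ => z i from funext fun j => congrArg z (Subsingleton.elim _ _), O.one_comp]

/-- The factorization `x = 1[x]`. -/
def oneFactorization (x : O.carrier) : O.Factorization x := ⟨⟨O.one, fun _ => x⟩, O.one_comp x⟩

/-- The factorization `x = x[1, …, 1]`. -/
def factorizationOne (x : O.carrier) : O.Factorization x := ⟨⟨x, fun _ => O.one⟩, O.comp_one x⟩

theorem eq_oneFactorization {x : O.carrier} (p : O.Factorization x) (h : p.1.1 = O.one) :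
    p = oneFactorization x := by
  obtain ⟨⟨y, z⟩, hp⟩ := p
  dsimp only at h
  subst h
  exact Subtype.ext (Sigma.ext rfl (heq_of_eq (funext fun i =>
    eq_of_factorization_one _ _ _ rfl hp i)))

theorem eq_factorizationOne {x : O.carrier} (p : O.Factorization x) (h : ∀ i, p.1.2 i = O.one) :
    p = factorizationOne x := by
  obtain ⟨⟨y, z⟩, hp⟩ := p
  dsimp only at h hp
  obtain rfl : z = fun _ => O.one := funext h
  obtain rfl : y = x := by rw [← hp, O.comp_one]
  rfl

theorem rd_ofFn_const_one (n : ℕ) : rd (List.ofFn fun _ : Fin n => O.one) = 1 := by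
  induction n with
  | zero => rfl
  | succ n ih => rw [List.ofFn_succ, ← List.singleton_append, rd_append, ih, rd_one, mul_one]

theorem rd_ofFn_one_const (x : O.carrier) {n : ℕ} (h : n = 1) :
    rd (List.ofFn fun _ : Fin n => x) = rd [x] := by
  subst h; rfl

/-- Degrees add up to 0, so the left factor has degree 0 and is the unit. -/
theorem factorization_one_unique (hg : O.IsGrading dg) (p : O.Factorization O.one) :
    p = oneFactorization O.one := by
  refine eq_oneFactorization p ((hg.1 _).1 ?_)
  have h := hg.2 p.1.1 p.1.2
  rw [p.2, (hg.1 _).2 rfl] at h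
  omega

/-- This makes the formula for the coproduct of a letter valid for the unit as well, so that later
expansions need no case distinction. -/
theorem comulGen_one (hg : O.IsGrading dg) : O.comulGen K O.one = 1 := by
  have hu : Unique (O.Factorization O.one) := ⟨⟨oneFactorization _⟩, factorization_one_unique hg⟩
  have := Fintype.ofFinite (O.Factorization O.one)
  rw [comulGen_eq_sum, Fintype.sum_unique, factorization_one_unique hg default]
  change E K (rd [O.one]) ⊗ₜ[K] E K (rd (List.ofFn fun _ => O.one)) = 1
  rw [rd_one, rd_ofFn_const_one]
  rfl

theorem comul_E_singleton (hg : O.IsGrading dg) (x : O.carrier) :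
    O.comul K (E K (rd [x])) = O.comulGen K x := by
  by_cases h : x = O.one
  · rw [h, rd_one, E_one, map_one, comulGen_one hg]
  · exact comul_E_nonUnit ⟨x, h⟩

theorem counit_E_rd_of_ne {x : O.carrier} (h : x ≠ O.one) {l : List O.carrier} (hx : x ∈ l) :
    O.counit K (E K (rd l)) = 0 := by
  rw [E_rd_eq_prod, map_list_prod, List.prod_eq_zero]
  rw [List.map_map, List.mem_map]
  exact ⟨x, hx, counit_E_nonUnit ⟨x, h⟩⟩

theorem tmul_list_prod {R A B ι : Type*} [CommSemiring R] [Semiring A] [Algebra R A] [Semiring B]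
    [Algebra R B] (f : ι → A) (g : ι → B) (l : List ι) :
    (l.map fun i => f i ⊗ₜ[R] g i).prod = (l.map f).prod ⊗ₜ[R] (l.map g).prod := by
  induction l with
  | nil => rfl
  | cons i l ih => simp [ih, Algebra.TensorProduct.tmul_mul_tmul]

theorem tmul_ofFn_prod {R A B : Type*} [CommSemiring R] [Semiring A] [Algebra R A] [Semiring B]
    [Algebra R B] {n : ℕ} (f : Fin n → A) (g : Fin n → B) :
    (List.ofFn fun i => f i ⊗ₜ[R] g i).prod = (List.ofFn f).prod ⊗ₜ[R] (List.ofFn g).prod := by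
  have h := tmul_list_prod (R := R) f g (List.ofFn id)
  simpa only [List.map_ofFn, Function.comp_def, id] using h

/-- The coproduct is multiplicative, and the ordered product of the sums attached to the letters
expands over the families of factorizations. -/
theorem comul_E_ofFn (hg : O.IsGrading dg) {n : ℕ} (z : Fin n → O.carrier)
    [∀ x, Fintype (O.Factorization x)] :
    O.comul K (E K (rd (List.ofFn z))) = ∑ q : ∀ i, O.Factorization (z i),
      E K (rd (List.ofFn fun i => (q i).1.1)) ⊗ₜ[K]
        E K (rd (List.ofFn fun i => List.ofFn (q i).1.2).flatten) := by
  rw [E_rd_eq_prod, map_list_prod, List.map_map, List.map_ofFn]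
  simp only [Function.comp_def, comul_E_singleton hg, comulGen_eq_sum]
  rw [List.prod_ofFn_sum (fun i => O.Factorization (z i))]
  refine Finset.sum_congr rfl fun q _ => ?_
  rw [tmul_ofFn_prod, E_rd_flatten, E_rd_eq_prod, List.map_ofFn, List.map_ofFn]
  rfl

theorem comul_coassoc (hg : O.IsGrading dg) (hf : O.FinitelyFactorizable) :
    (Algebra.TensorProduct.assoc K K K (O.Natural K) (O.Natural K) (O.Natural K)).toAlgHom.comp
      ((Algebra.TensorProduct.map (O.comul K) (.id K (O.Natural K))).comp (O.comul K))
      = (Algebra.TensorProduct.map (.id K (O.Natural K)) (O.comul K)).comp (O.comul K) := by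
  refine natural_algHom_ext K fun x => ?_
  have (x : O.carrier) : Finite (O.Factorization x) := hf x
  have (x : O.carrier) : Fintype (O.Factorization x) := Fintype.ofFinite _
  have : Fintype (LeftFactorization x.1) := Fintype.ofEquiv _ (leftEquiv _).symm
  have : Fintype (RightFactorization x.1) := Fintype.ofEquiv _ (rightEquiv _).symm
  rw [AlgHom.comp_apply, AlgHom.comp_apply, AlgHom.comp_apply, comul_E_nonUnit, comulGen_eq_sum]
  simp only [map_sum, Algebra.TensorProduct.map_tmul, comul_E_singleton hg, comul_E_ofFn hg,
    comulGen_eq_sum, TensorProduct.sum_tmul, TensorProduct.tmul_sum, AlgHom.id_apply]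
  -- The left side factorizes the left factor again, the right side the right factors; both become
  -- sums over the same triples (p, q, w).
  rw [← Fintype.sum_sigma', ← Fintype.sum_sigma', ← (leftEquiv x.1).sum_comp,
    ← (rightEquiv x.1).sum_comp, ← (leftEquivRight x.1).sum_comp]
  refine Finset.sum_congr rfl fun t _ => ?_
  change E K (rd [t.1.1]) ⊗ₜ[K] (E K (rd (List.ofFn t.1.2.1)) ⊗ₜ[K] E K (rd (List.ofFn t.1.2.2))) =
    E K (rd [t.1.1]) ⊗ₜ[K] (E K (rd (List.ofFn t.1.2.1)) ⊗ₜ[K]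
      E K (rd (List.ofFn fun i => List.ofFn (arityCurry t.1.1 t.1.2.1 t.1.2.2 i)).flatten))
  rw [List.ofFn_finSigma _ (O.ar_comp t.1.1 t.1.2.1).symm t.1.2.2]
  rfl

/-- The counit kills every term whose left factor is not the unit, leaving x = 1[x]. -/
theorem rTensor_counit_comul (hf : O.FinitelyFactorizable) :
    (Algebra.TensorProduct.map (O.counit K) (.id K (O.Natural K))).comp (O.comul K)
      = (Algebra.TensorProduct.lid K (O.Natural K)).symm := by
  refine natural_algHom_ext K fun x => ?_
  have := hf x.1
  have := Fintype.ofFinite (O.Factorization x.1)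
  rw [AlgHom.comp_apply, comul_E_nonUnit, comulGen_eq_sum, map_sum,
    Finset.sum_eq_single (oneFactorization x.1)]
  · rw [Algebra.TensorProduct.map_tmul]
    change O.counit K (E K (rd [O.one])) ⊗ₜ[K] E K (rd (List.ofFn fun _ => x.1)) =
      1 ⊗ₜ[K] E K (rd [x.1])
    rw [rd_one, E_one, map_one]
    exact congrArg (fun w => 1 ⊗ₜ[K] E K w) (rd_ofFn_one_const x.1 O.ar_one)
  · intro p _ hp
    rw [Algebra.TensorProduct.map_tmul, counit_E_nonUnit ⟨p.1.1, fun h => hp (eq_oneFactorization p h)⟩,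
      TensorProduct.zero_tmul]
  · simp

/-- The counit kills every term with a right factor different from the unit, leaving x = x[1, …, 1].
-/
theorem lTensor_counit_comul (hf : O.FinitelyFactorizable) :
    (Algebra.TensorProduct.map (.id K (O.Natural K)) (O.counit K)).comp (O.comul K)
      = (Algebra.TensorProduct.rid K K (O.Natural K)).symm := by
  refine natural_algHom_ext K fun x => ?_
  have := hf x.1
  have := Fintype.ofFinite (O.Factorization x.1)
  rw [AlgHom.comp_apply, comul_E_nonUnit, comulGen_eq_sum, map_sum,
    Finset.sum_eq_single (factorizationOne x.1)]
  · rw [Algebra.TensorProduct.map_tmul]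
    change E K (rd [x.1]) ⊗ₜ[K] O.counit K (E K (rd (List.ofFn fun _ => O.one))) =
      E K (rd [x.1]) ⊗ₜ[K] 1
    rw [rd_ofFn_const_one, E_one, map_one]
  · intro p _ hp
    obtain ⟨i, hi⟩ : ∃ i, p.1.2 i ≠ O.one := by
      by_contra! h
      exact hp (eq_factorizationOne p h)
    rw [Algebra.TensorProduct.map_tmul, counit_E_rd_of_ne hi (List.mem_ofFn.2 ⟨i, rfl⟩),
      TensorProduct.tmul_zero]
  · simp

end Hopf

end NSOperad

/-! ### Antipode of a connected graded bialgebra -/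

section Antipode

open Coalgebra WithConv

variable {K : Type v} [Field K] {H : Type w} [Ring H] [Bialgebra K H] {I : Type w'}

/-- A bialgebra with a basis which is compatible with a connected grading has an antipode. -/
theorem exists_antipode_of_graded_basis (b : Module.Basis I K H) (d : I → ℕ)
    (hΔ : ∀ i, comul (R := K) (b i) ∈
      Submodule.span K {x | ∃ j k, d j + d k = d i ∧ x = b j ⊗ₜ[K] b k})
    (h0 : ∀ i, d i = 0 → algebraMap K H (counit (R := K) (b i)) = b i) :
    ∃ α : H →ₗ[K] H,
      LinearMap.mul' K H ∘ₗ α.rTensor H ∘ₗ comul = Algebra.linearMap K H ∘ₗ counit ∧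
      LinearMap.mul' K H ∘ₗ α.lTensor H ∘ₗ comul = Algebra.linearMap K H ∘ₗ counit := by
  -- For the convolution product the identity is 1 - J, so its inverse is the sum of the powers of
  -- J. As J vanishes in degree 0, J ^ n vanishes in degrees below n, and the series is finite on
  -- each basis element.
  set J : WithConv (H →ₗ[K] H) := 1 - toConv LinearMap.id with hJ
  have key : ∀ i {f g : H ⊗[K] H →ₗ[K] H},
      (∀ j k, d j + d k = d i → f (b j ⊗ₜ b k) = g (b j ⊗ₜ b k)) →
      f (comul (R := K) (b i)) = g (comul (R := K) (b i)) := by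
    intro i f g h
    rw [← sub_eq_zero, ← LinearMap.sub_apply]
    refine LinearMap.mem_ker.1 (Submodule.span_le.2 ?_ (hΔ i))
    rintro _ ⟨j, k, hjk, rfl⟩
    exact LinearMap.mem_ker.2 (by rw [LinearMap.sub_apply, h j k hjk, sub_self])
  have hJ0 : ∀ i, d i = 0 → J.ofConv (b i) = 0 := by
    intro i hi
    rw [hJ, ofConv_sub, LinearMap.sub_apply, sub_eq_zero]
    exact h0 i hi
  have hJn : ∀ n i, d i < n → (J ^ n).ofConv (b i) = 0 := by
    intro n
    induction n with
    | zero => intro i hi; omega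
    | succ n ih =>
      intro i hi
      rw [pow_succ]
      refine (key i (f := LinearMap.mul' K H ∘ₗ TensorProduct.map (J ^ n).ofConv J.ofConv) (g := 0)
        fun j k hjk => ?_).trans (LinearMap.zero_apply _)
      rw [LinearMap.comp_apply, TensorProduct.map_tmul, LinearMap.mul'_apply, LinearMap.zero_apply]
      -- Either the right tensor factor has degree 0 and is killed by J, or the left one has degree
      -- below n and is killed by J ^ n.
      rcases Nat.eq_zero_or_pos (d k) with hk | hk
      · rw [hJ0 k hk, mul_zero]
      · rw [ih j (by omega), zero_mul]
  set s : ℕ → WithConv (H →ₗ[K] H) := fun N => ∑ n ∈ Finset.range (N + 1), J ^ n with hs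
  have hsN : ∀ N i, d i ≤ N → (s N).ofConv (b i) = (s (d i)).ofConv (b i) := by
    intro N i hN
    simp only [hs, ofConv_sum, LinearMap.sum_apply]
    refine (Finset.sum_subset (Finset.range_subset_range.2 (by omega)) fun n _ hn => ?_).symm
    exact hJn n i (by simpa using hn)
  -- The truncation depends on the basis element. By `hsN` a longer truncation takes the same value,
  -- so α agrees with the single map `s (d i)` on all the tensor factors occurring in the coproduct
  -- of `b i`.
  set α : H →ₗ[K] H := b.constr K fun i => (s (d i)).ofConv (b i) with hα
  have hαb : ∀ i, α (b i) = (s (d i)).ofConv (b i) := fun i => b.constr_basis K _ i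
  have hid : toConv (LinearMap.id : H →ₗ[K] H) = 1 - J := by rw [hJ, sub_sub_cancel]
  have hfin : ∀ i, ((1 : WithConv (H →ₗ[K] H)) - J ^ (d i + 1)).ofConv (b i) =
      (Algebra.linearMap K H ∘ₗ counit) (b i) := by
    intro i
    rw [ofConv_sub, LinearMap.sub_apply, hJn _ _ (Nat.lt_succ_self _), sub_zero]
    rfl
  refine ⟨α, b.ext fun i => ?_, b.ext fun i => ?_⟩
  -- Telescoping: the truncated series times 1 - J is 1 - J ^ (d i + 1), which coincides with the
  -- convolution unit on `b i`.
  · rw [← hfin, ← geom_sum_mul_neg, ← hid]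
    refine key i (f := LinearMap.mul' K H ∘ₗ α.rTensor H)
      (g := LinearMap.mul' K H ∘ₗ TensorProduct.map (s (d i)).ofConv LinearMap.id) fun j k hjk => ?_
    simp only [LinearMap.comp_apply, LinearMap.rTensor_tmul, TensorProduct.map_tmul,
      LinearMap.mul'_apply, LinearMap.id_apply]
    rw [hαb, hsN (d i) j (by omega)]
  · rw [← hfin, ← mul_neg_geom_sum, ← hid]
    refine key i (f := LinearMap.mul' K H ∘ₗ α.lTensor H)
      (g := LinearMap.mul' K H ∘ₗ TensorProduct.map LinearMap.id (s (d i)).ofConv) fun j k hjk => ?_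
    simp only [LinearMap.comp_apply, LinearMap.lTensor_tmul, TensorProduct.map_tmul,
      LinearMap.mul'_apply, LinearMap.id_apply]
    rw [hαb, hsN (d i) k (by omega)]

end Antipode

/-! ### The grading on reduced words -/

namespace NSOperad

variable {K : Type v} [Field K] {O : NSOperad.{u}} {dg : O.carrier → ℕ}

/-- The additive extension of `dg` to reduced words. -/
def wordDeg (dg : O.carrier → ℕ) (w : O.RedWord) : ℕ := (w.toList.map fun y => dg y.1).sum

theorem wordDeg_mul (w w' : O.RedWord) : wordDeg dg (w * w') = wordDeg dg w + wordDeg dg w' := by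
  simp [wordDeg]

theorem wordDeg_rd_singleton (hg : O.IsGrading dg) (x : O.carrier) :
    wordDeg dg (rd [x]) = dg x := by
  by_cases h : x = O.one
  · rw [h, rd_one, (hg.1 _).2 rfl]; rfl
  · rw [show rd [x] = _ from rd_nonUnit ⟨x, h⟩]; simp [wordDeg]

theorem wordDeg_rd (hg : O.IsGrading dg) (l : List O.carrier) :
    wordDeg dg (rd l) = (l.map dg).sum := by
  induction l with
  | nil => rfl
  | cons x l ih =>
    rw [← List.singleton_append, rd_append, wordDeg_mul, ih, wordDeg_rd_singleton hg]
    simp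

theorem eq_one_of_wordDeg_eq_zero (hg : O.IsGrading dg) (w : O.RedWord) (h : wordDeg dg w = 0) :
    w = 1 := by
  induction w using FreeMonoid.inductionOn' with
  | one => rfl
  | of_mul x w _ =>
    rw [wordDeg_mul] at h
    refine absurd ((hg.1 x.1).1 ?_) x.2
    rw [← wordDeg_rd_singleton hg, rd_nonUnit]
    omega

/-- On a letter, homogeneity of the coproduct is the additivity of the degree under composition; it
passes to words because spans of homogeneous tensors multiply. -/
theorem comul_E_mem (hg : O.IsGrading dg) (hf : O.FinitelyFactorizable) (w : O.RedWord) :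
    O.comul K (E K w) ∈ Submodule.span K {x | ∃ j k : O.RedWord,
      wordDeg dg j + wordDeg dg k = wordDeg dg w ∧ x = E K j ⊗ₜ[K] E K k} := by
  induction w using FreeMonoid.inductionOn' with
  | one =>
    rw [E_one, map_one]
    exact Submodule.subset_span ⟨1, 1, rfl, rfl⟩
  | of_mul x w ih =>
    rw [E_mul, map_mul]
    have hx : O.comul K (E K (FreeMonoid.of x)) ∈ Submodule.span K {y | ∃ j k : O.RedWord,
        wordDeg dg j + wordDeg dg k = wordDeg dg (FreeMonoid.of x) ∧ y = E K j ⊗ₜ[K] E K k} := by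
      have := hf x.1
      have := Fintype.ofFinite (O.Factorization x.1)
      rw [← rd_nonUnit, comul_E_nonUnit, comulGen_eq_sum]
      refine Submodule.sum_mem _ fun p _ => Submodule.subset_span ⟨_, _, ?_, rfl⟩
      rw [wordDeg_rd_singleton hg, wordDeg_rd_singleton hg, wordDeg_rd hg, List.map_ofFn,
        List.sum_ofFn]
      exact (hg.2 p.1.1 p.1.2).symm.trans (congrArg dg p.2)
    have h := Submodule.mul_mem_mul hx ih
    rw [Submodule.span_mul_span] at h
    refine Submodule.span_mono ?_ h
    rintro _ ⟨_, ⟨j, k, hjk, rfl⟩, _, ⟨j', k', hjk', rfl⟩, rfl⟩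
    refine ⟨j * j', k * k', ?_, ?_⟩
    · simp only [wordDeg_mul]; omega
    · simp only [Algebra.TensorProduct.tmul_mul_tmul, E_mul]

/-- The natural bialgebra of a graded finitely factorizable operad is a Hopf algebra. -/
theorem isHopfAlgebra (hg : O.IsGrading dg) (hf : O.FinitelyFactorizable) :
    IsHopfAlgebra (O.comul K) (O.counit K) where
  coassoc := comul_coassoc hg hf
  rTensor_counit := rTensor_counit_comul hf
  lTensor_counit := lTensor_counit_comul hf
  exists_antipode := by
    let _ : Bialgebra K (O.Natural K) := Bialgebra.ofAlgHom (O.comul K) (O.counit K)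
      (comul_coassoc hg hf) (rTensor_counit_comul hf) (lTensor_counit_comul hf)
    have hb : ∀ w, MonoidAlgebra.basis O.RedWord K w = E K w := fun w =>
      MonoidAlgebra.basis_apply ..
    refine exists_antipode_of_graded_basis (MonoidAlgebra.basis O.RedWord K) (wordDeg dg)
      (fun w => ?_) fun w hw => ?_
    · simp only [hb]
      exact comul_E_mem hg hf w
    · rw [hb, eq_one_of_wordDeg_eq_zero hg w hw, E_one]
      exact (congrArg _ (map_one (O.counit K))).trans (map_one _)

end NSOperad

/-! ## Finiteness -/

/-- All the factors of x have degree at most that of x, so a factorization is a left factor from a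
finite set with a tuple from the same finite set. -/
theorem NSOperad.IsGrading.finitelyFactorizable {O : NSOperad.{u}} {dg : O.carrier → ℕ}
    (hg : O.IsGrading dg) (h : ∀ d, {x | dg x ≤ d}.Finite) : O.FinitelyFactorizable := by
  intro x
  have : Finite {y | dg y ≤ dg x} := h (dg x)
  have hle : ∀ p : O.Factorization x, dg p.1.1 + ∑ i, dg (p.1.2 i) = dg x := fun p => by
    rw [← hg.2, p.2]
  let f : O.Factorization x →
      Σ y : {y | dg y ≤ dg x}, (Fin (O.ar y.1) → {y | dg y ≤ dg x}) := fun p =>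
    ⟨⟨p.1.1, (Nat.le_add_right _ _).trans (hle p).le⟩, fun i => ⟨p.1.2 i,
      ((Finset.single_le_sum (f := fun i => dg (p.1.2 i)) (fun _ _ => Nat.zero_le _)
        (Finset.mem_univ i)).trans (Nat.le_add_left _ _)).trans (hle p).le⟩⟩
  let g : (Σ y : {y | dg y ≤ dg x}, (Fin (O.ar y.1) → {y | dg y ≤ dg x})) →
      (y : O.carrier) × (Fin (O.ar y) → O.carrier) := fun q => ⟨q.1.1, fun i => (q.2 i).1⟩
  refine Finite.of_injective f fun p p' hp => Subtype.ext ?_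
  exact congrArg g hp

section Finiteness

variable {S : ℕ → Type u} {r s : ℕ}

theorem HasProfile.arity_eq (hS : HasProfile S r s) {n : ℕ} (g : S n) : n = r + 1 := by
  by_contra h
  have h1 := (hS n).2
  have := (hS n).1
  rw [if_neg h, Finite.card_eq_zero_iff] at h1
  exact h1.elim g

theorem HasProfile.finite_sigma (hS : HasProfile S r s) : Finite (Σ n, S n) := by
  have := (hS (r + 1)).1
  refine Finite.of_surjective (fun g : S (r + 1) => (⟨_, g⟩ : Σ n, S n)) ?_
  rintro ⟨n, g⟩
  obtain rfl := hS.arity_eq g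
  exact ⟨g, rfl⟩

theorem STerm.deg_eq_zero {t : STerm S} : t.deg = 0 ↔ t = STerm.leaf := by
  cases t with
  | leaf => simp [STerm.deg]
  | node g ts => simp [STerm.deg]

/-- The root uses one unit of degree, so a tree of degree at most d + 1 is a leaf or a generator
with a tuple of children of degree at most d. -/
theorem STerm.finite_deg_le [Finite (Σ n, S n)] (d : ℕ) : {t : STerm S | t.deg ≤ d}.Finite := by
  induction d with
  | zero =>
    refine (Set.finite_singleton STerm.leaf).subset fun t ht => ?_
    exact STerm.deg_eq_zero.1 (Nat.le_zero.1 ht)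
  | succ d ih =>
    have : Finite {t : STerm S | t.deg ≤ d} := ih
    refine ((Set.finite_singleton STerm.leaf).union (Set.finite_range
      fun p : (Σ g : (Σ n, S n), (Fin g.1 → {t : STerm S | t.deg ≤ d})) =>
        STerm.node p.1.2 fun i => (p.2 i).1)).subset fun t ht => ?_
    cases t with
    | leaf => exact Or.inl rfl
    | node g ts =>
      refine Or.inr ⟨⟨⟨_, g⟩, fun i => ⟨ts i, ?_⟩⟩, rfl⟩
      have h1 : 1 + ∑ i, (ts i).deg ≤ d + 1 := ht
      have h2 := Finset.single_le_sum (f := fun i => (ts i).deg) (fun _ _ => Nat.zero_le _)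
        (Finset.mem_univ i)
      change (ts i).deg ≤ d
      dsimp only at h2
      omega

theorem freeOperad_isGrading (S : ℕ → Type u) : (freeOperad S).IsGrading STerm.deg :=
  ⟨fun _ => STerm.deg_eq_zero, STerm.deg_graft⟩

/-- Equivalent trees have the same degree, and the leaf is the only tree of degree 0. -/
theorem masCongr_rel_leaf {t : STerm S} : (masCongr S).rel t STerm.leaf ↔ t = STerm.leaf :=
  ⟨fun h => STerm.deg_eq_zero.1 (masCongr_deg h), fun h => h ▸ (masCongr S).iseqv.refl _⟩

theorem MAs_isGrading (S : ℕ → Type u) : (MAs S).IsGrading (MAs.deg S) := by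
  refine ⟨fun x => ?_, fun y z => ?_⟩
  · obtain ⟨t, rfl⟩ := (masCongr S).exists_rep x
    exact (STerm.deg_eq_zero (t := t)).trans
      (masCongr_rel_leaf.symm.trans (masCongr S).cls_eq.symm)
  · obtain ⟨t, rfl⟩ := (masCongr S).exists_rep y
    have h := (masCongr S).quoComp_cls t (fun i => (masCongr S).out (z i)) z fun i i' hi =>
      (congrArg z (Fin.ext hi)).trans ((masCongr S).cls_out (z i')).symm
    refine (congrArg (MAs.deg S) h).trans ((STerm.deg_graft _ _).trans ?_)
    refine congrArg (STerm.deg t + ·) (Finset.sum_congr rfl fun i _ => ?_)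
    exact congrArg (MAs.deg S) ((masCongr S).cls_out (z i))

theorem masCongr_finiteType [Finite (Σ n, S n)] : (masCongr S).FiniteType := fun x =>
  (STerm.finite_deg_le (STerm.deg x)).subset fun _ h => (masCongr_deg h).ge

theorem freeOperad_finitelyFactorizable [Finite (Σ n, S n)] :
    (freeOperad S).FinitelyFactorizable :=
  (freeOperad_isGrading S).finitelyFactorizable STerm.finite_deg_le

theorem MAs_finitelyFactorizable [Finite (Σ n, S n)] : (MAs S).FinitelyFactorizable := by
  refine (MAs_isGrading S).finitelyFactorizable fun d => ?_
  refine ((STerm.finite_deg_le (S := S) d).image (masCongr S).cls).subset fun x hx => ?_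
  obtain ⟨t, rfl⟩ := (masCongr S).exists_rep x
  exact ⟨t, hx, rfl⟩

end Finiteness

/-! ### Positions of internal nodes in preorder -/

theorem Fin.sum_Iio_zero {n : ℕ} (d : Fin (n + 1) → ℕ) : ∑ k ∈ Finset.Iio 0, d k = 0 :=
  Finset.sum_eq_zero fun k hk => absurd (Finset.mem_Iio.1 hk) (Fin.not_lt_zero k)

theorem Fin.sum_Iio_succ_eq {n : ℕ} (d : Fin (n + 1) → ℕ) (i : Fin n) :
    ∑ k ∈ Finset.Iio i.succ, d k = d 0 + ∑ k ∈ Finset.Iio i, d k.succ := by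
  have h : ∀ {m : ℕ} (j : Fin m) (e : Fin m → ℕ),
      ∑ k ∈ Finset.Iio j, e k = ∑ k, if k < j then e k else 0 := by
    intro m j e
    rw [← Finset.sum_filter]
    congr 1
    ext
    simp
  rw [h, h, Fin.sum_univ_succ]
  simp

theorem Fin.sum_Iio_add_le {n : ℕ} (d : Fin n → ℕ) (i : Fin n) :
    ∑ k ∈ Finset.Iio i, d k + d i ≤ ∑ k, d k := by
  rw [add_comm, ← Finset.sum_insert (by simp)]
  exact Finset.sum_le_sum_of_subset (Finset.subset_univ _)

/-- Locates a position of a concatenation inside a block; in preorder the blocks are the children of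
the root and the partial sums are their offsets. -/
theorem List.getElem?_flatten_ofFn {α : Type*} : ∀ {n : ℕ} (L : Fin n → List α) (m : ℕ) (a : α),
    (List.ofFn L).flatten[m]? = some a ↔
      ∃ i k, m = ∑ j ∈ Finset.Iio i, (L j).length + k ∧ (L i)[k]? = some a
  | 0, L, m, a => by simp
  | n + 1, L, m, a => by
    rw [List.ofFn_succ, List.flatten_cons, Fin.exists_fin_succ, List.getElem?_append]
    simp only [Fin.sum_Iio_zero, Fin.sum_Iio_succ_eq fun j => (L j).length]
    split_ifs with h
    · constructor
      · intro h1
        exact Or.inl ⟨m, (zero_add _).symm, h1⟩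
      · rintro (⟨k, rfl, h1⟩ | ⟨i, k, rfl, h1⟩)
        · rwa [zero_add]
        · omega
    · rw [List.getElem?_flatten_ofFn (fun i => L i.succ)]
      constructor
      · rintro ⟨i, k, h1, h2⟩
        exact Or.inr ⟨i, k, by omega, h2⟩
      · rintro (⟨k, rfl, h1⟩ | ⟨i, k, rfl, h1⟩)
        · obtain ⟨h2, -⟩ := List.getElem?_eq_some_iff.1 h1
          omega
        · exact ⟨i, k, by omega, h1⟩

namespace STerm

variable {S : ℕ → Type u}

theorem offset_add_deg_le {n : ℕ} (g : S n) (ts : Fin n → STerm S) (i : Fin n) :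
    offset ts i + (ts i).deg ≤ (node g ts).deg := by
  have := Fin.sum_Iio_add_le (fun i => (ts i).deg) i
  simp only [offset, deg] at this ⊢
  omega

theorem length_nodes (t : STerm S) : t.nodes.length = t.deg := by
  induction t with
  | leaf => rfl
  | node g ts ih =>
    simp only [nodes, deg, List.length_cons, List.length_flatten, List.map_ofFn, List.sum_ofFn,
      Function.comp_def, ih]
    omega

theorem Edge.lt {t : STerm S} {j : ℕ+} {a b : ℕ} (h : t.Edge j a b) : a < b ∧ b < t.deg := by
  induction t generalizing a b with
  | leaf => exact h.elim
  | node g ts ih =>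
    obtain ⟨i, ⟨h1, -, rfl, rfl⟩ | ⟨a', b', h1, rfl, rfl⟩⟩ := h
    · have h2 := offset_add_deg_le g ts i
      have h3 : (ts i).deg ≠ 0 := fun h => h1 (deg_eq_zero.1 h)
      have h4 : offset ts i ≠ 0 := by simp [offset]
      omega
    · have h2 := offset_add_deg_le g ts i
      have := ih i h1
      omega

end STerm

/-! ### Compatibility of words with trees and forests -/

namespace SForest

variable {S : ℕ → Type u}

theorem isRoot_singleton {t : STerm S} {a : ℕ} :
    IsRoot [t] a ↔ t ≠ STerm.leaf ∧ a = 0 := by simp [IsRoot]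

theorem edge_singleton {t : STerm S} {j : ℕ+} {a b : ℕ} :
    Edge [t] j a b ↔ t.Edge j a b := by simp [Edge]

theorem nodes_singleton (t : STerm S) : nodes [t] = t.nodes := by simp [nodes]

theorem nodes_cons (t : STerm S) (f : SForest S) : nodes (t :: f) = t.nodes ++ nodes f := by
  simp [nodes]

theorem deg_cons (t : STerm S) (f : SForest S) : deg (t :: f) = t.deg + deg f := by
  simp [deg]

theorem deg_singleton (t : STerm S) : deg [t] = t.deg := by simp [deg]

/-- In preorder the nodes of the first tree form an initial block, and no edge joins two different
trees; the conditions on the two blocks are independent. -/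
theorem compatible_cons (A : ForestAlphabet S) (w : List A.carrier) (t : STerm S) (f : SForest S) :
    Compatible A w (t :: f) ↔
      Compatible A (w.take t.deg) [t] ∧ Compatible A (w.drop t.deg) f := by
  have htake : ∀ {i : ℕ} {a : A.carrier}, (w.take t.deg)[i]? = some a ↔ i < t.deg ∧ w[i]? = some a := by
    intro i a
    rw [List.getElem?_take]
    split_ifs with h <;> simp [h]
  constructor
  · intro h
    have hl := h.length_eq
    rw [deg_cons] at hl
    refine ⟨⟨?_, ?_, ?_, ?_⟩, ⟨?_, ?_, ?_, ?_⟩⟩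
    · rw [List.length_take, deg_singleton]; omega
    · intro i a hi ha
      exact h.root i a (Or.inl (isRoot_singleton.1 hi)) (htake.1 ha).2
    · intro i a g hi ha
      refine h.deco i a g ?_ (htake.1 ha).2
      rw [nodes_singleton] at hi
      rw [nodes_cons, List.getElem?_append_left (by rw [STerm.length_nodes]; exact (htake.1 ha).1), hi]
    · intro i i' j a a' he ha ha'
      exact h.edge i i' j a a' (Or.inl (edge_singleton.1 he)) (htake.1 ha).2 (htake.1 ha').2
    · rw [List.length_drop]; omega
    · intro i a hi ha
      rw [List.getElem?_drop] at ha
      exact h.root _ a (Or.inr ⟨i, hi, rfl⟩) ha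
    · intro i a g hi ha
      rw [List.getElem?_drop] at ha
      refine h.deco _ a g ?_ ha
      rw [nodes_cons, ← STerm.length_nodes, List.getElem?_append_right (by omega),
        Nat.add_sub_cancel_left, hi]
    · intro i i' j a a' he ha ha'
      rw [List.getElem?_drop] at ha ha'
      exact h.edge _ _ j a a' (Or.inr ⟨i, i', he, rfl, rfl⟩) ha ha'
  · rintro ⟨h1, h2⟩
    have hl1 := h1.length_eq
    have hl2 := h2.length_eq
    rw [List.length_take, deg_singleton] at hl1
    rw [List.length_drop] at hl2
    refine ⟨?_, ?_, ?_, ?_⟩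
    · rw [deg_cons]; omega
    · rintro i a (⟨ht, rfl⟩ | ⟨i, hi, rfl⟩) ha
      · refine h1.root 0 a (isRoot_singleton.2 ⟨ht, rfl⟩) (htake.2 ⟨?_, ha⟩)
        exact Nat.pos_of_ne_zero fun h => ht (STerm.deg_eq_zero.1 h)
      · exact h2.root i a hi (by rwa [List.getElem?_drop])
    · intro i a g hi ha
      rw [nodes_cons, List.getElem?_append, STerm.length_nodes] at hi
      split_ifs at hi with h
      · exact h1.deco i a g (by rwa [nodes_singleton]) (htake.2 ⟨h, ha⟩)
      · refine h2.deco _ a g hi ?_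
        rwa [List.getElem?_drop, Nat.add_sub_of_le (by omega)]
    · rintro i i' j a a' (he | ⟨i, i', he, rfl, rfl⟩) ha ha'
      · have := he.lt
        exact h1.edge i i' j a a' (edge_singleton.2 he) (htake.2 ⟨by omega, ha⟩)
          (htake.2 ⟨by omega, ha'⟩)
      · exact h2.edge i i' j a a' he (by rwa [List.getElem?_drop]) (by rwa [List.getElem?_drop])

theorem compatible_nil (A : ForestAlphabet S) (w : List A.carrier) :
    Compatible A w [] ↔ w = [] := by
  constructor
  · intro h
    exact List.length_eq_zero_iff.1 h.length_eq
  · rintro rfl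
    exact ⟨rfl, by simp, by simp, by simp⟩

theorem compatible_leaf (A : ForestAlphabet S) (w : List A.carrier) :
    Compatible A w [STerm.leaf] ↔ w = [] := by
  rw [compatible_cons, compatible_nil]
  change Compatible A (w.take 0) _ ∧ w.drop 0 = [] ↔ _
  constructor
  · intro h
    exact h.2
  · rintro rfl
    exact ⟨⟨rfl, by simp, by simp, by simp⟩, rfl⟩

end SForest

/-- The alphabet `A` with another root relation. -/
abbrev ForestAlphabet.withRoot {S : ℕ → Type u} (A : ForestAlphabet S) (Q : A.carrier → Prop) :
    ForestAlphabet S where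
  carrier := A.carrier
  root := Q
  deco := A.deco
  edge := A.edge

namespace SForest

variable {S : ℕ → Type u}

theorem compatible_node_nil (A : ForestAlphabet S) {n : ℕ} (g : S n) (ts : Fin n → STerm S) :
    ¬ Compatible A [] [STerm.node g ts] := by
  intro h
  have := h.length_eq
  rw [deg_singleton, STerm.deg, List.length_nil] at this
  omega

/-- The subtrees interact only through the root letter `a`. The edge from `a` to the root of the
i-th child is a condition on that root alone, so replacing the root relation by `A.edge
(Nat.succPNat i) a` makes each child an independent tree. This is the recursion behind all later
inductions on trees. -/
theorem compatible_node_cons (A : ForestAlphabet S) {n : ℕ} (g : S n) (ts : Fin n → STerm S)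
    (a : A.carrier) (w : List A.carrier) : Compatible A (a :: w) [STerm.node g ts] ↔
      (A.root a ∧ A.deco g a) ∧ w.length = ∑ i, (ts i).deg ∧
        ∀ i : Fin n, Compatible (A.withRoot (A.edge (Nat.succPNat i) a))
          ((w.drop (∑ k ∈ Finset.Iio i, (ts k).deg)).take (ts i).deg) [ts i] := by
  set o : Fin n → ℕ := fun i => ∑ k ∈ Finset.Iio i, (ts k).deg with ho
  have hoff : ∀ i, STerm.offset ts i = 1 + o i := fun i => rfl
  -- The letter `a` takes position 0, hence a shift by one between positions in `w` and in `a :: w`.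
  have hslice : ∀ {i : Fin n} {k : ℕ} {b : A.carrier}, ((w.drop (o i)).take (ts i).deg)[k]? = some b ↔
      k < (ts i).deg ∧ (a :: w)[STerm.offset ts i + k]? = some b := by
    intro i k b
    rw [List.getElem?_take, hoff, show 1 + o i + k = (o i + k) + 1 by omega, List.getElem?_cons_succ,
      List.getElem?_drop]
    split_ifs with h <;> simp [h]
  have hnodes : ∀ {m : ℕ} {h : Σ n, S n}, (STerm.node g ts).nodes[m]? = some h ↔
      (m = 0 ∧ h = ⟨n, g⟩) ∨
        ∃ i k, m = STerm.offset ts i + k ∧ (ts i).nodes[k]? = some h := by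
    intro m h
    rw [STerm.nodes]
    rcases m with _ | m
    · simp only [List.getElem?_cons_zero, Option.some.injEq, true_and, hoff]
      refine ⟨fun h => Or.inl h.symm, ?_⟩
      rintro (h | ⟨i, k, h, -⟩)
      · exact h.symm
      · omega
    · rw [List.getElem?_cons_succ, List.getElem?_flatten_ofFn]
      simp only [STerm.length_nodes, hoff]
      constructor
      · rintro ⟨i, k, h1, h2⟩
        exact Or.inr ⟨i, k, by change m = o i + k at h1; omega, h2⟩
      · rintro (⟨h, -⟩ | ⟨i, k, h1, h2⟩)
        · omega
        · exact ⟨i, k, by change m = o i + k; omega, h2⟩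
  constructor
  · intro h
    have hl := h.length_eq
    rw [deg_singleton, STerm.deg, List.length_cons] at hl
    have hl' : w.length = ∑ i, (ts i).deg := by omega
    refine ⟨⟨?_, ?_⟩, hl', fun i => ⟨?_, ?_, ?_, ?_⟩⟩
    · exact h.root 0 a (isRoot_singleton.2 ⟨by simp, rfl⟩) rfl
    · exact h.deco 0 a ⟨n, g⟩ (by rw [nodes_singleton, hnodes]; exact Or.inl ⟨rfl, rfl⟩) rfl
    · have := Fin.sum_Iio_add_le (fun i => (ts i).deg) i
      rw [deg_singleton, List.length_take, List.length_drop]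
      change (ts i).deg ⊓ (w.length - o i) = _
      change o i + _ ≤ _ at this
      omega
    · intro k b hk hb
      obtain ⟨h1, rfl⟩ := isRoot_singleton.1 hk
      refine h.edge 0 (STerm.offset ts i) _ a b (edge_singleton.2 ?_) rfl (hslice.1 hb).2
      exact ⟨i, Or.inl ⟨h1, rfl, rfl, rfl⟩⟩
    · intro k b g' hk hb
      refine h.deco (STerm.offset ts i + k) b g' ?_ (hslice.1 hb).2
      rw [nodes_singleton] at hk ⊢
      exact hnodes.2 (Or.inr ⟨i, k, rfl, hk⟩)
    · intro k k' j b b' he hb hb'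
      refine h.edge (STerm.offset ts i + k) (STerm.offset ts i + k') j b b' (edge_singleton.2 ?_)
        (hslice.1 hb).2 (hslice.1 hb').2
      exact ⟨i, Or.inr ⟨k, k', edge_singleton.1 he, rfl, rfl⟩⟩
  · rintro ⟨⟨hr, hd⟩, hl, h⟩
    refine ⟨?_, ?_, ?_, ?_⟩
    · rw [deg_singleton, STerm.deg, List.length_cons, hl, add_comm]
    · intro i b hi hb
      obtain ⟨-, rfl⟩ := isRoot_singleton.1 hi
      obtain rfl : a = b := by simpa using hb
      exact hr
    · intro m b g' hm hb
      rw [nodes_singleton, hnodes] at hm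
      obtain ⟨rfl, rfl⟩ | ⟨i, k, rfl, hk⟩ := hm
      · obtain rfl : a = b := by simpa using hb
        exact hd
      · have hk' : k < (ts i).deg := by
          rw [← STerm.length_nodes]
          exact (List.getElem?_eq_some_iff.1 hk).1
        exact (h i).deco k b g' (by rwa [nodes_singleton]) (hslice.2 ⟨hk', hb⟩)
    · intro m m' j b b' he hb hb'
      obtain ⟨i, ⟨h1, hj, rfl, rfl⟩ | ⟨k, k', h1, rfl, rfl⟩⟩ := edge_singleton.1 he
      · obtain rfl : a = b := by simpa using hb
        -- Children are numbered from 0 and edge labels from 1.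
        obtain rfl : j = Nat.succPNat i := PNat.eq hj
        refine (h i).root 0 b' (isRoot_singleton.2 ⟨h1, rfl⟩) (hslice.2 ⟨?_, hb'⟩)
        exact Nat.pos_of_ne_zero fun h => h1 (STerm.deg_eq_zero.1 h)
      · have := h1.lt
        exact (h i).edge k k' j b b' (edge_singleton.2 h1) (hslice.2 ⟨by omega, hb⟩)
          (hslice.2 ⟨by omega, hb'⟩)

end SForest

/-! ### Polynomials of trees and forests -/

section ForestPoly

variable (K : Type v) [Field K] {S : ℕ → Type u}

/-- A homogeneous left factor of degree d allows only the cut after d letters. -/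
theorem NCSeries.coeff_mul_of_length {K : Type v} [Field K] {A : Type u} (f g : NCSeries K A) (d : ℕ)
    (hf : ∀ w : List A, w.length ≠ d → f.coeff w = 0) (w : List A) :
    (f * g).coeff w = f.coeff (w.take d) * g.coeff (w.drop d) := by
  rw [coeff_mul]
  by_cases h : d ≤ w.length
  · refine Finset.sum_eq_single d (fun i hi hid => ?_) fun h' => absurd (Finset.mem_range.2 ?_) h'
    · rw [hf, zero_mul]
      rw [Finset.mem_range] at hi
      rw [List.length_take]
      omega
    · omega
  · rw [hf (w.take d) (by rw [List.length_take]; omega), zero_mul]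
    refine Finset.sum_eq_zero fun i hi => ?_
    rw [hf, zero_mul]
    rw [Finset.mem_range] at hi
    rw [List.length_take]
    omega

open Classical in
theorem coeff_forestPoly (A : ForestAlphabet S) (f : SForest S) (w : List A.carrier) :
    (forestPoly K A f).1.coeff w = if SForest.Compatible A w f then 1 else 0 := rfl

theorem coeff_forestPoly_of_length (A : ForestAlphabet S) (f : SForest S) (w : List A.carrier)
    (h : w.length ≠ f.deg) : (forestPoly K A f).1.coeff w = 0 := by
  classical
  exact if_neg fun h' => h h'.length_eq

theorem forestPoly_cons (A : ForestAlphabet S) (t : STerm S) (f : SForest S) :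
    forestPoly K A (t :: f) = forestPoly K A [t] * forestPoly K A f := by
  classical
  refine Subtype.ext (NCSeries.ext fun w => ?_)
  refine Eq.trans ?_ (NCSeries.coeff_mul_of_length _ _ t.deg (fun w hw =>
    coeff_forestPoly_of_length K A [t] w (by rwa [SForest.deg_singleton])) w).symm
  rw [coeff_forestPoly, coeff_forestPoly, coeff_forestPoly, SForest.compatible_cons,
    ite_zero_mul_ite_zero, mul_one]
  congr

theorem forestPoly_nil (A : ForestAlphabet S) : forestPoly K A [] = 1 := by
  classical
  refine Subtype.ext (NCSeries.ext fun w => ?_)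
  rw [coeff_forestPoly, SForest.compatible_nil]
  refine Eq.trans ?_ (NCSeries.coeff_one (K := K) w).symm
  congr

theorem forestPoly_leaf (A : ForestAlphabet S) : forestPoly K A [STerm.leaf] = 1 := by
  classical
  refine Subtype.ext (NCSeries.ext fun w => ?_)
  rw [coeff_forestPoly, SForest.compatible_leaf]
  refine Eq.trans ?_ (NCSeries.coeff_one (K := K) w).symm
  congr

open Classical in
-- All factors are indicator series of sets of words of fixed lengths, so a word has a single
-- possible cutting into blocks.
theorem coeff_prod_ofFn_forestPoly {A : Type u} : ∀ {n : ℕ} (P : Fin n → List A → Prop)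
    (d : Fin n → ℕ) (_ : ∀ i w, P i w → w.length = d i) (f : Fin n → NCSeries K A)
    (_ : ∀ i w, (f i).coeff w = if P i w then 1 else 0) (w : List A),
    (List.ofFn f).prod.coeff w = if w.length = ∑ i, d i ∧
      ∀ i, P i ((w.drop (∑ k ∈ Finset.Iio i, d k)).take (d i)) then 1 else 0
  | 0, P, d, hd, f, hf, w => by
    rw [List.ofFn_zero, List.prod_nil, NCSeries.coeff_one]
    simp
  | n + 1, P, d, hd, f, hf, w => by
    rw [List.ofFn_succ, List.prod_cons, NCSeries.coeff_mul_of_length _ _ (d 0) (fun w hw => by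
      rw [hf, if_neg fun h => hw (hd _ _ h)]), hf,
      coeff_prod_ofFn_forestPoly (fun i => P i.succ) (fun i => d i.succ) (fun i => hd i.succ) _
        (fun i => hf i.succ), ite_zero_mul_ite_zero, mul_one]
    refine if_congr ?_ rfl rfl
    simp only [Fin.forall_fin_succ, Fin.sum_univ_succ, Fin.sum_Iio_zero, Fin.sum_Iio_succ_eq d, List.drop_zero, List.drop_drop]
    constructor
    · rintro ⟨h1, h2, h3⟩
      have := hd _ _ h1
      rw [List.length_take] at this
      rw [List.length_drop] at h2
      exact ⟨by omega, h1, h3⟩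
    · rintro ⟨h1, h2, h3⟩
      exact ⟨h2, by rw [List.length_drop]; omega, h3⟩

theorem coeff_forestPoly_node_nil (A : ForestAlphabet S) {n : ℕ} (g : S n) (ts : Fin n → STerm S) :
    (forestPoly K A [STerm.node g ts]).1.coeff [] = 0 := by
  classical
  exact if_neg (SForest.compatible_node_nil A g ts)

/-- The polynomial of the tree `t`, where the letter of the root is constrained by `Q`. -/
noncomputable def rootPoly (A : ForestAlphabet S) (Q : A.carrier → Prop) (t : STerm S) :
    NCPoly K A.carrier :=
  forestPoly K (A.withRoot Q) [t]

open Classical in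
-- Once the first letter `a` is fixed, what remains is an ordered product over the children, each
-- with its root constrained by `a`.
theorem coeff_forestPoly_node_cons (A : ForestAlphabet S) {n : ℕ} (g : S n) (ts : Fin n → STerm S)
    (a : A.carrier) (w : List A.carrier) :
    (forestPoly K A [STerm.node g ts]).1.coeff (a :: w) =
      if A.root a ∧ A.deco g a then
        (List.ofFn fun i : Fin n =>
          (rootPoly K A (A.edge (Nat.succPNat i) a) (ts i)).1).prod.coeff w
      else 0 := by
  have hprod := coeff_prod_ofFn_forestPoly K
    (fun i w => SForest.Compatible (A.withRoot (A.edge (Nat.succPNat i) a)) w [ts i])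
    (fun i => (ts i).deg) (fun i w h => by rw [h.length_eq, SForest.deg_singleton]) _
    (fun i w => coeff_forestPoly K (A.withRoot _) [ts i] w) w
  rw [coeff_forestPoly]
  by_cases h : A.root a ∧ A.deco g a
  · rw [if_pos h]
    refine Eq.trans ?_ hprod.symm
    exact if_congr ((SForest.compatible_node_cons A g ts a w).trans (and_iff_right h)) rfl rfl
  · rw [if_neg h, if_neg fun h' => h ((SForest.compatible_node_cons A g ts a w).1 h').1]

end ForestPoly

/-! ### Multiplicativity of `theta` and sums over shuffles -/

namespace NCPoly

variable {K : Type v} [Field K] {A : Type u} {B : Type u'}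

/-- The words on `A ⊔ B` that restrict to `u` on `A` and to `v` on `B`. -/
noncomputable def shuffles (u : List A) (v : List B) : Finset (List (A ⊕ B)) :=
  (finite_theta u v).toFinset

theorem mem_shuffles {u : List A} {v : List B} {w : List (A ⊕ B)} : w ∈ shuffles u v ↔
    w.filterMap Sum.getLeft? = u ∧ w.filterMap Sum.getRight? = v := by
  simp [shuffles]

theorem theta_eq_sum (f : NCPoly K (A ⊕ B)) (u : List A) (v : List B) :
    theta f u v = ∑ w ∈ shuffles u v, f.1.coeff w :=
  finsum_mem_eq_finite_toFinset_sum _ _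

theorem theta_add (f g : NCPoly K (A ⊕ B)) : theta (f + g) = theta f + theta g := by
  funext u v
  simp only [Pi.add_apply, theta_eq_sum, ← Finset.sum_add_distrib]
  rfl

theorem theta_smul (c : K) (f : NCPoly K (A ⊕ B)) : theta (c • f) = c • theta f := by
  funext u v
  simp only [Pi.smul_apply, theta_eq_sum, Finset.smul_sum]
  rfl

/-- `theta` as a linear map. -/
noncomputable def thetaLin : NCPoly K (A ⊕ B) →ₗ[K] (List A → List B → K) where
  toFun := theta
  map_add' := theta_add
  map_smul' := theta_smul

/-- Restriction to each summand of the alphabet is compatible with concatenation. The right side has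
the same shape as the product formula for `tensorCoeff`, so identities between `theta` and
`tensorCoeff` can be multiplied. -/
theorem theta_mul (f g : NCPoly K (A ⊕ B)) (u : List A) (v : List B) :
    theta (f * g) u v = ∑ i ∈ Finset.range (u.length + 1), ∑ j ∈ Finset.range (v.length + 1),
      theta f (u.take i) (v.take j) * theta g (u.drop i) (v.drop j) := by
  rw [← Finset.sum_product']
  simp only [theta_eq_sum, Finset.sum_mul_sum]
  simp only [← Finset.sum_product']
  rw [Finset.sum_sigma']
  refine (Finset.sum_congr rfl fun w _ => NCSeries.coeff_mul f.1 g.1 w).trans ?_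
  rw [Finset.sum_sigma']
  -- A shuffle cut after k letters corresponds to cuts of `u` and `v` with shuffles of the pieces:
  -- the two cuts count the letters of each alphabet among the first k letters.
  refine Finset.sum_nbij'
    (fun p => ⟨(((p.1.take p.2).filterMap Sum.getLeft?).length,
      ((p.1.take p.2).filterMap Sum.getRight?).length), (p.1.take p.2, p.1.drop p.2)⟩)
    (fun q => ⟨q.2.1 ++ q.2.2, q.2.1.length⟩) ?_ ?_ ?_ ?_ ?_
  · rintro ⟨w, k⟩ h
    simp only [Finset.mem_sigma, Finset.mem_range, mem_shuffles, Finset.mem_product] at h ⊢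
    obtain ⟨⟨rfl, rfl⟩, -⟩ := h
    have hl : w.filterMap Sum.getLeft? = (w.take k).filterMap Sum.getLeft? ++
        (w.drop k).filterMap Sum.getLeft? := by
      rw [← List.filterMap_append, List.take_append_drop]
    have hr : w.filterMap Sum.getRight? = (w.take k).filterMap Sum.getRight? ++
        (w.drop k).filterMap Sum.getRight? := by
      rw [← List.filterMap_append, List.take_append_drop]
    rw [hl, hr]
    simp
  · rintro ⟨⟨i, j⟩, ⟨w, w'⟩⟩ h
    simp only [Finset.mem_sigma, Finset.mem_range, mem_shuffles, Finset.mem_product] at h ⊢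
    obtain ⟨-, ⟨h1, h2⟩, h3, h4⟩ := h
    rw [List.filterMap_append, List.filterMap_append, h1, h2, h3, h4]
    simp
  · rintro ⟨w, k⟩ h
    simp only [Finset.mem_sigma, Finset.mem_range] at h
    simp
    omega
  · rintro ⟨⟨i, j⟩, ⟨w, w'⟩⟩ h
    simp only [Finset.mem_sigma, Finset.mem_range, mem_shuffles, Finset.mem_product] at h
    obtain ⟨⟨hi, hj⟩, ⟨h1, h2⟩, -⟩ := h
    simp only [List.take_left, List.drop_left, h1, h2, List.length_take]
    rw [Nat.min_eq_left (by omega), Nat.min_eq_left (by omega)]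
  · rintro ⟨w, k⟩ h
    rfl

theorem tensorCoeff_tmul (f : NCPoly K A) (g : NCPoly K B) (u : List A) (v : List B) :
    tensorCoeff (f ⊗ₜ[K] g) u v = f.1.coeff u * g.1.coeff v := rfl

theorem tensorCoeff_mul (x y : NCPoly K A ⊗[K] NCPoly K B) (u : List A) (v : List B) :
    tensorCoeff (x * y) u v =
      ∑ i ∈ Finset.range (u.length + 1), ∑ j ∈ Finset.range (v.length + 1),
        tensorCoeff x (u.take i) (v.take j) * tensorCoeff y (u.drop i) (v.drop j) := by
  induction x with
  | zero => simp
  | add x x' hx hx' => simp only [add_mul, map_add, Pi.add_apply, hx, hx', Finset.sum_add_distrib]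
  | tmul f g =>
    induction y with
    | zero => simp
    | add x x' hx hx' => simp only [mul_add, map_add, Pi.add_apply, hx, hx', Finset.sum_add_distrib]
    | tmul f' g' =>
      rw [Algebra.TensorProduct.tmul_mul_tmul, tensorCoeff_tmul]
      refine (congrArg₂ (· * ·) (NCSeries.coeff_mul f.1 f'.1 u)
        (NCSeries.coeff_mul g.1 g'.1 v)).trans ?_
      rw [Finset.sum_mul_sum]
      refine Finset.sum_congr rfl fun i _ => Finset.sum_congr rfl fun j _ => ?_
      rw [tensorCoeff_tmul, tensorCoeff_tmul, mul_mul_mul_comm]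

theorem theta_mul_eq {f g : NCPoly K (A ⊕ B)} {x y : NCPoly K A ⊗[K] NCPoly K B}
    (hf : theta f = tensorCoeff x) (hg : theta g = tensorCoeff y) :
    theta (f * g) = tensorCoeff (x * y) := by
  funext u v
  rw [theta_mul, tensorCoeff_mul, hf, hg]

theorem coeff_one_nil : (1 : NCSeries K A).coeff [] = 1 := by
  classical
  exact (NCSeries.coeff_one _).trans (if_pos rfl)

theorem coeff_one_cons (a : A) (w : List A) : (1 : NCSeries K A).coeff (a :: w) = 0 := by
  classical
  exact (NCSeries.coeff_one _).trans (if_neg (by simp))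

theorem shuffles_nil_nil : shuffles ([] : List A) ([] : List B) = {[]} := by
  ext w
  rw [mem_shuffles, Finset.mem_singleton]
  rcases w with _ | ⟨a | b, w⟩ <;> simp

/-- The sum over the shuffles of `u` and `v` is split according to the first letter. -/
theorem theta_nil_nil (f : NCPoly K (A ⊕ B)) : theta f [] [] = f.1.coeff [] := by
  rw [theta_eq_sum, shuffles_nil_nil, Finset.sum_singleton]

theorem theta_cons_nil (f : NCPoly K (A ⊕ B)) (a : A) (u : List A) :
    theta f (a :: u) [] = ∑ w ∈ shuffles u [], f.1.coeff (Sum.inl a :: w) := by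
  rw [theta_eq_sum]
  symm
  refine Finset.sum_bij (fun w _ => Sum.inl a :: w) ?_ (by simp) ?_ (by simp)
  · intro w hw
    rw [mem_shuffles] at hw ⊢
    exact ⟨by simp [hw.1], by simp [hw.2, List.filterMap_cons]⟩
  · rintro (_ | ⟨a' | b', w⟩) hw <;> rw [mem_shuffles] at hw <;> simp at hw
    obtain ⟨⟨rfl, h1⟩, h2⟩ := hw
    exact ⟨w, mem_shuffles.2 ⟨h1, by simpa using h2⟩, rfl⟩

theorem theta_nil_cons (f : NCPoly K (A ⊕ B)) (b : B) (v : List B) :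
    theta f [] (b :: v) = ∑ w ∈ shuffles [] v, f.1.coeff (Sum.inr b :: w) := by
  rw [theta_eq_sum]
  symm
  refine Finset.sum_bij (fun w _ => Sum.inr b :: w) ?_ (by simp) ?_ (by simp)
  · intro w hw
    rw [mem_shuffles] at hw ⊢
    exact ⟨(List.filterMap_cons_none rfl).trans hw.1, by simp [hw.2]⟩
  · rintro (_ | ⟨a' | b', w⟩) hw <;> rw [mem_shuffles] at hw <;> simp at hw
    obtain ⟨h1, rfl, h2⟩ := hw
    exact ⟨w, mem_shuffles.2 ⟨by simpa using h1, h2⟩, rfl⟩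

theorem theta_cons_cons (f : NCPoly K (A ⊕ B)) (a : A) (u : List A) (b : B) (v : List B) :
    theta f (a :: u) (b :: v) = ∑ w ∈ shuffles u (b :: v), f.1.coeff (Sum.inl a :: w) +
      ∑ w ∈ shuffles (a :: u) v, f.1.coeff (Sum.inr b :: w) := by
  classical
  rw [theta_eq_sum]
  have h : shuffles (a :: u) (b :: v) = (shuffles u (b :: v)).image (Sum.inl a :: ·) ∪
      (shuffles (a :: u) v).image (Sum.inr b :: ·) := by
    ext w
    rw [Finset.mem_union, Finset.mem_image, Finset.mem_image, mem_shuffles]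
    simp only [mem_shuffles]
    rcases w with _ | ⟨a' | b', w⟩
    · simp
    · simp only [List.filterMap_cons, Sum.getLeft?_inl, Sum.getRight?_inl, List.cons.injEq,
        Sum.inl.injEq, reduceCtorEq, false_and, and_false, exists_false, or_false]
      aesop
    · simp only [List.filterMap_cons, Sum.getLeft?_inr, Sum.getRight?_inr, List.cons.injEq,
        Sum.inr.injEq, reduceCtorEq, false_and, and_false, exists_false, false_or]
      aesop
  rw [h, Finset.sum_union, Finset.sum_image (by simp), Finset.sum_image (by simp)]
  rw [Finset.disjoint_left]
  intro w h1 h2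
  obtain ⟨w1, -, rfl⟩ := Finset.mem_image.1 h1
  obtain ⟨w2, -, h3⟩ := Finset.mem_image.1 h2
  simp at h3

theorem theta_one : theta (1 : NCPoly K (A ⊕ B)) = tensorCoeff (1 : NCPoly K A ⊗[K] NCPoly K B) := by
  funext u v
  rw [Algebra.TensorProduct.one_def, tensorCoeff_tmul]
  rcases u with _ | ⟨a, u⟩ <;> rcases v with _ | ⟨b, v⟩ <;>
    simp [theta_nil_nil, theta_nil_cons, theta_cons_nil, theta_cons_cons,
      coeff_one_nil, coeff_one_cons]

theorem theta_prod_ofFn : ∀ {n : ℕ} (f : Fin n → NCPoly K (A ⊕ B))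
    (x : Fin n → NCPoly K A ⊗[K] NCPoly K B) (_ : ∀ i, theta (f i) = tensorCoeff (x i)),
    theta (List.ofFn f).prod = tensorCoeff (List.ofFn x).prod
  | 0, f, x, _ => by simpa using theta_one
  | n + 1, f, x, h => by
    rw [List.ofFn_succ, List.prod_cons, List.ofFn_succ, List.prod_cons]
    exact theta_mul_eq (h 0) (theta_prod_ofFn _ _ fun i => h i.succ)

end NCPoly

/-! ### Trees evaluated on a disjoint sum of alphabets -/

section SumTree

variable (K : Type v) [Field K] {S : ℕ → Type u}

open Classical in
theorem coeff_forestPoly_node_cons' (A : ForestAlphabet S) {n : ℕ} (g : S n) (ts : Fin n → STerm S)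
    (a : A.carrier) (w : List A.carrier) :
    (forestPoly K A [STerm.node g ts]).1.coeff (a :: w) =
      if A.root a ∧ A.deco g a then
        (List.ofFn fun i : Fin n =>
          rootPoly K A (A.edge (Nat.succPNat i) a) (ts i)).prod.1.coeff w
      else 0 := by
  rw [coeff_forestPoly_node_cons]
  congr 2
  rw [SubmonoidClass.coe_list_prod, List.map_ofFn]
  rfl

/-- The polynomial of a tree on a disjoint sum. -/
noncomputable def sumTree (A B : ForestAlphabet S) (t : STerm S) :
    NCPoly K (A.carrier ⊕ B.carrier) :=
  forestPoly K (A.sum B) [t]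

/-- The polynomial of a tree on a disjoint sum, where the letter of the root satisfies `Q` if it is
in the first summand. -/
noncomputable def upperTree (A B : ForestAlphabet S) (Q : A.carrier → Prop) (t : STerm S) :
    NCPoly K (A.carrier ⊕ B.carrier) :=
  sumTree K (A.withRoot Q) B t

/-- The polynomial of a tree on a disjoint sum, where the root letter is in the second summand. -/
noncomputable def lowerTree (A B : ForestAlphabet S) (Q : B.carrier → Prop) (t : STerm S) :
    NCPoly K (A.carrier ⊕ B.carrier) :=
  forestPoly K ((A.sum B).withRoot (Sum.elim (fun _ => False) Q)) [t]

theorem forestPoly_congr {C : Type u} {R R' : C → Prop} (D : ∀ {n : ℕ}, S n → C → Prop)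
    {E E' : ℕ+ → C → C → Prop} (hR : R = R') (hE : E = E') (f : SForest S) :
    (forestPoly K (ForestAlphabet.mk C R D E) f : NCPoly K C) =
      forestPoly K (ForestAlphabet.mk C R' D E') f := by
  subst hR hE; rfl

/-- From a letter `a` of the first alphabet, edges go to its successors in A and to all the root
letters of B: this is the root relation of a disjoint sum, with A re-rooted at the successors of
`a`. -/
theorem rootPoly_sum_inl (A B : ForestAlphabet S) (j : ℕ+) (a : A.carrier) (t : STerm S) :
    (rootPoly K (A.sum B) ((A.sum B).edge j (Sum.inl a)) t : NCPoly K (A.carrier ⊕ B.carrier)) =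
      upperTree K A B (A.edge j a) t := by
  refine forestPoly_congr K _ ?_ ?_ [t]
  · funext x; cases x <;> rfl
  · funext j x y; cases x <;> cases y <;> rfl

/-- No edge returns from the second alphabet to the first. -/
theorem rootPoly_sum_inr (A B : ForestAlphabet S) (j : ℕ+) (b : B.carrier) (t : STerm S) :
    (rootPoly K (A.sum B) ((A.sum B).edge j (Sum.inr b)) t : NCPoly K (A.carrier ⊕ B.carrier)) =
      lowerTree K A B (B.edge j b) t := by
  refine forestPoly_congr K _ ?_ rfl [t]
  funext x; cases x <;> rfl

open Classical in
theorem coeff_sumTree_inl (A B : ForestAlphabet S) {n : ℕ} (g : S n) (ts : Fin n → STerm S)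
    (a : A.carrier) (w : List (A.carrier ⊕ B.carrier)) :
    (sumTree K A B (STerm.node g ts)).1.coeff (Sum.inl a :: w) =
      if A.root a ∧ A.deco g a then
        (List.ofFn fun i : Fin n =>
          upperTree K A B (A.edge (Nat.succPNat i) a) (ts i)).prod.1.coeff w
      else 0 := by
  refine (coeff_forestPoly_node_cons' K (A.sum B) g ts (Sum.inl a) w).trans ?_
  refine if_congr Iff.rfl (congrArg (fun l : List (NCPoly K (A.carrier ⊕ B.carrier)) =>
    l.prod.1.coeff w) (congrArg List.ofFn (funext fun i => ?_))) rfl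
  exact rootPoly_sum_inl K A B _ a (ts i)

open Classical in
theorem coeff_sumTree_inr (A B : ForestAlphabet S) {n : ℕ} (g : S n) (ts : Fin n → STerm S)
    (b : B.carrier) (w : List (A.carrier ⊕ B.carrier)) :
    (sumTree K A B (STerm.node g ts)).1.coeff (Sum.inr b :: w) =
      if B.root b ∧ B.deco g b then
        (List.ofFn fun i : Fin n =>
          lowerTree K A B (B.edge (Nat.succPNat i) b) (ts i)).prod.1.coeff w
      else 0 := by
  refine (coeff_forestPoly_node_cons' K (A.sum B) g ts (Sum.inr b) w).trans ?_
  refine if_congr Iff.rfl (congrArg (fun l : List (NCPoly K (A.carrier ⊕ B.carrier)) =>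
    l.prod.1.coeff w) (congrArg List.ofFn (funext fun i => ?_))) rfl
  exact rootPoly_sum_inr K A B _ b (ts i)

theorem coeff_sumTree_nil (A B : ForestAlphabet S) {n : ℕ} (g : S n) (ts : Fin n → STerm S) :
    (sumTree K A B (STerm.node g ts)).1.coeff [] = 0 :=
  coeff_forestPoly_node_nil K (A.sum B) g ts

theorem coeff_lowerTree_inl (A B : ForestAlphabet S) (Q : B.carrier → Prop) {n : ℕ} (g : S n)
    (ts : Fin n → STerm S) (a : A.carrier) (w : List (A.carrier ⊕ B.carrier)) :
    (lowerTree K A B Q (STerm.node g ts)).1.coeff (Sum.inl a :: w) = 0 := by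
  classical
  refine (coeff_forestPoly_node_cons' K
    ((A.sum B).withRoot (Sum.elim (fun _ => False) Q)) g ts (Sum.inl a) w).trans (if_neg ?_)
  exact fun h => h.1

open Classical in
theorem coeff_lowerTree_inr (A B : ForestAlphabet S) (Q : B.carrier → Prop) {n : ℕ} (g : S n)
    (ts : Fin n → STerm S) (b : B.carrier) (w : List (A.carrier ⊕ B.carrier)) :
    (lowerTree K A B Q (STerm.node g ts)).1.coeff (Sum.inr b :: w) =
      if Q b ∧ B.deco g b then
        (List.ofFn fun i : Fin n =>
          lowerTree K A B (B.edge (Nat.succPNat i) b) (ts i)).prod.1.coeff w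
      else 0 := by
  refine (coeff_forestPoly_node_cons' K
    ((A.sum B).withRoot (Sum.elim (fun _ => False) Q)) g ts (Sum.inr b) w).trans ?_
  refine if_congr Iff.rfl (congrArg (fun l : List (NCPoly K (A.carrier ⊕ B.carrier)) =>
    l.prod.1.coeff w) (congrArg List.ofFn (funext fun i => ?_))) rfl
  exact rootPoly_sum_inr K A B _ b (ts i)

theorem coeff_lowerTree_nil (A B : ForestAlphabet S) (Q : B.carrier → Prop) {n : ℕ} (g : S n)
    (ts : Fin n → STerm S) : (lowerTree K A B Q (STerm.node g ts)).1.coeff [] = 0 :=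
  coeff_forestPoly_node_nil K _ g ts

theorem coeff_rootPoly_node_nil (A : ForestAlphabet S) (Q : A.carrier → Prop) {n : ℕ} (g : S n)
    (ts : Fin n → STerm S) : (rootPoly K A Q (STerm.node g ts)).1.coeff [] = 0 :=
  coeff_forestPoly_node_nil K _ g ts

open Classical in
theorem coeff_rootPoly_node_cons (A : ForestAlphabet S) (Q : A.carrier → Prop) {n : ℕ} (g : S n)
    (ts : Fin n → STerm S) (a : A.carrier) (w : List A.carrier) :
    (rootPoly K A Q (STerm.node g ts)).1.coeff (a :: w) =
      if Q a ∧ A.deco g a then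
        (List.ofFn fun i : Fin n =>
          rootPoly K A (A.edge (Nat.succPNat i) a) (ts i)).prod.1.coeff w
      else 0 :=
  coeff_forestPoly_node_cons' K (A.withRoot Q) g ts a w

open NCPoly in
-- If the root letter is in B then so are all its descendants. The relation `Q` is generalized
-- because for a child it becomes the edge relation from the parent letter.
theorem theta_lowerTree (A B : ForestAlphabet S) (Q : B.carrier → Prop) (t : STerm S) :
    theta (lowerTree K A B Q t) = tensorCoeff (1 ⊗ₜ[K] rootPoly K B Q t) := by
  classical
  induction t generalizing Q with
  | leaf =>
    have h1 : lowerTree K A B Q STerm.leaf = 1 := forestPoly_leaf K _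
    have h2 : rootPoly K B Q STerm.leaf = 1 := forestPoly_leaf K _
    rw [h1, h2, theta_one]
    rfl
  | @node n g ts ih =>
    have hprod : ∀ b : B.carrier, theta (List.ofFn fun i : Fin n =>
        lowerTree K A B (B.edge (Nat.succPNat i) b) (ts i)).prod =
        tensorCoeff ((1 : NCPoly K A.carrier) ⊗ₜ[K] (List.ofFn fun i : Fin n =>
          rootPoly K B (B.edge (Nat.succPNat i) b) (ts i)).prod) := by
      intro b
      rw [theta_prod_ofFn _ _ fun i => ih i (B.edge (Nat.succPNat i) b), NSOperad.tmul_ofFn_prod]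
      congr 2
      simp
    have hr : ∀ (b : B.carrier) (u : List A.carrier) (v : List B.carrier),
        ∑ w ∈ shuffles u v, (lowerTree K A B Q (STerm.node g ts)).1.coeff (Sum.inr b :: w) =
        tensorCoeff ((1 : NCPoly K A.carrier) ⊗ₜ[K] rootPoly K B Q (STerm.node g ts)) u (b :: v) := by
      intro b u v
      simp only [coeff_lowerTree_inr]
      rw [tensorCoeff_tmul, coeff_rootPoly_node_cons]
      split_ifs
      · rw [← theta_eq_sum, hprod, tensorCoeff_tmul]
      · simp
    funext u v
    rcases u with _ | ⟨a, u⟩ <;> rcases v with _ | ⟨b, v⟩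
    · rw [theta_nil_nil, coeff_lowerTree_nil, tensorCoeff_tmul, coeff_rootPoly_node_nil, mul_zero]
    · rw [theta_nil_cons, hr]
    · rw [theta_cons_nil, tensorCoeff_tmul, coeff_rootPoly_node_nil, mul_zero]
      exact Finset.sum_eq_zero fun w _ => coeff_lowerTree_inl K A B Q g ts a w
    · rw [theta_cons_cons, hr, Finset.sum_eq_zero fun w _ => coeff_lowerTree_inl K A B Q g ts a w,
        zero_add]

end SumTree

/-! ### Factorizations of trees and the doubling of the alphabet -/

section TreeDoubling

variable {S : ℕ → Type u}

/-- The concatenation of the tuples of right factors. -/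
def STerm.joinRight {n : ℕ} (d : Fin n → (y : STerm S) × (Fin y.ar → STerm S))
    (k : Fin (∑ i, (d i).1.ar)) : STerm S :=
  (d (finSigmaFinEquiv.symm k).1).2 (finSigmaFinEquiv.symm k).2

theorem STerm.joinRight_apply {n : ℕ} (d : Fin n → (y : STerm S) × (Fin y.ar → STerm S)) (i : Fin n)
    (j : Fin (d i).1.ar) : joinRight d (finSigmaFinEquiv ⟨i, j⟩) = (d i).2 j := by
  rw [joinRight, Equiv.symm_apply_apply]

theorem STerm.joinRight_split {n : ℕ} (ys : Fin n → STerm S) (z : Fin (∑ i, (ys i).ar) → STerm S) :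
    joinRight (fun i => ⟨ys i, fun j => z (finSigmaFinEquiv ⟨i, j⟩)⟩) = z := by
  funext k
  exact congrArg z (Equiv.apply_symm_apply finSigmaFinEquiv k)

/-- A factorization of a tree. -/
abbrev TreeFactorization (t : STerm S) : Type u := (freeOperad S).Factorization t

namespace TreeFactorization

/-- The left factor. -/
def top {t : STerm S} (p : TreeFactorization t) : STerm S := p.1.1

/-- The forest of the right factors. -/
def bottom {t : STerm S} (p : TreeFactorization t) : SForest S := List.ofFn p.1.2

/-- The factorization `t = 1[t]`. -/
def ofLeaf (t : STerm S) : TreeFactorization t := ⟨⟨STerm.leaf, fun _ => t⟩, rfl⟩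

/-- The factorization of a tree obtained from factorizations of the children of its root. -/
def ofNode {n : ℕ} (g : S n) {ts : Fin n → STerm S} (q : ∀ i, TreeFactorization (ts i)) :
    TreeFactorization (STerm.node g ts) :=
  ⟨⟨STerm.node g fun i => (q i).top, STerm.joinRight fun i => (q i).1⟩, by
    refine congrArg (STerm.node g) (funext fun i => ?_)
    refine Eq.trans ?_ (q i).2
    exact congrArg (STerm.graft _) (funext fun j => STerm.joinRight_apply (fun i => (q i).1) i j)⟩

theorem bottom_ofNode {n : ℕ} (g : S n) {ts : Fin n → STerm S} (q : ∀ i, TreeFactorization (ts i)) :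
    (ofNode g q).bottom = (List.ofFn fun i => (q i).bottom).flatten := by
  refine (List.ofFn_finSigma (fun i => (q i).top.ar) rfl (ofNode g q).1.2).trans ?_
  congr 2
  funext i
  exact congrArg List.ofFn (funext fun j => STerm.joinRight_apply (fun i => (q i).1) i j)

/-- The factors of a factorization of `node g ts`, without the proofs. -/
noncomputable def children {n : ℕ} {t : STerm S} (p : TreeFactorization t) :
    Option (Fin n → (y : STerm S) × (Fin y.ar → STerm S)) :=
  open Classical in
  match p.1 with
  | ⟨STerm.leaf, _⟩ => none
  | ⟨@STerm.node _ m _ ys, z⟩ =>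
    if h : m = n then
      some fun i => ⟨ys (Fin.cast h.symm i), fun j => z (finSigmaFinEquiv ⟨Fin.cast h.symm i, j⟩)⟩
    else none

/-- The factorizations of `node g ts`, from the factorizations of the `ts i`. -/
def ofOption {n : ℕ} (g : S n) (ts : Fin n → STerm S) :
    Option (∀ i, TreeFactorization (ts i)) → TreeFactorization (STerm.node g ts)
  | none => ofLeaf _
  | some q => ofNode g q

theorem children_ofNode {n : ℕ} (g : S n) {ts : Fin n → STerm S}
    (q : ∀ i, TreeFactorization (ts i)) : (ofNode g q).children = some fun i => (q i).1 := by
  refine (dif_pos rfl).trans (congrArg some (funext fun i => ?_))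
  exact Sigma.ext rfl (heq_of_eq (funext fun j => STerm.joinRight_apply (fun i => (q i).1) i j))

/-- The left factor is a leaf, which forces the factorization 1[t], or its root is the root of the
tree; in the latter case the factorization amounts to one factorization of each child. -/
theorem ofOption_bijective {n : ℕ} (g : S n) (ts : Fin n → STerm S) :
    Function.Bijective (ofOption g ts) := by
  constructor
  · rintro (_ | q) (_ | q') h
    · rfl
    · exact absurd (congrArg (fun p => p.1.1) h) (by intro h; cases h)
    · exact absurd (congrArg (fun p => p.1.1) h) (by intro h; cases h)
    -- Factorizations of different trees have different types; `children` drops the proofs so that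
    -- the factors can be compared.
    · have h1 := congrArg (children (n := n)) h
      change (ofNode g q).children = (ofNode g q').children at h1
      rw [children_ofNode, children_ofNode] at h1
      refine congrArg some (funext fun i => Subtype.ext ?_)
      exact congrFun (Option.some.inj h1) i
  · rintro ⟨⟨y, z⟩, h⟩
    cases y with
    | leaf =>
      refine ⟨none, Subtype.ext (Sigma.ext rfl (heq_of_eq (funext fun i => ?_)))⟩
      obtain rfl : i = ⟨0, Nat.one_pos⟩ := Subsingleton.elim (α := Fin 1) _ _
      exact h.symm
    | node g' ys =>
      cases h
      refine ⟨some fun i => ⟨⟨ys i, fun j => z (finSigmaFinEquiv ⟨i, j⟩)⟩, rfl⟩,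
        Subtype.ext (Sigma.ext rfl (heq_of_eq (STerm.joinRight_split ys z)))⟩

end TreeFactorization

variable (K : Type v) [Field K]

theorem forestPoly_flatten (A : ForestAlphabet S) (l : List (SForest S)) :
    forestPoly K A l.flatten = (l.map (forestPoly K A)).prod := by
  have happ : ∀ f f' : SForest S,
      forestPoly K A (f ++ f') = forestPoly K A f * forestPoly K A f' := by
    intro f f'
    induction f with
    | nil => rw [forestPoly_nil, one_mul]; rfl
    | cons t f ih =>
      rw [forestPoly_cons, mul_assoc, ← ih, ← forestPoly_cons]; rfl
  induction l with
  | nil => exact forestPoly_nil K A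
  | cons f l ih => rw [List.flatten_cons, happ, ih, List.map_cons, List.prod_cons]

open NCPoly in
/-- Evaluating a tree on a disjoint sum of alphabets amounts to summing over its factorizations. -/
theorem theta_sumTree [∀ t : STerm S, Fintype (TreeFactorization t)] (A B : ForestAlphabet S)
    (t : STerm S) : theta (sumTree K A B t) =
      tensorCoeff (∑ p : TreeFactorization t,
        forestPoly K A [p.top] ⊗ₜ[K] forestPoly K B p.bottom) := by
  classical
  induction t generalizing A with
  | leaf =>
    have h1 : sumTree K A B STerm.leaf = 1 := forestPoly_leaf K _
    rw [h1, theta_one]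
    congr 1
    have hu : ∀ p : TreeFactorization (STerm.leaf (S := S)), p = TreeFactorization.ofLeaf _ :=
      NSOperad.factorization_one_unique (freeOperad_isGrading S)
    let _ : Unique (TreeFactorization (STerm.leaf (S := S))) := ⟨⟨TreeFactorization.ofLeaf _⟩, hu⟩
    rw [Fintype.sum_unique]
    change _ = forestPoly K A [STerm.leaf] ⊗ₜ[K] forestPoly K B [STerm.leaf]
    rw [forestPoly_leaf, forestPoly_leaf]
    rfl
  | @node n g ts ih =>
    -- The induction hypothesis holds for every first alphabet, so it applies to A with its root
    -- relation replaced by the condition imposed by the parent letter.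
    have hih : ∀ (Q : A.carrier → Prop) (i : Fin n), theta (upperTree K A B Q (ts i)) =
        tensorCoeff (∑ p : TreeFactorization (ts i),
          rootPoly K A Q p.top ⊗ₜ[K] forestPoly K B p.bottom) := fun Q i => ih i (A.withRoot Q)
    have hup : ∀ a : A.carrier, theta (List.ofFn fun i : Fin n =>
        upperTree K A B (A.edge (Nat.succPNat i) a) (ts i)).prod =
        tensorCoeff (∑ q : ∀ i, TreeFactorization (ts i), (List.ofFn fun i : Fin n =>
          rootPoly K A (A.edge (Nat.succPNat i) a) (q i).top).prod ⊗ₜ[K]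
            forestPoly K B (TreeFactorization.ofNode g q).bottom) := by
      intro a
      rw [theta_prod_ofFn _ _ fun i => hih (A.edge (Nat.succPNat i) a) i,
        List.prod_ofFn_sum fun i => TreeFactorization (ts i)]
      congr 1
      refine Finset.sum_congr rfl fun q _ => ?_
      rw [NSOperad.tmul_ofFn_prod, TreeFactorization.bottom_ofNode, forestPoly_flatten,
        List.map_ofFn]
      rfl
    have hlow : ∀ b : B.carrier, theta (List.ofFn fun i : Fin n =>
        lowerTree K A B (B.edge (Nat.succPNat i) b) (ts i)).prod =
        tensorCoeff ((1 : NCPoly K A.carrier) ⊗ₜ[K] (List.ofFn fun i : Fin n =>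
          rootPoly K B (B.edge (Nat.succPNat i) b) (ts i)).prod) := by
      intro b
      rw [theta_prod_ofFn _ _ fun i => theta_lowerTree K A B (B.edge (Nat.succPNat i) b) (ts i),
        NSOperad.tmul_ofFn_prod]
      congr 2
      simp
    have hsum : ∑ p : TreeFactorization (STerm.node g ts),
        forestPoly K A [p.top] ⊗ₜ[K] forestPoly K B p.bottom =
        1 ⊗ₜ[K] forestPoly K B [STerm.node g ts] +
        ∑ q : ∀ i, TreeFactorization (ts i),
          forestPoly K A [(STerm.node g fun i => (q i).top)] ⊗ₜ[K]
            forestPoly K B (TreeFactorization.ofNode g q).bottom := by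
      rw [← (Equiv.ofBijective _ (TreeFactorization.ofOption_bijective g ts)).sum_comp,
        Fintype.sum_option, ← forestPoly_leaf K A]
      rfl
    -- Words starting in A account for the factorizations whose left factor contains the root.
    have hl : ∀ (a : A.carrier) (u : List A.carrier) (v : List B.carrier),
        ∑ w ∈ shuffles u v, (sumTree K A B (STerm.node g ts)).1.coeff (Sum.inl a :: w) =
        tensorCoeff (∑ q : ∀ i, TreeFactorization (ts i),
          forestPoly K A [(STerm.node g fun i => (q i).top)] ⊗ₜ[K]
            forestPoly K B (TreeFactorization.ofNode g q).bottom) (a :: u) v := by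
      intro a u v
      simp only [coeff_sumTree_inl, map_sum, Finset.sum_apply, tensorCoeff_tmul,
        coeff_forestPoly_node_cons']
      split_ifs
      · rw [← theta_eq_sum, hup]
        simp only [map_sum, Finset.sum_apply, tensorCoeff_tmul]
      · simp
    have hl0 : ∀ v : List B.carrier, tensorCoeff (∑ q : ∀ i, TreeFactorization (ts i),
          forestPoly K A [(STerm.node g fun i => (q i).top)] ⊗ₜ[K]
            forestPoly K B (TreeFactorization.ofNode g q).bottom) [] v = 0 := by
      intro v
      simp only [map_sum, Finset.sum_apply, tensorCoeff_tmul, coeff_forestPoly_node_nil, zero_mul,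
        Finset.sum_const_zero]
    -- Words starting in B account for the single factorization 1[t], the whole tree being evaluated
    -- on B.
    have hr : ∀ (b : B.carrier) (u : List A.carrier) (v : List B.carrier),
        ∑ w ∈ shuffles u v, (sumTree K A B (STerm.node g ts)).1.coeff (Sum.inr b :: w) =
        tensorCoeff ((1 : NCPoly K A.carrier) ⊗ₜ[K] forestPoly K B [STerm.node g ts]) u
          (b :: v) := by
      intro b u v
      simp only [coeff_sumTree_inr]
      rw [tensorCoeff_tmul, coeff_forestPoly_node_cons']
      split_ifs
      · rw [← theta_eq_sum, hlow, tensorCoeff_tmul]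
      · simp
    have hr0 : ∀ u : List A.carrier, tensorCoeff ((1 : NCPoly K A.carrier) ⊗ₜ[K]
        forestPoly K B [STerm.node g ts]) u [] = 0 := by
      intro u
      rw [tensorCoeff_tmul, coeff_forestPoly_node_nil, mul_zero]
    have hr1 : ∀ (a : A.carrier) (u : List A.carrier) (v : List B.carrier),
        tensorCoeff ((1 : NCPoly K A.carrier) ⊗ₜ[K] forestPoly K B [STerm.node g ts])
          (a :: u) v = 0 := by
      intro a u v
      rw [tensorCoeff_tmul]
      exact (congrArg (· * _) (coeff_one_cons a u)).trans (zero_mul _)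
    rw [hsum, map_add]
    funext u v
    rw [Pi.add_apply, Pi.add_apply]
    rcases u with _ | ⟨a, u⟩ <;> rcases v with _ | ⟨b, v⟩
    · rw [theta_nil_nil, coeff_sumTree_nil, hl0, hr0, add_zero]
    · rw [theta_nil_cons, hr, hl0, add_zero]
    · rw [theta_cons_nil, hl, hr0, zero_add]
    · rw [theta_cons_cons, hl, hr, add_comm]

end TreeDoubling

theorem List.flatten_ofFn_singleton {α : Type*} {n : ℕ} (f : Fin n → α) :
    (List.ofFn fun i => [f i]).flatten = List.ofFn f := by
  have h := List.flatMap_singleton' (List.ofFn f)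
  rwa [List.flatMap_def, List.map_ofFn] at h

/-! ### Representatives of classes and of words of classes -/

section Representatives

variable {S : ℕ → Type u}

/-- The trees in an equivalence class. -/
abbrev MAs.Rep (x : (MAs S).carrier) : Type u := {t : STerm S // (masCongr S).cls t = x}

/-- The forests whose trees belong to the given equivalence classes. -/
abbrev MAs.ForestRep (l : List (MAs S).carrier) : Type u :=
  {f : SForest S // f.map (masCongr S).cls = l}

/-- The class of a tree, as an element of the operad. -/
abbrev MAs.mk (t : STerm S) : (MAs S).carrier := (masCongr S).cls t

theorem MAs.mk_eq_one {t : STerm S} : MAs.mk t = (MAs S).one ↔ t = STerm.leaf :=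
  (masCongr S).cls_eq.trans masCongr_rel_leaf

instance MAs.finite_rep [Finite (Σ n, S n)] (x : (MAs S).carrier) : Finite (MAs.Rep x) := by
  obtain ⟨t, rfl⟩ := (masCongr S).exists_rep x
  refine Set.Finite.subset (masCongr_finiteType t) fun s hs => ?_
  exact (masCongr S).iseqv.symm ((masCongr S).cls_eq.1 hs)

/-- Splitting off the first tree of a forest. -/
def MAs.forestRepCons (x : (MAs S).carrier) (l : List (MAs S).carrier) :
    MAs.Rep x × MAs.ForestRep l ≃ MAs.ForestRep (x :: l) where
  toFun p := ⟨p.1.1 :: p.2.1, congrArg₂ List.cons p.1.2 p.2.2⟩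
  invFun f :=
    match f with
    | ⟨[], h⟩ => (List.cons_ne_nil x l h.symm).elim
    | ⟨t :: f, h⟩ => ⟨⟨t, (List.cons.inj h).1⟩, ⟨f, (List.cons.inj h).2⟩⟩
  left_inv _ := rfl
  right_inv f := by
    obtain ⟨_ | ⟨t, f⟩, h⟩ := f
    · exact (List.cons_ne_nil x l h.symm).elim
    · rfl

instance MAs.unique_forestRep_nil : Unique (MAs.ForestRep ([] : List (MAs S).carrier)) where
  default := ⟨[], rfl⟩
  uniq f := Subtype.ext (List.map_eq_nil_iff.1 f.2)

instance MAs.finite_forestRep [Finite (Σ n, S n)] (l : List (MAs S).carrier) :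
    Finite (MAs.ForestRep l) := by
  induction l with
  | nil => infer_instance
  | cons x l ih => exact Finite.of_equiv _ (MAs.forestRepCons x l)

noncomputable instance [Finite (Σ n, S n)] (x : (MAs S).carrier) : Fintype (MAs.Rep x) :=
  Fintype.ofFinite _

noncomputable instance [Finite (Σ n, S n)] (l : List (MAs S).carrier) :
    Fintype (MAs.ForestRep l) := Fintype.ofFinite _

/-- The class of the leaf is the unit, which is not a letter of a reduced word. -/
theorem MAs.ne_leaf_of_map_eq {w : (MAs S).RedWord} {f : SForest S}
    (hf : f.map (masCongr S).cls = w.toList.map Subtype.val) : ∀ t ∈ f, t ≠ STerm.leaf := by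
  rintro _ ht rfl
  have h1 : (masCongr S).cls STerm.leaf ∈ f.map (masCongr S).cls := List.mem_map_of_mem ht
  rw [hf] at h1
  obtain ⟨y, -, hy⟩ := List.mem_map.1 h1
  exact y.2 hy

/-- Representatives of a reduced word contain no leaf, so the reduced words summed in the embedding
may be replaced by arbitrary forests of representatives. -/
theorem MAs.redForest_bijective (w : (MAs S).RedWord) :
    Set.BijOn redForest
      {f : (freeOperad S).RedWord |
        f.toList.map (fun y => (masCongr S).cls y.1) = w.toList.map Subtype.val}
      {f : SForest S | f.map (masCongr S).cls = w.toList.map Subtype.val} := by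
  refine ⟨fun f hf => ?_, fun f _ f' _ h => ?_, fun f hf => ?_⟩
  · refine (List.map_map ..).trans hf
  · exact List.map_injective_iff.2 Subtype.val_injective h
  · have h := MAs.ne_leaf_of_map_eq hf
    lift f to List {t : STerm S // t ≠ STerm.leaf} using h
    refine ⟨FreeMonoid.ofList f, ?_, rfl⟩
    exact (List.map_map ..).symm.trans hf

end Representatives

/-! ### The realization of `MAs S`: multiplicativity and doubling -/

section MasRealization

variable (K : Type v) [Field K] {S : ℕ → Type u}

theorem quotEmbed_E {O : NSOperad.{u}} (C : O.Congruence) (w : C.quotient.RedWord) :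
    NSOperad.quotEmbed K C (NSOperad.E K w) = ∑ᶠ f ∈ {f : O.RedWord |
      f.toList.map (fun y => C.cls y.1) = w.toList.map Subtype.val}, NSOperad.E K f := by
  rw [NSOperad.E, ← MonoidAlgebra.basis_apply]
  exact Module.Basis.constr_basis _ _ _ _

theorem realization_E (A : ForestAlphabet S) (f : (freeOperad S).RedWord) :
    realization K A (NSOperad.E K f) = forestPoly K A (redForest f) := by
  rw [NSOperad.E, ← MonoidAlgebra.basis_apply]
  exact Module.Basis.constr_basis _ _ _ _

variable [Finite (Σ n, S n)]

theorem masRealization_E (A : ForestAlphabet S) (w : (MAs S).RedWord) :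
    masRealization K A (NSOperad.E K w) =
      ∑ f : MAs.ForestRep (w.toList.map Subtype.val), forestPoly K A f.1 := by
  have hb := MAs.redForest_bijective w
  have hfin : {f : SForest S | f.map (masCongr S).cls = w.toList.map Subtype.val}.Finite :=
    MAs.finite_forestRep _
  have hfin' : {f : (freeOperad S).RedWord |
      f.toList.map (fun y => (masCongr S).cls y.1) = w.toList.map Subtype.val}.Finite :=
    Set.Finite.of_finite_image (hb.image_eq ▸ hfin) hb.injOn
  have h : NSOperad.quotEmbed K (masCongr S) (NSOperad.E K w) =
      ∑ f ∈ hfin'.toFinset, NSOperad.E K f := by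
    rw [← finsum_mem_eq_finite_toFinset_sum]
    exact quotEmbed_E K (masCongr S) w
  refine (congrArg (realization K A) h).trans ?_
  rw [map_sum]
  simp only [realization_E]
  rw [← finsum_mem_eq_finite_toFinset_sum (fun f => forestPoly K A (redForest f)),
    finsum_mem_eq_of_bijOn (g := forestPoly K A) redForest hb fun _ _ => rfl]
  refine (finsum_set_coe_eq_finsum_mem _).symm.trans ?_
  exact finsum_eq_sum_of_fintype
    fun f : MAs.ForestRep (w.toList.map Subtype.val) => forestPoly K A f.1

/-- The sum of the polynomials of the trees in an equivalence class. -/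
noncomputable def clsPoly (A : ForestAlphabet S) (x : (MAs S).carrier) : NCPoly K A.carrier :=
  ∑ t : MAs.Rep x, forestPoly K A [t.1]

/-- The leaf is alone in its class, and its only compatible word is empty. -/
theorem clsPoly_one (A : ForestAlphabet S) : clsPoly K A (MAs S).one = 1 := by
  let _ : Unique (MAs.Rep (S := S) (MAs S).one) :=
    ⟨⟨⟨STerm.leaf, rfl⟩⟩, fun t => Subtype.ext (MAs.mk_eq_one.1 t.2)⟩
  rw [clsPoly, Fintype.sum_unique]
  exact forestPoly_leaf K A

theorem sum_forestRep (A : ForestAlphabet S) (l : List (MAs S).carrier) :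
    ∑ f : MAs.ForestRep l, forestPoly K A f.1 = (l.map (clsPoly K A)).prod := by
  induction l with
  | nil =>
    rw [Fintype.sum_unique]
    exact forestPoly_nil K A
  | cons x l ih =>
    rw [← (MAs.forestRepCons x l).sum_comp, List.map_cons, List.prod_cons, ← ih, clsPoly,
      Finset.sum_mul_sum, ← Fintype.sum_prod_type']
    exact Finset.sum_congr rfl fun p _ => forestPoly_cons K A p.1.1 p.2.1

/-- The realization map as a morphism of algebras. -/
noncomputable def masRealizationHom (A : ForestAlphabet S) :
    (MAs S).Natural K →ₐ[K] NCPoly K A.carrier :=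
  MonoidAlgebra.lift K (NCPoly K A.carrier) (MAs S).RedWord
    (FreeMonoid.lift fun x => clsPoly K A x.1)

theorem masRealizationHom_E_rd (A : ForestAlphabet S) (l : List (MAs S).carrier) :
    masRealizationHom K A (NSOperad.E K (NSOperad.rd l)) = (l.map (clsPoly K A)).prod := by
  rw [NSOperad.E_rd_eq_prod, map_list_prod, List.map_map]
  congr 1
  refine List.map_congr_left fun x _ => ?_
  rw [Function.comp_apply]
  by_cases h : x = (MAs S).one
  · rw [h, NSOperad.rd_one, NSOperad.E_one, map_one, clsPoly_one]
  · rw [show NSOperad.rd [x] = _ from NSOperad.rd_nonUnit ⟨x, h⟩, NSOperad.E, masRealizationHom,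
      MonoidAlgebra.lift_single, one_smul, FreeMonoid.lift_eval_of]

/-- Representatives of a word are chosen letter by letter, so its image is the product of the class
polynomials of its letters. The realization is therefore multiplicative, although it is defined only
as a linear map. -/
theorem masRealization_eq (A : ForestAlphabet S) :
    masRealization K A = (masRealizationHom K A).toLinearMap := by
  refine NSOperad.natural_linearMap_ext K fun w => ?_
  rw [masRealization_E, sum_forestRep, ← masRealizationHom_E_rd, NSOperad.rd_toList]
  rfl

/-- Pairs of a tree in a class and of a factorization of this tree correspond to factorizations of
the class together with representatives of the factors. -/
noncomputable def MAs.repFactorization (x : (MAs S).carrier) :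
    (Σ t : MAs.Rep x, TreeFactorization t.1) ≃
      (Σ P : (MAs S).Factorization x, MAs.Rep P.1.1 × (∀ i, MAs.Rep (P.1.2 i))) where
  toFun s := ⟨⟨⟨MAs.mk s.2.1.1, fun i => MAs.mk (s.2.1.2 i)⟩,
    ((masCongr S).quoComp_cls s.2.1.1 s.2.1.2 _ fun i i' h => by rw [Fin.ext h]).trans
      ((congrArg MAs.mk s.2.2).trans s.1.2)⟩, ⟨s.2.1.1, rfl⟩, fun i => ⟨s.2.1.2 i, rfl⟩⟩
  invFun r := ⟨⟨(freeOperad S).comp r.2.1.1 fun i =>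
      (r.2.2 (Fin.cast (congrArg (MAs S).ar r.2.1.2) i)).1, by
        obtain ⟨⟨⟨Y, W⟩, h⟩, ⟨y, hy⟩, z⟩ := r
        dsimp only at hy z
        subst hy
        refine Eq.trans (Eq.symm ?_) h
        refine (masCongr S).quoComp_cls y _ _ fun i i' hi => ?_
        rw [Fin.ext hi]
        exact (z i').2.symm⟩,
    ⟨⟨r.2.1.1, fun i => (r.2.2 (Fin.cast (congrArg (MAs S).ar r.2.1.2) i)).1⟩, rfl⟩⟩
  left_inv s := by
    obtain ⟨⟨t, ht⟩, ⟨⟨y, z⟩, h⟩⟩ := s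
    dsimp only at h
    subst h
    rfl
  right_inv r := by
    obtain ⟨⟨⟨Y, W⟩, h⟩, ⟨y, hy⟩, z⟩ := r
    dsimp only at hy z
    subst hy
    obtain ⟨z', hz, rfl⟩ : ∃ (z' : Fin ((MAs S).ar (MAs.mk y)) → STerm S)
      (hz : ∀ i, MAs.mk (z' i) = W i), z = fun i => ⟨z' i, hz i⟩ := ⟨_, fun i => (z i).2, rfl⟩
    obtain rfl : (fun i => MAs.mk (z' i)) = W := funext hz
    rfl

open NCPoly in
-- Summing the tree identity over the representatives of `x` gives pairs of a tree and a
-- factorization of it; `MAs.repFactorization` regroups them by the factorizations of `x`, which are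
-- the terms of its coproduct.
theorem theta_clsPoly (A B : ForestAlphabet S) (x : (MAs S).carrier) :
    theta (A := A.carrier) (B := B.carrier) (clsPoly K (A.sum B) x) =
      tensorCoeff (TensorProduct.map (masRealizationHom K A).toLinearMap
        (masRealizationHom K B).toLinearMap ((MAs S).comulGen K x)) := by
  have (t : STerm S) : Finite (TreeFactorization t) := freeOperad_finitelyFactorizable t
  have (t : STerm S) : Fintype (TreeFactorization t) := Fintype.ofFinite _
  have (x : (MAs S).carrier) : Finite ((MAs S).Factorization x) := MAs_finitelyFactorizable x
  have (x : (MAs S).carrier) : Fintype ((MAs S).Factorization x) := Fintype.ofFinite _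
  have h1 : theta (A := A.carrier) (B := B.carrier) (clsPoly K (A.sum B) x) =
      ∑ t : MAs.Rep x, theta (sumTree K A B t.1) :=
    map_sum (thetaLin (K := K) (A := A.carrier) (B := B.carrier))
      (fun t : MAs.Rep x => sumTree K A B t.1) Finset.univ
  rw [h1]
  simp only [theta_sumTree]
  rw [← map_sum]
  congr 1
  rw [NSOperad.comulGen_eq_sum, map_sum, ← Fintype.sum_sigma']
  have h2 : ∀ P : (MAs S).Factorization x,
      TensorProduct.map (masRealizationHom K A).toLinearMap (masRealizationHom K B).toLinearMap
        (NSOperad.E K (NSOperad.rd [P.1.1]) ⊗ₜ[K] NSOperad.E K (NSOperad.rd (List.ofFn P.1.2))) =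
      ∑ q : MAs.Rep P.1.1 × (∀ i, MAs.Rep (P.1.2 i)),
        forestPoly K A [q.1.1] ⊗ₜ[K] forestPoly K B (List.ofFn fun i => (q.2 i).1) := by
    intro P
    rw [TensorProduct.map_tmul, AlgHom.toLinearMap_apply, AlgHom.toLinearMap_apply,
      masRealizationHom_E_rd, masRealizationHom_E_rd, List.map_singleton, List.prod_singleton,
      List.map_ofFn, Fintype.sum_prod_type]
    simp only [Function.comp_def, clsPoly]
    rw [List.prod_ofFn_sum fun i => MAs.Rep (P.1.2 i), TensorProduct.sum_tmul]
    refine Finset.sum_congr rfl fun y _ => ?_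
    rw [TensorProduct.tmul_sum]
    refine Finset.sum_congr rfl fun z _ => ?_
    congr 1
    have h3 := forestPoly_flatten K B (List.ofFn fun i => [(z i).1])
    rw [List.map_ofFn] at h3
    refine Eq.trans h3.symm (congrArg _ ?_)
    exact List.flatten_ofFn_singleton fun i => (z i).1
  simp only [h2]
  rw [← Fintype.sum_sigma', ← (MAs.repFactorization x).sum_comp]
  rfl

open NCPoly in
-- Multiplicativity reduces the identity to single letters.
theorem masRealizationHom_doubling (A B : ForestAlphabet S) (x : (MAs S).Natural K) :
    theta (A := A.carrier) (B := B.carrier) (masRealizationHom K (A.sum B) x) =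
      tensorCoeff (TensorProduct.map (masRealizationHom K A).toLinearMap
        (masRealizationHom K B).toLinearMap ((MAs S).comul K x)) := by
  let D : (MAs S).Natural K →ₐ[K] NCPoly K A.carrier ⊗[K] NCPoly K B.carrier :=
    (Algebra.TensorProduct.map (masRealizationHom K A) (masRealizationHom K B)).comp
      ((MAs S).comul K)
  let R : (MAs S).Natural K →ₐ[K] NCPoly K (A.carrier ⊕ B.carrier) := masRealizationHom K (A.sum B)
  have key : ∀ w : (MAs S).RedWord,
      theta (R (NSOperad.E K w)) = tensorCoeff (D (NSOperad.E K w)) := by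
    intro w
    induction w using FreeMonoid.inductionOn' with
    | one => rw [NSOperad.E_one, map_one, map_one]; exact theta_one
    | of_mul x w ih =>
      rw [NSOperad.E_mul, map_mul, map_mul]
      refine theta_mul_eq ?_ ih
      have h1 : R (NSOperad.E K (FreeMonoid.of x)) = clsPoly K (A.sum B) x.1 := by
        rw [← NSOperad.rd_nonUnit]
        exact (masRealizationHom_E_rd K (A.sum B) [x.1]).trans (by simp)
      rw [h1, ← NSOperad.rd_nonUnit]
      refine (theta_clsPoly K A B x.1).trans ?_
      rw [← NSOperad.comul_E_nonUnit]
      rfl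
  have : (thetaLin ∘ₗ R.toLinearMap : (MAs S).Natural K →ₗ[K] _) =
      tensorCoeff ∘ₗ D.toLinearMap := NSOperad.natural_linearMap_ext K key
  exact LinearMap.congr_fun this x

end MasRealization

/-! ### Composites of two generators and left combs -/

namespace STerm

variable {S : ℕ → Type u}

theorem ar_corolla {n : ℕ} (g : S n) : (corolla g).ar = n := by
  simp [corolla, ar]

theorem graft_eq {t t' : STerm S} (h : t = t') (T : ℕ → STerm S) :
    graft t (fun j => T j) = graft t' fun j => T j := by
  subst h; rfl

theorem graft_corolla {n : ℕ} (g : S n) (T : ℕ → STerm S) :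
    graft (corolla g) (fun k => T k) = node g fun i => T i := by
  refine congrArg (node g) (funext fun i => ?_)
  refine congrArg T ((finSigmaFinEquiv_apply _).trans ?_)
  simp [ar]

/-- The tuple of children of the root in a composite of two generators. -/
def insertNode {m : ℕ} (h : S m) (k : ℕ) (T : ℕ → STerm S) (i : ℕ) : STerm S :=
  if i < k then T i else if i = k then node h fun j => T (k + j) else T (i + m - 1)

/-- Makes the defining relations usable inside arbitrary trees. The grafted trees are indexed by
natural numbers so that no transport between arities is needed. -/
theorem graft_pcomp_corolla {n m : ℕ} (g : S n) (h : S m) (k : Fin ((freeOperad S).ar (corolla g)))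
    (T : ℕ → STerm S) :
    graft ((freeOperad S).pcomp (corolla g) k (corolla h)) (fun p => T p) =
      node g fun i => insertNode h k T i := by
  set c : ℕ → STerm S := fun i => if i = k then corolla h else leaf with hc
  have h0 : (fun q : Fin ((freeOperad S).ar (corolla g)) =>
      if q = k then corolla h else leaf) = fun q => c q.val :=
    funext fun q => if_congr Fin.ext_iff rfl rfl
  have h1 : (freeOperad S).pcomp (corolla g) k (corolla h) = node g fun i => c i :=
    (congrArg (graft (corolla g)) h0).trans (graft_corolla g c)
  rw [graft_eq h1]
  refine congrArg (node g) (funext fun i => ?_)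
  -- Leaves carried by the first i children: one each, except for m at position k. The correction is
  -- added on the left to avoid subtraction.
  have hsum : ∀ i : ℕ, ∑ x ∈ Finset.range i, (c x).ar + (if k < i then 1 else 0) =
      i + if k < i then m else 0 := by
    intro i
    induction i with
    | zero => simp
    | succ i ih =>
      rw [Finset.sum_range_succ]
      have hci : (c i).ar = if i = k then m else 1 := by
        simp only [hc]
        split_ifs
        · exact ar_corolla h
        · rfl
      rw [hci]
      split_ifs at ih ⊢ <;> omega
  have hval : ∀ j : Fin (c i).ar,
      (finSigmaFinEquiv (n := fun i : Fin n => (c i).ar) ⟨i, j⟩ : ℕ) =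
        ∑ x ∈ Finset.range i, (c x).ar + j := by
    intro j
    rw [finSigmaFinEquiv_apply, Finset.sum_range]
    rfl
  have h2 : (fun j : Fin (c i).ar => T (finSigmaFinEquiv (n := fun i : Fin n => (c i).ar) ⟨i, j⟩)) =
      fun j : Fin (c i).ar => (fun j : ℕ => T (∑ x ∈ Finset.range i, (c x).ar + j)) j :=
    funext fun j => congrArg T (hval j)
  refine (congrArg (graft (c i)) h2).trans ?_
  have hi := hsum i
  rw [insertNode]
  set T' : ℕ → STerm S := fun j => T (∑ x ∈ Finset.range i, (c x).ar + j) with hT'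
  rcases lt_trichotomy (i : ℕ) k with hlt | heq | hgt
  · rw [if_pos hlt, graft_eq (show c i = leaf from if_neg hlt.ne) T']
    change T (_ + 0) = _
    rw [if_neg hlt.le.not_gt, if_neg hlt.le.not_gt] at hi
    congr 1
  · rw [if_neg heq.not_lt, if_pos heq, graft_eq (show c i = corolla h from if_pos heq) T',
      graft_corolla h T']
    rw [if_neg heq.not_gt, if_neg heq.not_gt] at hi
    refine congrArg (node h) (funext fun j => congrArg T ?_)
    omega
  · rw [if_neg hgt.not_gt, if_neg hgt.ne', graft_eq (show c i = leaf from if_neg hgt.ne') T']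
    change T (_ + 0) = _
    rw [if_pos hgt, if_pos hgt] at hi
    congr 1
    omega

/-- The tree whose root is decorated by `g`, with the given list of children, completed by
leaves. -/
def nodeList {n : ℕ} (g : S n) (l : List (STerm S)) : STerm S :=
  node g fun i => l.getD i leaf

/-- The left comb with the given list of decorations. -/
def comb : List (Σ n, S n) → STerm S
  | [] => leaf
  | g :: l => nodeList g.2 [comb l]

theorem nodeList_congr {n : ℕ} (g : S n) {l l' : List (STerm S)}
    (h : ∀ i, l.getD i leaf = l'.getD i leaf) : nodeList g l = nodeList g l' :=
  congrArg (node g) (funext fun i => h i)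

/-- Missing children default to leaves, so trailing leaves are invisible; lists of children can be
padded to the arity at will. -/
theorem nodeList_append_leaf {n : ℕ} (g : S n) (l : List (STerm S)) :
    nodeList g (l ++ [leaf]) = nodeList g l := by
  refine nodeList_congr g fun i => ?_
  rw [List.getD_eq_getElem?_getD, List.getD_eq_getElem?_getD, List.getElem?_append]
  split_ifs with h
  · rfl
  · rw [List.getElem?_eq_none (by omega : l.length ≤ i)]
    rcases Nat.eq_zero_or_pos (i - l.length) with h0 | h0
    · rw [h0]; rfl
    · rw [List.getElem?_eq_none (by simp; omega)]

theorem nodeList_append_leaves {n : ℕ} (g : S n) (l : List (STerm S)) (c : ℕ) :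
    nodeList g (l ++ List.replicate c leaf) = nodeList g l := by
  induction c with
  | zero => simp
  | succ c ih => rw [List.replicate_succ', ← List.append_assoc, nodeList_append_leaf, ih]

end STerm

/-! ### Every tree is equivalent to a left comb -/

namespace MAs

open STerm

variable {S : ℕ → Type u}

/-- Two trees represent the same operation of `MAs S`. -/
abbrev Equivalent (t t' : STerm S) : Prop := (masCongr S).rel t t'

local infix:50 " ≈ₘ " => Equivalent

theorem rel_refl (t : STerm S) : t ≈ₘ t := (masCongr S).iseqv.refl t

theorem rel_symm {t t' : STerm S} (h : t ≈ₘ t') : t' ≈ₘ t := (masCongr S).iseqv.symm h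

theorem rel_trans {t t' t'' : STerm S} (h : t ≈ₘ t') (h' : t' ≈ₘ t'') : t ≈ₘ t'' :=
  (masCongr S).iseqv.trans h h'

theorem rel_node {n : ℕ} (g : S n) (T T' : ℕ → STerm S) (h : ∀ i, T i ≈ₘ T' i) :
    node g (fun i => T i) ≈ₘ node g fun i => T' i := by
  rw [← graft_corolla, ← graft_corolla]
  exact (masCongr S).comp_rel (y := corolla g) (y' := corolla g) (fun k => T k) (fun k => T' k)
    (rel_refl _) fun i i' hi => by rw [hi]; exact h i'

/-- By the chain g ∘ₖ h ≡ h ∘ₖ g ≡ g ∘ₖ' h, the position where h is grafted on g does not matter.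
Grafting the same trees `T` on both ends transports this to arbitrary trees. -/
theorem rel_insertNode {n : ℕ} (g h : S n) {k k' : ℕ} (hk : k < n) (hk' : k' < n)
    (T : ℕ → STerm S) :
    node g (fun i => insertNode h k T i) ≈ₘ node g fun i => insertNode h k' T i := by
  have hc : ∀ {g : S n} {k : ℕ}, k < n → k < (freeOperad S).ar (corolla g) := fun {g} _ hk =>
    lt_of_lt_of_eq hk (ar_corolla g).symm
  have key : (masCongr S).rel ((freeOperad S).pcomp (corolla g) ⟨k, hc hk⟩ (corolla h))
      ((freeOperad S).pcomp (corolla g) ⟨k', hc hk'⟩ (corolla h)) :=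
    .trans (.of ⟨n, n, g, h, ⟨k, hc hk⟩, ⟨k, hc hk⟩, rfl, rfl⟩)
      (.symm (.of ⟨n, n, g, h, ⟨k', hc hk'⟩, ⟨k, hc hk⟩, rfl, rfl⟩))
  have h1 := (masCongr S).comp_rel (fun p => T p) (fun p => T p) key
    fun i i' hi => by rw [hi]; exact rel_refl _
  have e1 := graft_pcomp_corolla g h ⟨k, hc hk⟩ T
  have e2 := graft_pcomp_corolla g h ⟨k', hc hk'⟩ T
  rw [← e1, ← e2]
  exact h1

theorem rel_nodeList {n : ℕ} (g : S n) {a b : STerm S} (hab : a ≈ₘ b) (p q : List (STerm S)) :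
    nodeList g (p ++ a :: q) ≈ₘ nodeList g (p ++ b :: q) := by
  refine rel_node g (fun i => (p ++ a :: q).getD i leaf) (fun i => (p ++ b :: q).getD i leaf)
    fun i => ?_
  simp only [List.getD_eq_getElem?_getD, List.getElem?_append]
  split_ifs with h
  · exact rel_refl _
  · rcases Nat.eq_zero_or_pos (i - p.length) with h0 | h0
    · rw [h0]; exact hab
    · obtain ⟨j, hj⟩ : ∃ j, i - p.length = j + 1 := ⟨i - p.length - 1, by omega⟩
      rw [hj]; exact rel_refl _

/-- Both sides graft the same sequence p, y, xs, x, q on a composite of g and h, with h in position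
`p.length + 1` or `p.length`. -/
theorem rel_rotate {n : ℕ} (g h : S n) (p q xs : List (STerm S)) (x y : STerm S)
    (hp : p.length + 2 ≤ n) (hxs : xs.length + 1 = n) :
    nodeList g (p ++ y :: nodeList h (xs ++ [x]) :: q) ≈ₘ
      nodeList g (p ++ nodeList h (y :: xs) :: x :: q) := by
  set T : ℕ → STerm S := fun i => (p ++ y :: (xs ++ x :: q)).getD i leaf with hT
  have hget : ∀ (a : STerm S) (l : List (STerm S)) (i : ℕ),
      (a :: l).getD (i + 1) leaf = l.getD i leaf := fun _ _ _ => rfl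
  have happ : ∀ (l l' : List (STerm S)) (i : ℕ), (l ++ l').getD (l.length + i) leaf =
      l'.getD i leaf := fun l l' i => by
    rw [List.getD_append_right _ _ _ _ (by omega), Nat.add_sub_cancel_left]
  have e1 : nodeList g (p ++ y :: nodeList h (xs ++ [x]) :: q) =
      node g fun i => insertNode h (p.length + 1) T i := by
    refine congrArg (node g) (funext fun i => ?_)
    obtain ⟨i, -⟩ := i
    dsimp only
    rw [insertNode]
    rcases lt_trichotomy i (p.length + 1) with hi | rfl | hi
    · rw [if_pos hi, hT]
      rcases Nat.lt_succ_iff_lt_or_eq.1 hi with hi | rfl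
      · simp only [List.getD_append _ _ _ _ hi]
      · exact (happ p _ 0).trans (happ p (y :: (xs ++ x :: q)) 0).symm
    · rw [if_neg (lt_irrefl _), if_pos rfl, happ, hget]
      refine congrArg (node h) (funext fun j => ?_)
      obtain ⟨j, hj⟩ := j
      simp only [hT]
      rw [add_assoc, happ, add_comm 1, hget]
      rcases Nat.lt_or_eq_of_le (show j ≤ xs.length by omega) with hj | rfl
      · rw [List.getD_append _ _ _ _ hj, List.getD_append _ _ _ _ hj]
      · exact (happ xs _ 0).trans (happ xs (x :: q) 0).symm
    · obtain ⟨j, rfl⟩ : ∃ j, i = p.length + (j + 1 + 1) := ⟨i - (p.length + 2), by omega⟩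
      rw [if_neg (by omega), if_neg (by omega), happ, hget, hget, hT]
      have : p.length + (j + 1 + 1) + n - 1 = p.length + ((xs.length + (j + 1)) + 1) := by omega
      simp only [this]
      rw [happ, hget, happ, hget]
  have e2 : nodeList g (p ++ nodeList h (y :: xs) :: x :: q) =
      node g fun i => insertNode h p.length T i := by
    refine congrArg (node g) (funext fun i => ?_)
    obtain ⟨i, -⟩ := i
    dsimp only
    rw [insertNode]
    rcases lt_trichotomy i p.length with hi | rfl | hi
    · rw [if_pos hi, hT]
      simp only [List.getD_append _ _ _ _ hi]
    · rw [if_neg (lt_irrefl _), if_pos rfl]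
      refine (happ p _ 0).trans (congrArg (node h) (funext fun j => ?_))
      obtain ⟨j, hj⟩ := j
      simp only [hT]
      rw [happ, ← List.cons_append, List.getD_append _ _ _ _ (by simp; omega)]
    · obtain ⟨j, rfl⟩ : ∃ j, i = p.length + (j + 1) := ⟨i - (p.length + 1), by omega⟩
      rw [if_neg (by omega), if_neg (by omega), happ, hget, hT]
      have : p.length + (j + 1) + n - 1 = p.length + ((xs.length + j) + 1) := by omega
      simp only [this]
      rw [happ, hget, happ]
  rw [e1, e2]
  exact rel_insertNode g h (by omega) (by omega) T

/-- A rotation moves the root of the comb one step to the left, with the leaf as its new first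
child; by induction the rest of the comb slides over that leaf. -/
theorem rel_slide {n : ℕ} (hn : ∀ m, S m → m = n) (b : List (Σ n, S n)) (g : S n)
    (p q : List (STerm S)) (hp : p.length + 2 ≤ n) :
    nodeList g (p ++ leaf :: comb b :: q) ≈ₘ nodeList g (p ++ comb b :: leaf :: q) := by
  induction b generalizing g p q with
  | nil => exact rel_refl _
  | cons h b ih =>
    obtain ⟨m, h⟩ := h
    obtain rfl := hn m h
    obtain ⟨c, rfl⟩ : ∃ c, m = c + 2 := ⟨m - 2, by omega⟩
    have e : comb (⟨_, h⟩ :: b) = nodeList h ((comb b :: List.replicate c leaf) ++ [leaf]) := by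
      rw [nodeList_append_leaf]
      exact (nodeList_append_leaves h [comb b] c).symm
    have e' : nodeList h (leaf :: comb b :: List.replicate c leaf) = nodeList h [leaf, comb b] :=
      nodeList_append_leaves h [leaf, comb b] c
    rw [e]
    refine rel_trans (rel_rotate g h p q _ _ _ hp (by simp)) (rel_nodeList g ?_ p _)
    rw [e', ← e]
    refine rel_trans (ih h [] [] (by simp)) ?_
    rw [List.nil_append, ← List.singleton_append, nodeList_append_leaf]
    exact rel_refl _

theorem rel_slide_leaves {n : ℕ} (hn : ∀ m, S m → m = n) (b : List (Σ n, S n)) (g : S n) (c : ℕ)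
    (hc : c + 1 ≤ n) :
    nodeList g (List.replicate c leaf ++ [comb b]) ≈ₘ nodeList g [comb b] := by
  induction c with
  | zero => exact rel_refl _
  | succ c ih =>
    rw [List.replicate_succ', List.append_assoc]
    refine rel_trans (rel_slide hn b g (List.replicate c leaf) [] (by simp; omega)) ?_
    rw [show List.replicate c leaf ++ comb b :: [leaf] =
      List.replicate c leaf ++ [comb b] ++ [leaf] by simp, nodeList_append_leaf]
    exact ih (by omega)

/-- The root h of the first comb is rotated to the right, where it takes `comb b` as its last child;
`comb b` slides to the first place under h, and h is rotated back. Now `comb a` and `comb b` are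
adjacent under h, and induction applies. -/
theorem rel_merge {n : ℕ} (hn : ∀ m, S m → m = n) (a b : List (Σ n, S n)) (g : S n)
    (p q : List (STerm S)) (hp : p.length + 2 ≤ n) :
    nodeList g (p ++ comb a :: comb b :: q) ≈ₘ nodeList g (p ++ comb (a ++ b) :: leaf :: q) := by
  induction a generalizing g p q with
  | nil => exact rel_slide hn b g p q hp
  | cons h a ih =>
    obtain ⟨m, h⟩ := h
    obtain rfl := hn m h
    obtain ⟨c, rfl⟩ : ∃ c, m = c + 2 := ⟨m - 2, by omega⟩
    have e : comb (⟨_, h⟩ :: a) = nodeList h (comb a :: List.replicate (c + 1) leaf) :=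
      (nodeList_append_leaves h [comb a] (c + 1)).symm
    have e1 : nodeList h [comb b] = nodeList h ((comb b :: List.replicate c leaf) ++ [leaf]) := by
      rw [nodeList_append_leaf]
      exact (nodeList_append_leaves h [comb b] c).symm
    have e2 : nodeList h (comb a :: comb b :: List.replicate c leaf) =
      nodeList h [comb a, comb b] := nodeList_append_leaves h [comb a, comb b] c
    rw [e]
    refine rel_trans (rel_symm (rel_rotate g h p q _ _ _ hp (by simp))) ?_
    have h1 := rel_nodeList g (rel_slide_leaves hn b h (c + 1) (by omega)) (p ++ [comb a]) q
    rw [List.append_assoc, List.append_assoc] at h1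
    refine rel_trans h1 ?_
    rw [e1]
    refine rel_trans (rel_rotate g h p q _ _ _ hp (by simp)) (rel_nodeList g ?_ p _)
    rw [e2]
    refine rel_trans (ih h [] [] (by simp)) ?_
    rw [List.nil_append, ← List.singleton_append, nodeList_append_leaf]
    exact rel_refl _

theorem rel_slide_combs {n : ℕ} (hn : ∀ m, S m → m = n) (ls : List (List (Σ n, S n))) (g : S n)
    (p : List (STerm S)) (hp : p.length + ls.length + 1 ≤ n) :
    nodeList g (p ++ leaf :: ls.map comb) ≈ₘ nodeList g (p ++ ls.map comb) := by
  induction ls generalizing p with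
  | nil =>
    rw [List.map_nil, List.append_nil, nodeList_append_leaf]
    exact rel_refl _
  | cons b ls ih =>
    rw [List.length_cons] at hp
    refine rel_trans (rel_slide hn b g p _ (by omega)) ?_
    have h := ih (p ++ [comb b]) (by simp; omega)
    rwa [List.append_assoc, List.append_assoc] at h

/-- Each merging leaves a leaf behind, which `rel_slide_combs` moves to the end, where it
disappears; the next comb is then adjacent. -/
theorem rel_merge_combs {n : ℕ} (hn : ∀ m, S m → m = n) (ls : List (List (Σ n, S n)))
    (a : List (Σ n, S n)) (g : S n) (hls : ls.length + 1 ≤ n) :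
    nodeList g (comb a :: ls.map comb) ≈ₘ nodeList g [comb (a ++ ls.flatten)] := by
  induction ls generalizing a with
  | nil => simpa using rel_refl _
  | cons b ls ih =>
    rw [List.length_cons] at hls
    refine rel_trans (rel_merge hn a b g [] _ (by simp; omega)) ?_
    refine rel_trans (rel_slide_combs hn ls g [comb (a ++ b)] (by simp; omega)) ?_
    have h := ih (a ++ b) (by omega)
    rwa [List.append_assoc] at h

/-- Once the children are combs, merging them in order into the first one concatenates their
decorations in preorder. The arity n + 1 guarantees that a first child exists. -/
theorem rel_comb {n : ℕ} (hn : ∀ m, S m → m = n + 1) (t : STerm S) : t ≈ₘ comb t.nodes := by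
  induction t with
  | leaf => exact rel_refl _
  | @node m g ts ih =>
    obtain rfl := hn m g
    have h1 : node g ts ≈ₘ nodeList g ((List.ofFn fun i => (ts i).nodes).map comb) := by
      have e : node g ts = node g fun i => (List.ofFn ts).getD i leaf := by
        refine congrArg (node g) (funext fun i => ?_)
        rw [List.getD_eq_getElem?_getD, List.getElem?_ofFn, dif_pos i.2]
        rfl
      rw [e]
      refine rel_node g (fun i => (List.ofFn ts).getD i leaf)
        (fun i => ((List.ofFn fun i => (ts i).nodes).map comb).getD i leaf) fun i => ?_
      by_cases hi : i < n + 1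
      · simp only [List.getD_eq_getElem?_getD, List.getElem?_map, List.getElem?_ofFn, dif_pos hi]
        exact ih ⟨i, hi⟩
      · simp only [List.getD_eq_getElem?_getD, List.getElem?_map, List.getElem?_ofFn, dif_neg hi]
        exact rel_refl _
    refine rel_trans h1 ?_
    rw [nodes, List.ofFn_succ, List.map_cons]
    exact rel_merge_combs hn _ _ g (by simp)

/-- Trees with the same decorations in preorder are equivalent. -/
theorem rel_of_nodes_eq {r s : ℕ} (hS : HasProfile S r s) {t t' : STerm S}
    (h : t.nodes = t'.nodes) : t ≈ₘ t' := by
  have hn : ∀ m, S m → m = r + 1 := fun _ => hS.arity_eq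
  refine rel_trans (rel_comb hn t) ?_
  rw [h]
  exact rel_symm (rel_comb hn t')

end MAs

theorem List.map_eq_map_of_imp {α β γ : Type*} {g : α → β} {h : α → γ}
    (H : ∀ a b, g a = g b → h a = h b) : ∀ {l l' : List α}, l.map g = l'.map g → l.map h = l'.map h
  | [], [], _ => rfl
  | a :: l, b :: l', e => by
    rw [List.map_cons, List.map_cons, List.cons.injEq] at e
    rw [List.map_cons, List.map_cons, H a b e.1, List.map_eq_map_of_imp H e.2]

/-! ### Test words and injectivity of the realization -/

section Injectivity

variable {S : ℕ → Type u}

/-- Every internal node but the root has a parent. -/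
theorem STerm.exists_edge {t : STerm S} {k : ℕ} (hk : 0 < k) (hkt : k < t.deg) :
    ∃ j a, t.Edge j a k := by
  induction t generalizing k with
  | leaf => exact absurd hkt (Nat.not_lt_zero _)
  | node g ts ih =>
    obtain ⟨m, rfl⟩ : ∃ m, k = m + 1 := ⟨k - 1, by omega⟩
    rw [← length_nodes] at hkt
    obtain ⟨x, h⟩ : ∃ x, (node g ts).nodes[m + 1]? = some x := ⟨_, List.getElem?_eq_getElem hkt⟩
    rw [nodes, List.getElem?_cons_succ, List.getElem?_flatten_ofFn] at h
    obtain ⟨i, k', h1, h2⟩ := h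
    simp only [length_nodes] at h1
    have hk' : k' < (ts i).deg := by
      rw [← length_nodes]
      exact (List.getElem?_eq_some_iff.1 h2).1
    have hoff : m + 1 = offset ts i + k' := by rw [offset]; omega
    rcases Nat.eq_zero_or_pos k' with rfl | h0
    · refine ⟨Nat.succPNat i, 0, i, Or.inl ⟨?_, rfl, rfl, hoff⟩⟩
      exact fun h => hk'.ne' (deg_eq_zero.2 h)
    · obtain ⟨j, a, h⟩ := ih i h0 hk'
      exact ⟨j, offset ts i + a, i, Or.inr ⟨a, k', h, rfl, hoff⟩⟩

/-- Following parents leads from any node to the root, through earlier positions, and the index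
strictly increases along every edge. -/
theorem SForest.Compatible.root_lt {w : List ((Σ n, S n) × ℕ)} {t : STerm S}
    (h : Compatible (ForestAlphabet.lengthAlphabet S) w [t]) {k : ℕ} (hk : 0 < k)
    {a b : (Σ n, S n) × ℕ} (ha : w[0]? = some a) (hb : w[k]? = some b) : a.2 < b.2 := by
  induction k using Nat.strong_induction_on generalizing b with
  | _ k ih =>
    have hkt : k < t.deg := by
      rw [← SForest.deg_singleton, ← h.length_eq]
      exact (List.getElem?_eq_some_iff.1 hb).1
    obtain ⟨j, m, he⟩ := STerm.exists_edge hk hkt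
    have hlt := he.lt.1
    have hm : m < w.length := lt_trans hlt (List.getElem?_eq_some_iff.1 hb).1
    have h1 : (w[m]).2 < b.2 :=
      h.edge m k j w[m] b (edge_singleton.2 he) (List.getElem?_eq_getElem hm) hb
    rcases Nat.eq_zero_or_pos m with rfl | h0
    · rw [List.getElem?_eq_getElem hm, Option.some.injEq] at ha
      rwa [← ha]
    · exact (ih m hlt h0 (List.getElem?_eq_getElem hm)).trans h1

namespace SForest

/-- A word compatible with `f`, such that the indices increase along each tree of `f` and decrease
from one tree to the next. -/
def testWord : SForest S → List ((Σ n, S n) × ℕ)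
  | [] => []
  | t :: f => t.nodes.zipIdx (deg f) ++ testWord f

theorem length_testWord (f : SForest S) : (testWord f).length = f.deg := by
  induction f with
  | nil => rfl
  | cons t f ih =>
    rw [testWord, List.length_append, List.length_zipIdx, STerm.length_nodes, ih, deg_cons]

theorem lt_of_mem_testWord (f : SForest S) : ∀ a ∈ testWord f, a.2 < f.deg := by
  induction f with
  | nil => simp [testWord]
  | cons t f ih =>
    intro a ha
    rw [deg_cons]
    rcases List.mem_append.1 ha with h | h
    · have := List.snd_lt_add_of_mem_zipIdx h
      rw [STerm.length_nodes] at this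
      omega
    · have := ih a h
      omega

theorem compatible_zipIdx (t : STerm S) (c : ℕ) :
    Compatible (ForestAlphabet.lengthAlphabet S) (t.nodes.zipIdx c) [t] := by
  refine ⟨?_, fun _ _ _ _ => trivial, fun i a g hi ha => ?_, fun i i' j a a' he ha ha' => ?_⟩
  · exact List.length_zipIdx.trans (t.length_nodes.trans (deg_singleton t).symm)
  · rw [nodes_singleton] at hi
    have ha' : (t.nodes.zipIdx c)[i]? = some a := ha
    rw [List.getElem?_zipIdx, hi] at ha'
    obtain rfl := Option.some.inj ha'
    rfl
  · have h1 : (t.nodes.zipIdx c)[i]? = some a := ha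
    have h2 : (t.nodes.zipIdx c)[i']? = some a' := ha'
    rw [List.getElem?_zipIdx] at h1 h2
    obtain ⟨b, -, rfl⟩ := Option.map_eq_some_iff.1 h1
    obtain ⟨b', -, rfl⟩ := Option.map_eq_some_iff.1 h2
    have := (edge_singleton.1 he).lt
    change c + i < c + i'
    omega

theorem compatible_testWord (f : SForest S) :
    Compatible (ForestAlphabet.lengthAlphabet S) (testWord f) f := by
  induction f with
  | nil => exact (compatible_nil _ _).2 rfl
  | cons t f ih =>
    have hl : (t.nodes.zipIdx (deg f)).length = t.deg := by
      rw [List.length_zipIdx, STerm.length_nodes]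
    refine (compatible_cons (ForestAlphabet.lengthAlphabet S) (testWord (t :: f)) t f).2 ⟨?_, ?_⟩
    · have : (testWord (t :: f)).take t.deg = t.nodes.zipIdx (deg f) := List.take_left' hl
      exact this ▸ compatible_zipIdx t _
    · have : (testWord (t :: f)).drop t.deg = testWord f := List.drop_left' hl
      exact this ▸ ih

/-- A tree compatible with the beginning of a word cannot reach the letters of lower index. -/
theorem deg_le_of_compatible {s : List ((Σ n, S n) × ℕ)} {f f' : SForest S} {t : STerm S}
    (hs : s ≠ []) (hsf : ∀ a ∈ s, f.deg ≤ a.2)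
    (h : Compatible (ForestAlphabet.lengthAlphabet S) (s ++ testWord f) (t :: f')) :
    t.deg ≤ s.length := by
  -- Otherwise the first letter after `s` lies in the tree whose root letter is `s[0]`. Its index
  -- would exceed that of `s[0]`, which is at least `f.deg`, whereas the indices in `testWord f` are
  -- below `f.deg`.
  by_contra! hlt
  have h1 := ((compatible_cons (ForestAlphabet.lengthAlphabet S) (s ++ testWord f) t f').1 h).1
  have hlen := h.length_eq
  rw [deg_cons] at hlen
  have hlen' : s.length + (testWord f).length = t.deg + f'.deg := by
    rw [← List.length_append]; exact hlen
  have hpos := List.length_pos_iff.2 hs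
  have hu : 0 < (testWord f).length := by omega
  have ha : ((s ++ testWord f).take t.deg)[0]? = some s[0] := by
    rw [List.getElem?_take, if_pos (by omega), List.getElem?_append_left hpos,
      List.getElem?_eq_getElem hpos]
  have hb : ((s ++ testWord f).take t.deg)[s.length]? = some (testWord f)[0] := by
    rw [List.getElem?_take, if_pos hlt, List.getElem?_append_right le_rfl, Nat.sub_self,
      List.getElem?_eq_getElem hu]
  have h2 := h1.root_lt hpos ha hb
  have h3 := hsf _ (List.getElem_mem hpos)
  have h4 := lt_of_mem_testWord f _ (List.getElem_mem hu)
  omega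

/-- Here `s` is the unread part of the current tree of the test word. No tree of `f'` extends past a
nonempty `s`, so completing `s` takes at least one tree, and each tree of `f` at least one more. -/
theorem length_le_of_compatible {f' : SForest S} : ∀ {s : List ((Σ n, S n) × ℕ)} {f : SForest S}
    (_ : ∀ a ∈ s, f.deg ≤ a.2) (_ : ∀ t ∈ f, t ≠ STerm.leaf)
    (_ : Compatible (ForestAlphabet.lengthAlphabet S) (s ++ testWord f) f'),
    f.length ≤ f'.length ∧ (s ≠ [] → f.length + 1 ≤ f'.length) := by
  induction f' with
  | nil =>
    intro s f _ hf h
    have h1 : s ++ testWord f = [] := (compatible_nil _ _).1 h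
    obtain ⟨rfl, h2⟩ := List.append_eq_nil_iff.1 h1
    rcases f with _ | ⟨t, f⟩
    · exact ⟨le_rfl, fun h => absurd rfl h⟩
    · have h3 := length_testWord (t :: f)
      rw [h2, deg_cons, List.length_nil] at h3
      exact absurd (STerm.deg_eq_zero.1 (by omega)) (hf t List.mem_cons_self)
  | cons t' f' ih =>
    have key : ∀ {s : List ((Σ n, S n) × ℕ)} {f : SForest S}
        (_ : ∀ a ∈ s, f.deg ≤ a.2) (_ : ∀ t ∈ f, t ≠ STerm.leaf)
        (_ : Compatible (ForestAlphabet.lengthAlphabet S) (s ++ testWord f) (t' :: f')),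
        s ≠ [] → f.length + 1 ≤ (t' :: f').length := by
      intro s f hs hf h hne
      have hle := deg_le_of_compatible hne hs h
      have h1 := ((compatible_cons (ForestAlphabet.lengthAlphabet S) (s ++ testWord f) t' f').1 h).2
      have h2 : (s ++ testWord f).drop t'.deg = s.drop t'.deg ++ testWord f :=
        List.drop_append_of_le_length hle
      have h3 := (ih (s := s.drop t'.deg) (fun a ha => hs a (List.mem_of_mem_drop ha)) hf
        (h2 ▸ h1)).1
      rw [List.length_cons]
      omega
    intro s f hs hf h
    refine ⟨?_, key hs hf h⟩
    by_cases hne : s = []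
    · subst hne
      rcases f with _ | ⟨t, f⟩
      · simp
      · refine key (s := t.nodes.zipIdx (deg f)) (f := f)
          (fun a ha => List.le_snd_of_mem_zipIdx ha) (fun t ht => hf t (List.mem_cons_of_mem _ ht))
          h ?_
        intro h0
        have h1 : t.nodes.length = 0 := by rw [← List.length_zipIdx, h0]; rfl
        rw [STerm.length_nodes] at h1
        exact hf t List.mem_cons_self (STerm.deg_eq_zero.1 h1)
    · have := key hs hf h hne
      omega

/-- The test word of `f` determines the decorations of `f` among the forests that do not have more
trees than `f`. -/
theorem nodes_eq_of_compatible_testWord {f : SForest S} : ∀ {f' : SForest S}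
    (_ : ∀ t ∈ f, t ≠ STerm.leaf) (_ : f'.length ≤ f.length)
    (_ : Compatible (ForestAlphabet.lengthAlphabet S) (testWord f) f'),
    f'.map STerm.nodes = f.map STerm.nodes := by
  induction f with
  | nil =>
    intro f' _ hl _
    rw [List.length_eq_zero_iff.1 (Nat.le_zero.1 hl)]
  | cons t f ih =>
    intro f' hf hl h
    have hl0 : (t.nodes.zipIdx (deg f)).length = t.deg := by
      rw [List.length_zipIdx, STerm.length_nodes]
    have hne : t.nodes.zipIdx (deg f) ≠ [] := by
      intro h0
      rw [h0] at hl0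
      exact hf t List.mem_cons_self (STerm.deg_eq_zero.1 hl0.symm)
    rcases f' with _ | ⟨t', f'⟩
    · have h1 : t.nodes.zipIdx (deg f) ++ testWord f = [] := (compatible_nil _ _).1 h
      exact absurd (List.append_eq_nil_iff.1 h1).1 hne
    · have hs : ∀ a ∈ t.nodes.zipIdx (deg f), SForest.deg f ≤ a.2 := fun a ha =>
        List.le_snd_of_mem_zipIdx ha
      have hft : ∀ t ∈ f, t ≠ STerm.leaf := fun t ht => hf t (List.mem_cons_of_mem _ ht)
      have hle := deg_le_of_compatible hne hs h
      obtain ⟨h1, h2⟩ := (compatible_cons (ForestAlphabet.lengthAlphabet S)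
        (t.nodes.zipIdx (deg f) ++ testWord f) t' f').1 h
      have h3 : (t.nodes.zipIdx (deg f) ++ testWord f).drop t'.deg =
        (t.nodes.zipIdx (deg f)).drop t'.deg ++ testWord f := List.drop_append_of_le_length hle
      rw [List.length_cons, List.length_cons] at hl
      have hdeg : t'.deg = t.deg := by
        -- A shorter first tree leaves a nonempty remainder of `t`, which costs `f'` one tree too
        -- many.
        by_contra hdeg
        have h4 := (length_le_of_compatible (s := (t.nodes.zipIdx (deg f)).drop t'.deg)
          (fun a ha => hs a (List.mem_of_mem_drop ha)) hft (h3 ▸ h2)).2 (by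
            rw [Ne, List.drop_eq_nil_iff]; omega)
        omega
      have h5 : (t.nodes.zipIdx (deg f) ++ testWord f).drop t'.deg = testWord f :=
        List.drop_left' (hl0.trans hdeg.symm)
      have h6 : (t.nodes.zipIdx (deg f) ++ testWord f).take t'.deg = t.nodes.zipIdx (deg f) :=
        List.take_left' (hl0.trans hdeg.symm)
      have h7 : Compatible (ForestAlphabet.lengthAlphabet S) (t.nodes.zipIdx (deg f)) [t'] := h6 ▸ h1
      rw [List.map_cons, List.map_cons, ih hft (by omega) (h5 ▸ h2)]
      congr 1
      refine List.ext_getElem (by rw [STerm.length_nodes, STerm.length_nodes, hdeg])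
        fun i hi hi' => ?_
      exact (h7.deco i (t.nodes[i], deg f + i) t'.nodes[i]
        (by rw [nodes_singleton, List.getElem?_eq_getElem hi]) (by
          refine List.getElem?_zipIdx.trans ?_
          rw [List.getElem?_eq_getElem hi']; rfl)).symm

end SForest

variable (K : Type v) [Field K]

theorem coeff_sum_NCPoly {A : Type u} {ι : Type*} (s : Finset ι) (f : ι → NCPoly K A)
    (w : List A) : (∑ i ∈ s, f i).1.coeff w = ∑ i ∈ s, (f i).1.coeff w := by
  classical
  induction s using Finset.induction_on with
  | empty => rfl
  | insert i s hi ih => rw [Finset.sum_insert hi, Finset.sum_insert hi, ← ih]; rfl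

theorem masRealization_injective [CharZero K] {r s : ℕ} (hS : HasProfile S r s) :
    Function.Injective (masRealization K (ForestAlphabet.lengthAlphabet S)) := by
  classical
  have := hS.finite_sigma
  rw [injective_iff_map_eq_zero]
  intro x hx
  by_contra hx0
  set b := MonoidAlgebra.basis (MAs S).RedWord K with hb
  have hc : (b.repr x).support.Nonempty := by
    rw [Finsupp.support_nonempty_iff]
    exact fun h => hx0 (b.repr.map_eq_zero_iff.1 h)
  -- Compatible forests may have more trees than `f` but not fewer; a word of maximal length
  -- therefore meets no interference from the other words of the support.
  obtain ⟨w, hw, hmax⟩ := Finset.exists_max_image _ (fun w => w.toList.length) hc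
  set f : SForest S := w.toList.map fun y => (masCongr S).out y.1 with hf
  have hfw : f.map (masCongr S).cls = w.toList.map Subtype.val := by
    refine (List.map_map ..).trans (List.map_congr_left fun y _ => ?_)
    exact (masCongr S).cls_out y.1
  have hcoeff : ∀ w' : (MAs S).RedWord,
      (masRealization K (ForestAlphabet.lengthAlphabet S) (b w')).1.coeff f.testWord =
      ((Finset.univ.filter fun f' : MAs.ForestRep (w'.toList.map Subtype.val) =>
        SForest.Compatible (ForestAlphabet.lengthAlphabet S) f.testWord f'.1).card : K) := by
    intro w'
    have h1 : b w' = NSOperad.E K w' := MonoidAlgebra.basis_apply ..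
    rw [h1, masRealization_E]
    refine (coeff_sum_NCPoly K _ _ _).trans ?_
    rw [Finset.card_filter, Nat.cast_sum]
    refine Finset.sum_congr rfl fun f' _ => ?_
    refine (coeff_forestPoly K (ForestAlphabet.lengthAlphabet S) f'.1 f.testWord).trans ?_
    split_ifs <;> simp
  have hother : ∀ w' ∈ (b.repr x).support, w' ≠ w → b.repr x w' *
      (masRealization K (ForestAlphabet.lengthAlphabet S) (b w')).1.coeff f.testWord = 0 := by
    intro w' hw' hne
    rw [hcoeff, Finset.card_eq_zero.2, Nat.cast_zero, mul_zero]
    refine Finset.filter_eq_empty_iff.2 fun f' _ hcomp => hne ?_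
    have hl : f'.1.length ≤ f.length := by
      have h1 : f'.1.length = w'.toList.length := List.length_map (masCongr S).cls ▸
        (congrArg List.length f'.2).trans (List.length_map _)
      exact h1.trans_le ((hmax w' hw').trans_eq (List.length_map _).symm)
    have h2 := SForest.nodes_eq_of_compatible_testWord (MAs.ne_leaf_of_map_eq hfw) hl hcomp
    have h3 : f'.1.map (masCongr S).cls = f.map (masCongr S).cls :=
      List.map_eq_map_of_imp (fun t t' h => (masCongr S).cls_eq.2 (MAs.rel_of_nodes_eq hS h)) h2
    rw [f'.2, hfw] at h3
    exact List.map_injective_iff.2 Subtype.val_injective h3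
  have hx1 : (masRealization K (ForestAlphabet.lengthAlphabet S) x).1.coeff f.testWord = 0 := by
    rw [hx]; rfl
  have hsum : x = ∑ w' ∈ (b.repr x).support, b.repr x w' • b w' :=
    (b.linearCombination_repr x).symm.trans (Finsupp.linearCombination_apply ..)
  rw [hsum, map_sum] at hx1
  have hx2 := (coeff_sum_NCPoly K _ _ _).symm.trans hx1
  simp only [map_smul] at hx2
  have hx3 : ∑ w' ∈ (b.repr x).support, b.repr x w' *
      (masRealization K (ForestAlphabet.lengthAlphabet S) (b w')).1.coeff f.testWord = 0 := hx2
  -- What survives is the coefficient of `w` times the number of its representatives compatible with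
  -- the test word. This number is positive since `f` is one of them, and characteristic zero keeps
  -- it nonzero.
  rw [Finset.sum_eq_single_of_mem w hw hother, hcoeff, mul_eq_zero, Nat.cast_eq_zero,
    Finset.card_eq_zero, Finset.filter_eq_empty_iff] at hx3
  rcases hx3 with h | h
  · exact Finsupp.mem_support_iff.1 hw h
  · exact h (x := ⟨f, hfw⟩) (Finset.mem_univ _) f.compatible_testWord

end Injectivity

/-! ### Transport of a Hopf algebra structure -/

section Transport

variable {K : Type v} [Field K] {H : Type w} [Ring H] [Algebra K H] {H' : Type w'} [Ring H']
  [Algebra K H']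

/-- The coproduct transported along an isomorphism of algebras. -/
noncomputable def transportComul (Δ : H →ₐ[K] H ⊗[K] H) (φ : H ≃ₐ[K] H') : H' →ₐ[K] H' ⊗[K] H' :=
  (Algebra.TensorProduct.map φ.toAlgHom φ.toAlgHom).comp (Δ.comp φ.symm.toAlgHom)

/-- The counit transported along an isomorphism of algebras. -/
def transportCounit (ε : H →ₐ[K] K) (φ : H ≃ₐ[K] H') : H' →ₐ[K] K :=
  ε.comp φ.symm.toAlgHom

theorem isHopfIso_transport (Δ : H →ₐ[K] H ⊗[K] H) (ε : H →ₐ[K] K) (φ : H ≃ₐ[K] H') :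
    IsHopfIso Δ ε (transportComul Δ φ) (transportCounit ε φ) φ where
  map_comul x := by simp [transportComul]
  map_counit x := by simp [transportCounit]

/-- Every axiom is the image under φ of the original one, compared on pure tensors; the antipode is
conjugated by φ. -/
theorem IsHopfAlgebra.transport {Δ : H →ₐ[K] H ⊗[K] H} {ε : H →ₐ[K] K} (h : IsHopfAlgebra Δ ε)
    (φ : H ≃ₐ[K] H') : IsHopfAlgebra (transportComul Δ φ) (transportCounit ε φ) := by
  have hc : ∀ x, transportComul Δ φ (φ x) =
      Algebra.TensorProduct.map φ.toAlgHom φ.toAlgHom (Δ x) := (isHopfIso_transport Δ ε φ).map_comul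
  have he : ∀ x, transportCounit ε φ (φ x) = ε x := (isHopfIso_transport Δ ε φ).map_counit
  refine ⟨?_, ?_, ?_, ?_⟩
  · refine AlgHom.ext fun y => ?_
    obtain ⟨x, rfl⟩ := φ.surjective y
    have h1 := congrArg (Algebra.TensorProduct.map φ.toAlgHom
      (Algebra.TensorProduct.map φ.toAlgHom φ.toAlgHom)) (DFunLike.congr_fun h.coassoc x)
    simp only [AlgHom.comp_apply, hc] at h1 ⊢
    refine Eq.trans ?_ (h1.trans ?_)
    · generalize Δ x = z
      induction z with
      | zero => simp
      | add a b ha hb => simp only [map_add, ha, hb]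
      | tmul a b =>
        simp only [Algebra.TensorProduct.map_tmul, AlgHom.coe_id, id, AlgEquiv.toAlgHom_apply, hc]
        generalize Δ a = z
        induction z with
        | zero => simp
        | add a b ha hb => simp only [map_add, TensorProduct.add_tmul, ha, hb]
        | tmul a c => simp
    · generalize Δ x = z
      induction z with
      | zero => simp
      | add a b ha hb => simp only [map_add, ha, hb]
      | tmul a b => simp [hc]
  · refine AlgHom.ext fun y => ?_
    obtain ⟨x, rfl⟩ := φ.surjective y
    have h1 := congrArg (Algebra.TensorProduct.map (.id K K) φ.toAlgHom)
      (DFunLike.congr_fun h.rTensor_counit x)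
    simp only [AlgHom.comp_apply, hc] at h1 ⊢
    refine Eq.trans ?_ (h1.trans ?_)
    · generalize Δ x = z
      induction z with
      | zero => simp
      | add a b ha hb => simp only [map_add, ha, hb]
      | tmul a b => simp [he]
    · simp
  · refine AlgHom.ext fun y => ?_
    obtain ⟨x, rfl⟩ := φ.surjective y
    have h1 := congrArg (Algebra.TensorProduct.map φ.toAlgHom (.id K K))
      (DFunLike.congr_fun h.lTensor_counit x)
    simp only [AlgHom.comp_apply, hc] at h1 ⊢
    refine Eq.trans ?_ (h1.trans ?_)
    · generalize Δ x = z
      induction z with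
      | zero => simp
      | add a b ha hb => simp only [map_add, ha, hb]
      | tmul a b => simp [he]
    · simp
  · obtain ⟨α, h1, h2⟩ := h.exists_antipode
    refine ⟨φ.toLinearMap ∘ₗ α ∘ₗ φ.symm.toLinearMap, LinearMap.ext fun y => ?_,
      LinearMap.ext fun y => ?_⟩
    all_goals obtain ⟨x, rfl⟩ := φ.surjective y
    · have h3 := congrArg φ (DFunLike.congr_fun h1 x)
      simp only [LinearMap.comp_apply, AlgHom.toLinearMap_apply, hc, he] at h3 ⊢
      refine Eq.trans ?_ (h3.trans ?_)
      · generalize Δ x = z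
        induction z with
        | zero => simp
        | add a b ha hb => simp only [map_add, ha, hb]
        | tmul a b => simp
      · simp
    · have h3 := congrArg φ (DFunLike.congr_fun h2 x)
      simp only [LinearMap.comp_apply, AlgHom.toLinearMap_apply, hc, he] at h3 ⊢
      refine Eq.trans ?_ (h3.trans ?_)
      · generalize Δ x = z
        induction z with
        | zero => simp
        | add a b ha hb => simp only [map_add, ha, hb]
        | tmul a b => simp
      · simp

end Transport

/-! ### Polynomial realization and conclusion -/

theorem ForestAlphabet.sum_assoc {S : ℕ → Type u} (A B C : ForestAlphabet S) :
    ForestAlphabet.IsIso ((A.sum B).sum C) (A.sum (B.sum C)) (Equiv.sumAssoc _ _ _) where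
  root_iff := by rintro ((a | b) | c) <;> exact Iff.rfl
  deco_iff g := by rintro ((a | b) | c) <;> exact Iff.rfl
  edge_iff j := by rintro ((a | b) | c) ((a' | b') | c') <;> exact Iff.rfl

/-- All representatives of a word have the degree of that word, and compatible words have as many
letters as there are nodes. -/
theorem masRealization_isHomogeneous (K : Type v) [Field K] {S : ℕ → Type u}
    [Finite (Σ n, S n)] (A : ForestAlphabet S) (n : ℕ) {x : (MAs S).Natural K}
    (hx : x ∈ (MAs S).homogeneous K (MAs.deg S) n) :
    NCPoly.IsHomogeneous n (masRealization K A x) := by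
  induction hx using Submodule.span_induction with
  | mem x h =>
    obtain ⟨y, hy, rfl⟩ := h
    intro l hl
    rw [masRealization_E]
    refine (coeff_sum_NCPoly K _ _ _).trans (Finset.sum_eq_zero fun f _ => ?_)
    refine coeff_forestPoly_of_length K A f.1 l fun h => hl ?_
    have h1 := congrArg (List.map (MAs.deg S)) f.2
    rw [h, ← hy, SForest.deg]
    refine congrArg List.sum (Eq.trans ?_ (h1.trans ?_))
    · exact (List.map_map (f := (masCongr S).cls) (g := MAs.deg S)).symm
    · exact List.map_map ..
  | zero =>
    intro l _
    rw [map_zero]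
    rfl
  | add x y _ _ hx hy =>
    intro l hl
    rw [map_add]
    exact (congrArg₂ (· + ·) (hx l hl) (hy l hl)).trans (add_zero _)
  | smul c x _ hx =>
    intro l hl
    rw [map_smul]
    exact (congrArg (c * ·) (hx l hl)).trans (mul_zero _)

theorem mainTheorem7 (K : Type v) [Field K] [CharZero K] (r s : ℕ) (S : ℕ → Type u)
    (hS : HasProfile S r s) :
    (MAs S).FinitelyFactorizable ∧ (MAs S).IsGrading (MAs.deg S) ∧ (masCongr S).FiniteType ∧
    IsHopfAlgebra ((MAs S).comul K) ((MAs S).counit K) ∧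
    (∃ V : Subalgebra K (NCPoly K (ForestAlphabet.lengthAlphabet S).carrier),
      Subalgebra.toSubmodule V =
        LinearMap.range (masRealization K (ForestAlphabet.lengthAlphabet S)) ∧
      ∃ (ΔV : V →ₐ[K] V ⊗[K] V) (εV : V →ₐ[K] K),
        IsHopfAlgebra ΔV εV ∧
        (∀ (x : (MAs S).Natural K) (y : V),
          masRealization K (ForestAlphabet.lengthAlphabet S) x = y →
          NCPoly.tensorCoeff (TensorProduct.map V.val.toLinearMap V.val.toLinearMap (ΔV y)) =
            NCPoly.theta (A := (ForestAlphabet.lengthAlphabet S).carrier)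
              (B := (ForestAlphabet.lengthAlphabet S).carrier)
              (masRealization K
                ((ForestAlphabet.lengthAlphabet S).sum (ForestAlphabet.lengthAlphabet S)) x)) ∧
        ∃ φ : (MAs S).Natural K ≃ₐ[K] V,
          (∀ x, (φ x : NCPoly K (ForestAlphabet.lengthAlphabet S).carrier) =
            masRealization K (ForestAlphabet.lengthAlphabet S) x) ∧
          IsHopfIso ((MAs S).comul K) ((MAs S).counit K) ΔV εV φ) ∧
    IsPolynomialRealization ((MAs S).comul K) ((MAs S).homogeneous K (MAs.deg S))
      (masRealization K) (ForestAlphabet.lengthAlphabet S) := by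
  have := hS.finite_sigma
  have hfact : (MAs S).FinitelyFactorizable := MAs_finitelyFactorizable
  have hHopf : IsHopfAlgebra ((MAs S).comul K) ((MAs S).counit K) :=
    NSOperad.isHopfAlgebra (MAs_isGrading S) hfact
  have hinj := masRealization_injective K hS
  have hdoub : ∀ (A B : ForestAlphabet S) (x : (MAs S).Natural K),
      NCPoly.theta (A := A.carrier) (B := B.carrier) (masRealization K (A.sum B) x) =
        NCPoly.tensorCoeff (TensorProduct.map (masRealization K A) (masRealization K B)
          ((MAs S).comul K x)) := by
    intro A B x
    rw [masRealization_eq, masRealization_eq, masRealization_eq]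
    exact masRealizationHom_doubling K A B x
  refine ⟨hfact, MAs_isGrading S, masCongr_finiteType, hHopf, ?_, ForestAlphabet.sum_assoc,
    fun A n _ hx => masRealization_isHomogeneous K A n hx, hdoub, hinj⟩
  set 𝔸 := ForestAlphabet.lengthAlphabet S
  have hρ : ∀ x, masRealizationHom K 𝔸 x = masRealization K 𝔸 x := fun x => by
    rw [masRealization_eq]; rfl
  have hinj' : Function.Injective (masRealizationHom K 𝔸) := fun x y h =>
    hinj (((hρ x).symm.trans h).trans (hρ y))
  let φ := AlgEquiv.ofInjective (masRealizationHom K 𝔸) hinj'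
  have hφ : ∀ x, (φ x : NCPoly K 𝔸.carrier) = masRealization K 𝔸 x := hρ
  refine ⟨(masRealizationHom K 𝔸).range, by rw [masRealization_eq]; rfl,
    transportComul ((MAs S).comul K) φ, transportCounit ((MAs S).counit K) φ,
    hHopf.transport φ, fun x y hxy => ?_, φ, hφ, isHopfIso_transport _ _ φ⟩
  -- By doubling, the right side is the image under the realizations of the coproduct of `x`; the
  -- left side is the transported coproduct followed by the inclusion, and the two agree on pure
  -- tensors.
  obtain rfl : φ x = y := Subtype.ext ((hφ x).trans hxy)
  rw [(isHopfIso_transport _ ((MAs S).counit K) φ).map_comul, hdoub]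
  congr 1
  generalize (MAs S).comul K x = z
  induction z with
  | zero => simp
  | add a b ha hb => simp only [map_add, ha, hb]
  | tmul a b => exact congrArg₂ (· ⊗ₜ[K] ·) (hφ a) (hφ b)
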